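/- Let $\Bbbk$ be a field, let $Q$ be a quiver with source and target maps $s,t$, let $R$ be a set of paths of length $2$ in $Q$, let $I$ be the two-sided ideal of the path algebra $\Bbbk Q$ generated by $R$, and let $A=\Bbbk Q/I$. Paths are written from right to left. Let $\mathcal B$ be the set of paths that have no subpath in $R$, let $\Gamma$ be the set of paths all of whose subpaths of length $2$ are in $R$, and let $\Gamma_m$ be the set of elements of $\Gamma$ of length $m$. Let $\mathcal B\odot\Gamma_m$ be the set of pairs $(\alpha,\gamma)\in\mathcal B\times\Gamma_m$ with $s(\alpha)=t(\gamma)$ and $t(\alpha)=s(\gamma)$, and let $\Bbbk(\mathcal B\odot\Gamma)$ be the complex that in degree $m\ge0$ is the vector space with basis $\mathcal B\odot\Gamma_m$ and whose differential is, for $m\ge1$, $$d_m(\alpha,c_m\cdots c_1)=(\alpha c_m,\;c_{m-1}\cdots c_1)+(-1)^m\,(c_1\alpha,\;c_m\cdots c_2),$$ where a pair whose first component is not in $\mathcal B$ stands for $0$. The maps $(\alpha,c_m\cdots c_1)\mapsto\alpha\otimes c_m\otimes\cdots\otimes c_1$ form a morphism of complexes from $\Bbbk(\mathcal B\odot\Gamma)$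 to the Hochschild complex $(A^{\otimes(m+1)},b)_{m\ge0}$, whose homology is $HH_*(A)$. Below, that the homology classes of certain chains of $\Bbbk(\mathcal B\odot\Gamma)$ freely span $HH_m(A)$ means that these chains are cycles, that their classes form a basis of $H_m(\Bbbk(\mathcal B\odot\Gamma))$, and that the classes of their images form a basis of $HH_m(A)$ (so that the morphism identifies the two spaces). A cycle is a path $C=c_l\cdots c_1$ of length $l\ge1$ with $s(C)=t(C)$; put $\mathrm{rot}(C)=c_{l-1}\cdots c_1c_l$. The period of $C$ is the least $r\ge1$ with $\mathrm{rot}^r(C)=C$. A circuit is an equivalence class of cycles under repeated rotation; its length and its period are those of its cycles. A cycle $C$ is complete if $C^2\in\Gamma$ and cocomplete if $C^2\in\mathcal B$, and a circuit is complete or cocomplete if the cycles it contains are. For every circuit $C$ choose, arbitrarily, a cycle $\bar C$ in $C$. 1. $HH_0(A)$ is freely spanned by the homology classes of the pairs $(e,e)$, one for each vertex $e$ of $Q$; the pairs $(\bar C,s(\bar C))$, one for each cocomplete circuit $C$; and the pairs $(a,s(a))$, one for each loop $a$ in $Q$ such that $a^2\in I$. 2. $HH_1(A)$ is freely spanned by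 the homology classes of * the sums $\sum_{i=0}^{r-1}(\alpha_i,a_i)$, one for each cocomplete circuit $C$, where $r$ is the period of $C$, $a_i$ is the first arrow of $\mathrm{rot}^i(\bar C)$ and $\mathrm{rot}^i(\bar C)=\alpha_ia_i$; * the pairs $(s(a),a)$, one for each loop $a$ such that $a^2\in I$; * the pairs $(c_2,c_1)$, where $\bar C=c_2c_1$, one for each complete circuit $C$ of length $2$ whose period $r$ is such that $(-1)^r=1$ in $\Bbbk$. 3. If $m\ge2$, then $HH_m(A)$ is freely spanned by the homology classes of * the sums $\sum_{i=0}^{r-1}(-1)^{(m+1)i}\,\bigl(s(\mathrm{rot}^i(\bar C)),\mathrm{rot}^i(\bar C)\bigr)$, one for each complete circuit $C$ of length $m$ whose period $r$ is such that $(-1)^{(m+1)r}=1$ in $\Bbbk$; * the pairs $(c_{m+1},\,c_m\cdots c_1)$, where $\bar C=c_{m+1}c_m\cdots c_1$, one for each complete circuit $C$ of length $m+1$ whose period $r$ is such that $(-1)^{mr}=1$ in $\Bbbk$. -/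

import Mathlib

open scoped TensorProduct

noncomputable section

namespace QuadraticMonomial

/-! ## Homology of a sequence of linear maps, and bases made of homology classes -/

section Homology

variable {k : Type*} [Field k] {X : ℕ → Type*} [∀ n, AddCommGroup (X n)] [∀ n, Module k (X n)]

/-- The cycles of a chain complex `⋯ → X 2 → X 1 → X 0` in each degree. -/
def cycles (d : ∀ n, X (n + 1) →ₗ[k] X n) : ∀ n, Submodule k (X n)
  | 0 => ⊤
  | n + 1 => LinearMap.ker (d n)

/-- The boundaries of a chain complex `⋯ → X 2 → X 1 → X 0` in each degree. -/
def boundaries (d : ∀ n, X (n + 1) →ₗ[k] X n) (n : ℕ) : Submodule k (X n) :=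
  LinearMap.range (d n)

/-- The homology of a chain complex: cycles modulo boundaries. -/
abbrev Homology (d : ∀ n, X (n + 1) →ₗ[k] X n) (n : ℕ) : Type _ :=
  cycles d n ⧸ (boundaries d n).submoduleOf (cycles d n)

/-- The `n`-chains `z i` are cycles, and their homology classes, indexed by `ι`, form a basis of
the `n`-th homology space (in particular, they are different for different indices). -/
def HomologyFreelySpannedBy (d : ∀ n, X (n + 1) →ₗ[k] X n) (n : ℕ) {ι : Type*}
    (z : ι → X n) : Prop :=
  ∃ hz : ∀ i, z i ∈ cycles d n, ∃ b : Module.Basis ι k (Homology d n),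
    ∀ i, b i = Submodule.Quotient.mk ⟨z i, hz i⟩

end Homology

/-! ## The Hochschild complex of an algebra -/

section Hochschild

variable (k : Type*) [Field k] (A : Type*) [NonUnitalRing A] [Module k A]
  [IsScalarTower k A A] [SMulCommClass k A A]

/-- The tuple `(x_m x_0, x_1, …, x_{m-1})` obtained from `(x_0, x_1, …, x_m)`. -/
def cyclicFace {A : Type*} [Mul A] {m : ℕ} (x : Fin (m + 2) → A) : Fin (m + 1) → A :=
  fun j => if j = 0 then x (Fin.last (m + 1)) * x 0 else x j.castSucc

/-- A map between tuples such that changing one entry of the input changes at most one entry of the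
output, and does so linearly, induces a multilinear map to a tensor power. -/
def tprodComp {m n : ℕ} (f : (Fin m → A) → (Fin n → A))
    (hf : ∀ (x : Fin m → A) (j : Fin m), ∃ (i : Fin n) (L : A →ₗ[k] A), ∀ v,
      f (Function.update x j v) = Function.update (f x) i (L v)) :
    MultilinearMap k (fun _ : Fin m => A) (⨂[k] _ : Fin n, A) :=
  MultilinearMap.mk' (fun x => PiTensorProduct.tprod k (f x))
    (fun x j v w => by
      obtain ⟨i, L, h⟩ := hf x j
      simp only [h, map_add, MultilinearMap.map_update_add])
    (fun x j c v => by
      obtain ⟨i, L, h⟩ := hf x j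
      simp only [h, map_smul, MultilinearMap.map_update_smul])

theorem contractNth_update {m : ℕ} (i : Fin (m + 1)) (x : Fin (m + 2) → A) (j : Fin (m + 2)) :
    ∃ (i' : Fin (m + 1)) (L : A →ₗ[k] A), ∀ v,
      Fin.contractNth i.castSucc (· * ·) (Function.update x j v) =
        Function.update (Fin.contractNth i.castSucc (· * ·) x) i' (L v) := by
  rcases lt_trichotomy (j : ℕ) i with h | h | h
  · refine ⟨⟨j, by omega⟩, LinearMap.id, fun v => ?_⟩
    funext l
    simp only [Fin.contractNth, Function.update_apply, Fin.ext_iff, Fin.val_castSucc, Fin.val_succ,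
      LinearMap.id_apply]
    split_ifs <;> first | rfl | omega
  · refine ⟨i, LinearMap.mulRight k (x i.succ), fun v => ?_⟩
    funext l
    simp only [Fin.contractNth, Function.update_apply, Fin.ext_iff, Fin.val_castSucc, Fin.val_succ,
      LinearMap.mulRight_apply]
    split_ifs with h1 h2 h3 h4 h5 h6 <;> first | rfl | omega | (congr 2; ext; simp; omega)
  · by_cases h' : (j : ℕ) = i + 1
    · refine ⟨i, LinearMap.mulLeft k (x i.castSucc), fun v => ?_⟩
      funext l
      simp only [Fin.contractNth, Function.update_apply, Fin.ext_iff, Fin.val_castSucc,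
        Fin.val_succ, LinearMap.mulLeft_apply]
      split_ifs with h1 h2 h3 h4 h5 h6 <;> first | rfl | omega | (congr 2; ext; simp; omega)
    · refine ⟨⟨j - 1, by omega⟩, LinearMap.id, fun v => ?_⟩
      funext l
      simp only [Fin.contractNth, Function.update_apply, Fin.ext_iff, Fin.val_castSucc,
        Fin.val_succ, LinearMap.id_apply]
      split_ifs <;> first | rfl | omega

theorem cyclicFace_update {m : ℕ} (x : Fin (m + 2) → A) (j : Fin (m + 2)) :
    ∃ (i' : Fin (m + 1)) (L : A →ₗ[k] A), ∀ v,
      cyclicFace (Function.update x j v) = Function.update (cyclicFace x) i' (L v) := by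
  by_cases h0 : (j : ℕ) = 0
  · refine ⟨0, LinearMap.mulLeft k (x (Fin.last _)), fun v => ?_⟩
    funext l
    simp only [cyclicFace, Function.update_apply, Fin.ext_iff, Fin.val_castSucc, Fin.val_last,
      Fin.val_zero, LinearMap.mulLeft_apply]
    split_ifs <;> first | rfl | omega
  · by_cases h1 : (j : ℕ) = m + 1
    · refine ⟨0, LinearMap.mulRight k (x 0), fun v => ?_⟩
      funext l
      simp only [cyclicFace, Function.update_apply, Fin.ext_iff, Fin.val_castSucc, Fin.val_last,
        Fin.val_zero, LinearMap.mulRight_apply]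
      split_ifs <;> first | rfl | omega
    · refine ⟨⟨j, by omega⟩, LinearMap.id, fun v => ?_⟩
      funext l
      simp only [cyclicFace, Function.update_apply, Fin.ext_iff, Fin.val_castSucc, Fin.val_last,
        Fin.val_zero, LinearMap.id_apply]
      split_ifs <;> first | rfl | omega

/-- The differential of the Hochschild complex of `A`, with `A^{⊗(m+1)}` in degree `m`:
`b(x_0 ⊗ ⋯ ⊗ x_{m+1})` is the sum of `(-1)^i x_0 ⊗ ⋯ ⊗ x_i x_{i+1} ⊗ ⋯ ⊗ x_{m+1}`
for `0 ≤ i ≤ m` and of `(-1)^{m+1} x_{m+1} x_0 ⊗ x_1 ⊗ ⋯ ⊗ x_m`.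

No unit is needed to write this down. The homology of this complex is the Hochschild homology
of `A` when `A` is unital and, more generally, when `A` has local units. -/
def hochschildD (m : ℕ) : (⨂[k] _ : Fin (m + 2), A) →ₗ[k] (⨂[k] _ : Fin (m + 1), A) :=
  PiTensorProduct.lift
    (∑ i : Fin (m + 1), (-1 : k) ^ (i : ℕ) •
        tprodComp k A (Fin.contractNth i.castSucc (· * ·)) (contractNth_update k A i)
      + (-1 : k) ^ (m + 1) • tprodComp k A cyclicFace (cyclicFace_update k A))

end Hochschild

/-! ## Paths in a quiver -/

section Paths

variable {V : Type*} [Quiver V]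

/-- `IsWalk v [c_m, …, c_1] w`: the arrows compose, from right to left, to a path `c_m ⋯ c_1`
from `w` to `v`. -/
def IsWalk : V → List (Quiver.Total V) → V → Prop
  | v, [], w => v = w
  | v, a :: l, w => a.right = v ∧ IsWalk a.left l w

variable (V) in
/-- A path `c_m ⋯ c_1` in a quiver, written from right to left like a composition of maps, so that
`arrows = [c_m, …, c_1]`; if there are no arrows, it is the trivial path at a vertex. -/
@[ext]
structure QPath where
  tgt : V
  arrows : List (Quiver.Total V)
  src : V
  isWalk : IsWalk tgt arrows src

theorem IsWalk.append {u v w : V} {l l' : List (Quiver.Total V)} (h : IsWalk u l v)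
    (h' : IsWalk v l' w) : IsWalk u (l ++ l') w := by
  induction l generalizing u with
  | nil => cases h; exact h'
  | cons a l ih => exact ⟨h.1, ih h.2⟩

theorem IsWalk.dropLast {u v : V} {l : List (Quiver.Total V)} (h : IsWalk u l v) (hl : l ≠ []) :
    IsWalk u l.dropLast (l.getLast hl).right := by
  induction l generalizing u with
  | nil => exact absurd rfl hl
  | cons a l ih =>
    cases l with
    | nil => exact h.1.symm
    | cons b l => exact ⟨h.1, ih h.2 (by simp)⟩

theorem IsWalk.getLast {u v : V} {l : List (Quiver.Total V)} (h : IsWalk u l v) (hl : l ≠ []) :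
    (l.getLast hl).left = v := by
  induction l generalizing u with
  | nil => exact absurd rfl hl
  | cons a l ih =>
    cases l with
    | nil => exact h.2
    | cons b l => exact ih h.2 (by simp)

theorem IsWalk.head {u v : V} {l : List (Quiver.Total V)} (h : IsWalk u l v) (hl : l ≠ []) :
    (l.head hl).right = u := by
  cases l with
  | nil => exact absurd rfl hl
  | cons a l => exact h.1

theorem IsWalk.tail {u v : V} {l : List (Quiver.Total V)} (h : IsWalk u l v) (hl : l ≠ []) :
    IsWalk (l.head hl).left l.tail v := by
  cases l with
  | nil => exact absurd rfl hl
  | cons a l => exact h.2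

namespace QPath

/-- The length of a path. -/
def length (p : QPath V) : ℕ := p.arrows.length

/-- The trivial path at a vertex. -/
def triv (e : V) : QPath V := ⟨e, [], e, rfl⟩

/-- An arrow, as a path of length one. -/
def ofArrow (a : Quiver.Total V) : QPath V := ⟨a.right, [a], a.left, rfl, rfl⟩

/-- The concatenation `pq` (first `q`, then `p`). -/
def comp (p q : QPath V) (h : p.src = q.tgt) : QPath V :=
  ⟨p.tgt, p.arrows ++ q.arrows, q.src, p.isWalk.append (h ▸ q.isWalk)⟩

/-- The last arrow `c_m` of `c_m ⋯ c_1`. -/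
def lastArrow (p : QPath V) (hp : p.arrows ≠ []) : QPath V := ofArrow (p.arrows.head hp)

/-- The path `c_{m-1} ⋯ c_1` obtained from `c_m ⋯ c_1` by removing its last arrow. -/
def dropLastArrow (p : QPath V) (hp : p.arrows ≠ []) : QPath V :=
  ⟨(p.arrows.head hp).left, p.arrows.tail, p.src, p.isWalk.tail hp⟩

/-- The first arrow `c_1` of `c_m ⋯ c_1`. -/
def firstArrow (p : QPath V) (hp : p.arrows ≠ []) : QPath V := ofArrow (p.arrows.getLast hp)

/-- The path `c_m ⋯ c_2` obtained from `c_m ⋯ c_1` by removing its first arrow. -/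
def dropFirstArrow (p : QPath V) (hp : p.arrows ≠ []) : QPath V :=
  ⟨p.tgt, p.arrows.dropLast, (p.arrows.getLast hp).right, p.isWalk.dropLast hp⟩

/-- `q` is a subpath of `p`, that is, `p = uqv` for some paths `u` and `v`. -/
def IsSubpath (q p : QPath V) : Prop :=
  ∃ (u v : QPath V) (hu : u.src = q.tgt) (hv : (u.comp q hu).src = v.tgt),
    p = (u.comp q hu).comp v hv

end QPath

/-- The paths that have no subpath in `R`. -/
def pathsB (R : Set (QPath V)) : Set (QPath V) :=
  {p | ∀ q, q.IsSubpath p → q ∉ R}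

/-- The paths all of whose subpaths of length two are in `R`. -/
def pathsΓ (R : Set (QPath V)) : Set (QPath V) :=
  {p | ∀ q, q.IsSubpath p → q.length = 2 → q ∈ R}

end Paths

/-! ## Cycles and circuits -/

section Circuits

variable (V : Type*) [Quiver V]

/-- A cycle in a quiver: a path of positive length that ends where it begins. -/
@[ext]
structure Cyc where
  path : QPath V
  ne_nil : path.arrows ≠ []
  closed : path.src = path.tgt

variable {V}

namespace Cyc

/-- The rotation `c_{m-1} ⋯ c_1 c_m` of a cycle `c_m ⋯ c_1`. -/
def rot (C : Cyc V) : Cyc V where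
  path := (C.path.dropLastArrow C.ne_nil).comp (C.path.lastArrow C.ne_nil)
    (C.closed.trans (C.path.isWalk.head C.ne_nil).symm)
  ne_nil := by simp [QPath.comp, QPath.lastArrow, QPath.ofArrow]
  closed := rfl

theorem ext_arrows {C D : Cyc V} (h : C.path.arrows = D.path.arrows) : C = D := by
  obtain ⟨⟨u, l, v, hw⟩, hn, hc⟩ := C
  obtain ⟨⟨u', l', v', hw'⟩, hn', hc'⟩ := D
  obtain rfl : l = l' := h
  have e1 : u = u' := (hw.head hn).symm.trans (hw'.head hn)
  have e2 : v = v' := (hw.getLast hn).symm.trans (hw'.getLast hn)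
  subst e1 e2
  rfl

theorem rot_iterate_arrows (C : Cyc V) (n : ℕ) :
    (rot^[n] C).path.arrows = C.path.arrows.rotate n := by
  induction n with
  | zero => simp
  | succ n ih =>
    rw [Function.iterate_succ_apply', ← List.rotate_rotate, ← ih]
    have h := (rot^[n] C).ne_nil
    obtain ⟨a, l, hl⟩ := List.exists_cons_of_ne_nil h
    simp [rot, QPath.comp, QPath.dropLastArrow, QPath.lastArrow, QPath.ofArrow, hl]

/-- The period of a cycle: the least positive `i` with `rot^i(C) = C`. It is the length of the
primitive cycle of which `C` is a power. -/
def period (C : Cyc V) : ℕ := Function.minimalPeriod rot C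

variable (V) in
/-- Two cycles are conjugate if one can be obtained from the other by repeated rotation. -/
def conj : Setoid (Cyc V) where
  r C D := ∃ n : ℕ, rot^[n] C = D
  iseqv :=
    { refl := fun C => ⟨0, rfl⟩
      symm := by
        rintro C D ⟨n, rfl⟩
        refine ⟨n * C.path.arrows.length - n, ext_arrows ?_⟩
        have hpos : 0 < C.path.arrows.length := List.length_pos_iff.2 C.ne_nil
        have hle : n ≤ n * C.path.arrows.length := Nat.le_mul_of_pos_right n hpos
        rw [rot_iterate_arrows, rot_iterate_arrows, List.rotate_rotate, Nat.add_sub_cancel' hle,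
          Nat.mul_comm, List.rotate_length_mul]
      trans := by
        rintro C D E ⟨n, rfl⟩ ⟨m, rfl⟩
        exact ⟨m + n, Function.iterate_add_apply _ _ _ _⟩ }

/-- A cycle is complete if its square is in `Γ`. -/
def IsComplete (R : Set (QPath V)) (C : Cyc V) : Prop :=
  C.path.comp C.path C.closed ∈ pathsΓ R

/-- A cycle is cocomplete if its square is in `B`. -/
def IsCocomplete (R : Set (QPath V)) (C : Cyc V) : Prop :=
  C.path.comp C.path C.closed ∈ pathsB R

end Cyc

variable (V) in
/-- The circuits of a quiver: the conjugacy classes of cycles. -/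
def Circuit : Type _ := Quotient (Cyc.conj V)

/-- The circuit of a cycle. -/
def Cyc.circuit (C : Cyc V) : Circuit V := Quotient.mk (Cyc.conj V) C

/-- A circuit is complete if the cycles it contains are. -/
def Circuit.IsComplete (R : Set (QPath V)) (C : Circuit V) : Prop :=
  ∀ D : Cyc V, D.circuit = C → D.IsComplete R

/-- A circuit is cocomplete if the cycles it contains are. -/
def Circuit.IsCocomplete (R : Set (QPath V)) (C : Circuit V) : Prop :=
  ∀ D : Cyc V, D.circuit = C → D.IsCocomplete R

/-- The length of a circuit is that of any of the cycles it contains. -/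
def Circuit.HasLength (C : Circuit V) (m : ℕ) : Prop :=
  ∀ D : Cyc V, D.circuit = C → D.path.length = m

/-- The period of a circuit is that of any of the cycles it contains. -/
def Circuit.HasPeriod (C : Circuit V) (r : ℕ) : Prop :=
  ∀ D : Cyc V, D.circuit = C → D.period = r

end Circuits

/-! ## The path algebra and its quotient by a set of paths -/

section Algebra

variable (k : Type*) [Field k] (V : Type*) [Quiver V]

/-- The path algebra: the vector space with basis the set of all paths, multiplied by
concatenation. It is unital exactly when the quiver has finitely many vertices. -/
def PathAlgebra : Type _ := QPath V →₀ k

namespace PathAlgebra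

instance : AddCommGroup (PathAlgebra k V) := inferInstanceAs (AddCommGroup (QPath V →₀ k))
instance : Module k (PathAlgebra k V) := inferInstanceAs (Module k (QPath V →₀ k))

variable {V} in
/-- A path, as an element of the path algebra. -/
def ofPath (p : QPath V) : PathAlgebra k V := Finsupp.single p (1 : k)

open Classical in
/-- The multiplication of the path algebra: the product of two paths is their concatenation if
there is one, and zero otherwise. -/
def mulMap : PathAlgebra k V →ₗ[k] PathAlgebra k V →ₗ[k] PathAlgebra k V :=
  Finsupp.linearCombination k fun p : QPath V => Finsupp.linearCombination k fun q : QPath V =>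
    if h : p.src = q.tgt then ofPath k (p.comp q h) else 0

instance : Mul (PathAlgebra k V) := ⟨fun x y => mulMap k V x y⟩

variable {k V}

theorem mul_def (x y : PathAlgebra k V) : x * y = mulMap k V x y := rfl

open Classical in
theorem ofPath_mul_ofPath (p q : QPath V) :
    mulMap k V (ofPath k p) (ofPath k q) =
      if h : p.src = q.tgt then ofPath k (p.comp q h) else 0 := by
  have h1 : mulMap k V (ofPath k p) = Finsupp.linearCombination k fun q : QPath V =>
      if h : p.src = q.tgt then ofPath k (p.comp q h) else 0 := by
    refine (Finsupp.linearCombination_single k (1 : k) p).trans ?_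
    exact one_smul k _
  rw [h1]
  refine (Finsupp.linearCombination_single k (1 : k) q).trans ?_
  exact one_smul k _

theorem span_ofPath : Submodule.span k (Set.range (ofPath k : QPath V → PathAlgebra k V)) = ⊤ := by
  refine eq_top_iff.2 fun x _ => ?_
  change QPath V →₀ k at x
  induction x using Finsupp.induction_linear with
  | zero => exact Submodule.zero_mem _
  | add x y hx hy => exact Submodule.add_mem _ (hx trivial) (hy trivial)
  | single p c =>
    have : (Finsupp.single p c : QPath V →₀ k) = c • (ofPath k p : PathAlgebra k V) :=
      (Finsupp.smul_single_one p c).symm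
    rw [this]
    exact Submodule.smul_mem _ _ (Submodule.subset_span ⟨p, rfl⟩)

protected theorem induction {P : PathAlgebra k V → Prop} (h0 : P 0)
    (hadd : ∀ x y, P x → P y → P (x + y)) (hsmul : ∀ (c : k) x, P x → P (c • x))
    (hp : ∀ p, P (ofPath k p)) (x : PathAlgebra k V) : P x := by
  have hx : x ∈ Submodule.span k (Set.range (ofPath k : QPath V → PathAlgebra k V)) := by
    rw [span_ofPath]; trivial
  refine Submodule.span_induction (p := fun y _ => P y) ?_ h0 (fun x y _ _ => hadd x y)
    (fun c x _ => hsmul c x) hx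
  rintro _ ⟨p, rfl⟩
  exact hp p

theorem mul_assoc_aux (x y z : PathAlgebra k V) :
    mulMap k V (mulMap k V x y) z = mulMap k V x (mulMap k V y z) := by
  induction x using PathAlgebra.induction with
  | h0 => simp
  | hadd _ _ h1 h2 => simp [h1, h2]
  | hsmul c _ h => simp [h]
  | hp p =>
    induction y using PathAlgebra.induction with
    | h0 => simp
    | hadd _ _ h1 h2 => simp [h1, h2]
    | hsmul c _ h => simp [h]
    | hp q =>
      induction z using PathAlgebra.induction with
      | h0 => simp
      | hadd _ _ h1 h2 => simp [h1, h2]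
      | hsmul c _ h => simp [h]
      | hp r =>
        rw [ofPath_mul_ofPath, ofPath_mul_ofPath]
        by_cases h1 : p.src = q.tgt <;> by_cases h2 : q.src = r.tgt
        · rw [dif_pos h1, dif_pos h2, ofPath_mul_ofPath, ofPath_mul_ofPath, dif_pos, dif_pos]
          · congr 1
            ext1 <;> simp [QPath.comp]
          · exact h1
          · exact h2
        · rw [dif_pos h1, dif_neg h2, ofPath_mul_ofPath, dif_neg, map_zero]
          exact h2
        · rw [dif_neg h1, dif_pos h2, ofPath_mul_ofPath, dif_neg, map_zero, LinearMap.zero_apply]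
          exact h1
        · rw [dif_neg h1, dif_neg h2, map_zero, map_zero, LinearMap.zero_apply]

instance : NonUnitalRing (PathAlgebra k V) where
  left_distrib x y z := by simp only [mul_def, map_add]
  right_distrib x y z := by simp only [mul_def, map_add, LinearMap.add_apply]
  zero_mul x := by simp only [mul_def, map_zero, LinearMap.zero_apply]
  mul_zero x := by simp only [mul_def, map_zero]
  mul_assoc := mul_assoc_aux

instance : IsScalarTower k (PathAlgebra k V) (PathAlgebra k V) where
  smul_assoc c x y := by simp only [smul_eq_mul, mul_def, map_smul, LinearMap.smul_apply]

instance : SMulCommClass k (PathAlgebra k V) (PathAlgebra k V) where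
  smul_comm c x y := by simp only [smul_eq_mul, mul_def, map_smul]

/-- The path algebra has local units. -/
theorem exists_local_unit (x : PathAlgebra k V) :
    ∃ s : Finset V, ∀ t : Finset V, s ⊆ t → (∑ e ∈ t, ofPath k (QPath.triv e)) * x = x := by
  classical
  induction x using PathAlgebra.induction with
  | h0 => exact ⟨∅, fun t _ => mul_zero _⟩
  | hadd x y hx hy =>
    obtain ⟨s, hs⟩ := hx
    obtain ⟨s', hs'⟩ := hy
    refine ⟨s ∪ s', fun t ht => ?_⟩
    rw [mul_add, hs t (Finset.union_subset_left ht), hs' t (Finset.union_subset_right ht)]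
  | hsmul c x hx =>
    obtain ⟨s, hs⟩ := hx
    exact ⟨s, fun t ht => by rw [mul_smul_comm, hs t ht]⟩
  | hp p =>
    refine ⟨{p.tgt}, fun t ht => ?_⟩
    rw [Finset.sum_mul, Finset.sum_eq_single p.tgt]
    · rw [mul_def, ofPath_mul_ofPath, dif_pos (show (QPath.triv p.tgt).src = p.tgt from rfl)]
      congr 1
    · intro e _ he
      rw [mul_def, ofPath_mul_ofPath, dif_neg (show ¬ (QPath.triv e).src = p.tgt from he)]
    · intro h
      exact absurd (ht (Finset.mem_singleton_self _)) h

end PathAlgebra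

variable {V}

/-- The two-sided ideal of the path algebra generated by a set of paths. -/
def relIdeal (R : Set (QPath V)) : TwoSidedIdeal (PathAlgebra k V) :=
  TwoSidedIdeal.span (PathAlgebra.ofPath k '' R)

/-- The quotient of the path algebra by the ideal generated by a set of paths. -/
def MonomialAlgebra (R : Set (QPath V)) : Type _ := (relIdeal k R).ringCon.Quotient

namespace MonomialAlgebra

variable {k}
variable (R : Set (QPath V))

instance : NonUnitalRing (MonomialAlgebra k R) :=
  inferInstanceAs (NonUnitalRing (relIdeal k R).ringCon.Quotient)

/-- The canonical projection from the path algebra. -/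
def mk (x : PathAlgebra k V) : MonomialAlgebra k R := (relIdeal k R).ringCon.toQuotient x

theorem mk_surjective : Function.Surjective (mk R : PathAlgebra k V → MonomialAlgebra k R) :=
  Quotient.mk''_surjective

theorem smul_compat (c : k) {x y : PathAlgebra k V} (h : (relIdeal k R).ringCon x y) :
    (relIdeal k R).ringCon (c • x) (c • y) := by
  classical
  obtain ⟨s, hs⟩ := PathAlgebra.exists_local_unit x
  obtain ⟨s', hs'⟩ := PathAlgebra.exists_local_unit y
  have hx := hs (s ∪ s') Finset.subset_union_left
  have hy := hs' (s ∪ s') Finset.subset_union_right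
  have := (relIdeal k R).ringCon.mul
    ((relIdeal k R).ringCon.refl (c • ∑ e ∈ s ∪ s', PathAlgebra.ofPath k (QPath.triv e))) h
  rwa [smul_mul_assoc, smul_mul_assoc, hx, hy] at this

/-- Scalars act on the quotient as they do on the path algebra. -/
instance : SMul k (MonomialAlgebra k R) :=
  ⟨fun c => Quotient.map' (fun x : PathAlgebra k V => c • x) fun _ _ h => smul_compat R c h⟩

theorem mk_smul (c : k) (x : PathAlgebra k V) : mk R (c • x) = c • mk R x := rfl

theorem mk_mul (x y : PathAlgebra k V) : mk R (x * y) = mk R x * mk R y := rfl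

/-- The canonical projection, as an additive map. -/
def mkAddHom : PathAlgebra k V →+ MonomialAlgebra k R where
  toFun := mk R
  map_zero' := rfl
  map_add' _ _ := rfl

instance : Module k (MonomialAlgebra k R) :=
  Function.Surjective.module k (mkAddHom R) (mk_surjective R) (mk_smul R)

instance : IsScalarTower k (MonomialAlgebra k R) (MonomialAlgebra k R) where
  smul_assoc c x y := by
    obtain ⟨x, rfl⟩ := mk_surjective R x
    obtain ⟨y, rfl⟩ := mk_surjective R y
    simp only [smul_eq_mul, ← mk_smul, ← mk_mul, smul_mul_assoc]

instance : SMulCommClass k (MonomialAlgebra k R) (MonomialAlgebra k R) where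
  smul_comm c x y := by
    obtain ⟨x, rfl⟩ := mk_surjective R x
    obtain ⟨y, rfl⟩ := mk_surjective R y
    simp only [smul_eq_mul, ← mk_smul, ← mk_mul, mul_smul_comm]

end MonomialAlgebra

end Algebra

/-! ## The complex `k(B ⊙ Γ)` -/

section Complex

variable (k : Type*) [Field k] {V : Type*} [Quiver V] (R : Set (QPath V))

/-- The set `B ⊙ Γ_m` of the pairs `(α, γ)` of antiparallel paths with `α` in `B` and `γ` in `Γ` of
length `m`. -/
def pairs (m : ℕ) : Set (QPath V × QPath V) :=
  {x | x.1 ∈ pathsB R ∧ x.2 ∈ pathsΓ R ∧ x.2.length = m ∧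
    x.1.src = x.2.tgt ∧ x.1.tgt = x.2.src}

/-- The component of degree `m` of the complex: the vector space with basis `B ⊙ Γ_m`. -/
abbrev Chains (m : ℕ) : Type _ := pairs R m →₀ k

open Classical in
/-- The basis element `(α, γ)` if the pair is in `B ⊙ Γ_m`, and zero otherwise. -/
def pair (m : ℕ) (α γ : QPath V) : Chains k R m :=
  if h : (α, γ) ∈ pairs R m then Finsupp.single ⟨(α, γ), h⟩ 1 else 0

variable {R} in
theorem pairs_ne_nil {m : ℕ} (x : pairs R (m + 1)) : x.1.2.arrows ≠ [] := by
  have h : x.1.2.arrows.length = m + 1 := x.2.2.2.1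
  intro h'
  simp [h'] at h

/-- The differential: `(α, c_{m+1} ⋯ c_1)` is sent to
`(α c_{m+1}, c_m ⋯ c_1) + (-1)^{m+1} (c_1 α, c_{m+1} ⋯ c_2)`, where a pair whose first component
is not in `B` stands for zero. -/
def chainsD (m : ℕ) : Chains k R (m + 1) →ₗ[k] Chains k R m :=
  Finsupp.linearCombination k fun x : pairs R (m + 1) =>
    pair k R m
      (x.1.1.comp (x.1.2.lastArrow (pairs_ne_nil x))
        (x.2.2.2.2.1.trans (x.1.2.isWalk.head (pairs_ne_nil x)).symm))
      (x.1.2.dropLastArrow (pairs_ne_nil x))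
    + (-1 : k) ^ (m + 1) •
      pair k R m
        ((x.1.2.firstArrow (pairs_ne_nil x)).comp x.1.1
          ((x.1.2.isWalk.getLast (pairs_ne_nil x)).trans x.2.2.2.2.2.symm))
        (x.1.2.dropFirstArrow (pairs_ne_nil x))

/-- The canonical comparison with the Hochschild complex of the algebra:
`(α, c_m ⋯ c_1)` is sent to `α ⊗ c_m ⊗ ⋯ ⊗ c_1`. -/
def toHochschild (m : ℕ) : Chains k R m →ₗ[k] ⨂[k] _ : Fin (m + 1), MonomialAlgebra k R :=
  Finsupp.linearCombination k fun x : pairs R m =>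
    PiTensorProduct.tprod k
      (Fin.cons (MonomialAlgebra.mk R (PathAlgebra.ofPath k x.1.1))
        (fun j : Fin m => MonomialAlgebra.mk R (PathAlgebra.ofPath k
          (QPath.ofArrow (x.1.2.arrows.get (Fin.cast x.2.2.2.1.symm j))))))

/-- The chains `z i` of degree `m` are cycles, their classes form a basis of the `m`-th homology
space of `k(B ⊙ Γ)`, and under the canonical comparison map also one of the `m`-th Hochschild
homology space of the algebra. -/
def HHFreelySpannedBy (m : ℕ) {ι : Type*} (z : ι → Chains k R m) : Prop :=
  HomologyFreelySpannedBy (X := fun n => Chains k R n) (chainsD k R) m z ∧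
  HomologyFreelySpannedBy (X := fun n => ⨂[k] _ : Fin (n + 1), MonomialAlgebra k R)
    (hochschildD k (MonomialAlgebra k R)) m (fun i => toHochschild k R m (z i))

/-- The pair `(e, e)` of trivial paths at a vertex. -/
def vertexPair (e : V) : Chains k R 0 := pair k R 0 (QPath.triv e) (QPath.triv e)

/-- The pair `(C, s(C))` of degree zero. -/
def cyclePair (C : Cyc V) : Chains k R 0 := pair k R 0 C.path (QPath.triv C.path.src)

/-- The loops `a` of the quiver such that `a^2` is in the ideal. -/
def squareZeroLoops : Set (Quiver.Total V) :=
  {a | ∃ h : (QPath.ofArrow a).src = (QPath.ofArrow a).tgt,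
    PathAlgebra.ofPath k ((QPath.ofArrow a).comp (QPath.ofArrow a) h) ∈ relIdeal k R}

/-- The pair `(a, s(a))` of degree zero. -/
def loopPairZero (a : Quiver.Total V) : Chains k R 0 :=
  pair k R 0 (QPath.ofArrow a) (QPath.triv a.left)

/-- The pair `(s(a), a)` of degree one. -/
def loopPairOne (a : Quiver.Total V) : Chains k R 1 :=
  pair k R 1 (QPath.triv a.left) (QPath.ofArrow a)

/-- The sum, over `0 ≤ i < r` with `r` the period of `C`, of the pairs `(c_l ⋯ c_2, c_1)` of degree
one with `c_l ⋯ c_1 = rot^i(C)`. -/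
def cocompleteSum (C : Cyc V) : Chains k R 1 :=
  ∑ i ∈ Finset.range C.period,
    pair k R 1 ((Cyc.rot^[i] C).path.dropFirstArrow (Cyc.rot^[i] C).ne_nil)
      ((Cyc.rot^[i] C).path.firstArrow (Cyc.rot^[i] C).ne_nil)

/-- The sum, over `0 ≤ i < r` with `r` the period of `C`, of the elements
`(-1)^{(m+1)i} (s(rot^i(C)), rot^i(C))` of degree `m`. -/
def completeSum (m : ℕ) (C : Cyc V) : Chains k R m :=
  ∑ i ∈ Finset.range C.period, (-1 : k) ^ ((m + 1) * i) •
    pair k R m (QPath.triv (Cyc.rot^[i] C).path.src) (Cyc.rot^[i] C).path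

/-- The pair `(c_{m+1}, c_m ⋯ c_1)` of degree `m`, for a cycle `C = c_{m+1} ⋯ c_1`. -/
def splitPair (m : ℕ) (C : Cyc V) : Chains k R m :=
  pair k R m (C.path.lastArrow C.ne_nil) (C.path.dropLastArrow C.ne_nil)

/-- The complete circuits of length `l` whose period `r` is such that `(-1)^{(l+1)r} = 1` in the
field `k`. -/
def signedCompleteCircuits (l : ℕ) : Set (Circuit V) :=
  {C | C.IsComplete R ∧ C.HasLength l ∧ ∃ r, C.HasPeriod r ∧ (-1 : k) ^ ((l + 1) * r) = 1}

end Complex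

end QuadraticMonomial

end

/-!
Two steps lead to the bases.

*From the Hochschild complex to the small one.* The classes of the paths without a subpath in `R`
form a basis of the algebra (`basisB`), so its tensor powers have bases made of tuples of such paths
and the Hochschild complex becomes the complex `hoch` on the span `CWords` of these tuples
(`hoch_toCWords`). It is obtained from the bar complex `bar` on words by closing up words
(`hoch_close`), so a contraction of the bar complex that leaves the two ends of the words alone
descends to it. The contraction `htpy` inserts a trivial path where the inner letters of a word
cease to be nontrivial and composable; if that never happens, it cuts an arrow off the first letter
that is not an arrow, provided that the products of neighbours up to it vanish. For this contraction, `deform = 1 - hoch ∘ chtpy - chtpy ∘ hoch` is the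
identity on the image of `k(B ⊙ Γ)` and sends every other tuple into this image up to tuples whose
inner letters have a smaller total length (`deform_cword_mem`). Hence some iterate of it moves any
given element into the image, and `k(B ⊙ Γ)` has the same homology as the Hochschild complex
(`HomologyFreelySpannedBy.hhFreelySpannedBy`). Only the non-unital ring structure and the local
units given by the trivial paths are used, so the quiver may be infinite.

*The homology of the small complex.* Apart from the pairs of trivial paths, a basis element `(α, γ)`
of degree `m` is the same as a cycle `D = αγ` that may be cut in two in such a way (`IsCut R m D`),
and the differential sends the basis element on `rot E` to the one on `rot E` plus or minus the one
on `E`, each of them being zero if that cycle cannot be cut in degree `m` (`chainsD_cut_rot`). So the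
complex is a direct sum over circuits, and which cuts exist depends on which of the cyclically
consecutive products of two arrows, the junctions, are relations. If a circuit has junctions of
both kinds, then each basis element on it either cancels against one of the next degree or is
determined by its neighbours, and the homology is zero (`ofCoord_eq_chainsD_of_not_isPure`). If all
junctions are of the same kind, the circuit is complete or cocomplete; its cycles can be cut in
exactly the same degrees, which are two consecutive ones, and the part of the complex on it is the
map `1 - δ • rot` on the space of functions on the orbit, with a sign `δ`. The kernel and the
cokernel of this map are one-dimensional if `δ` to the power of the period is `1`, and zero
otherwise; they are spanned by the sum over the orbit and by the class of any single cycle. This is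
`homologyFreelySpannedBy_chainsD`, where `classForm` provides linear forms dual to the classes.
-/

open scoped TensorProduct

noncomputable section

namespace QuadraticMonomial

/-! ### Paths as lists of arrows -/

section PathLists

variable {V : Type*} [Quiver V]

theorem isWalk_append {u w : V} {l l' : List (Quiver.Total V)} :
    IsWalk u (l ++ l') w ↔ ∃ v, IsWalk u l v ∧ IsWalk v l' w := by
  induction l generalizing u with
  | nil => simp [IsWalk]
  | cons a l ih => simp [IsWalk, ih, and_assoc]

theorem QPath.ext_arrows {p q : QPath V} (h : p.arrows = q.arrows) (hp : p.arrows ≠ []) :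
    p = q := by
  obtain ⟨u, l, v, hw⟩ := p
  obtain ⟨u', l', v', hw'⟩ := q
  obtain rfl : l = l' := h
  obtain rfl : u = u' := (hw.head hp).symm.trans (hw'.head hp)
  obtain rfl : v = v' := (hw.getLast hp).symm.trans (hw'.getLast hp)
  rfl

theorem QPath.src_eq_tgt_of_nil {p : QPath V} (hp : p.arrows = []) : p.tgt = p.src := by
  have := p.isWalk
  rwa [hp] at this

theorem QPath.eq_triv {p : QPath V} (hp : p.arrows = []) : p = QPath.triv p.tgt := by
  obtain ⟨u, l, v, hw⟩ := p
  obtain rfl : l = [] := hp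
  obtain rfl : u = v := hw
  rfl

theorem QPath.IsSubpath.isInfix {q p : QPath V} (h : q.IsSubpath p) : q.arrows <:+: p.arrows := by
  obtain ⟨u, v, hu, hv, rfl⟩ := h
  exact ⟨u.arrows, v.arrows, rfl⟩

theorem QPath.isSubpath_of_append {p q : QPath V} {l l' : List (Quiver.Total V)}
    (h : p.arrows = l ++ q.arrows ++ l') (hq : q.arrows ≠ []) : q.IsSubpath p := by
  have hw := p.isWalk
  rw [h, isWalk_append] at hw
  obtain ⟨v, hw1, hw2⟩ := hw
  rw [isWalk_append] at hw1
  obtain ⟨u, hu, hw1⟩ := hw1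
  obtain rfl : u = q.tgt := (hw1.head hq).symm.trans (q.isWalk.head hq)
  obtain rfl : v = q.src := (hw1.getLast hq).symm.trans (q.isWalk.getLast hq)
  exact ⟨⟨p.tgt, l, q.tgt, hu⟩, ⟨q.src, l', p.src, hw2⟩, rfl, rfl, QPath.ext rfl h rfl⟩

/-- Two arrows are related if their composite is one of the paths in `R`. -/
def Rel (R : Set (QPath V)) (a b : Quiver.Total V) : Prop := ∃ p ∈ R, p.arrows = [a, b]

theorem mem_of_rel {R : Set (QPath V)} {a b : Quiver.Total V} {p : QPath V}
    (hp : p.arrows = [a, b]) : Rel R a b ↔ p ∈ R := by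
  refine ⟨?_, fun h => ⟨p, h, hp⟩⟩
  rintro ⟨q, hq, hq'⟩
  rwa [QPath.ext_arrows (p := p) (q := q) (by rw [hp, hq']) (by simp [hp])]

/-- As the relations have length two, only consecutive arrows matter. -/
theorem mem_pathsB_iff {R : Set (QPath V)} (hR : ∀ p ∈ R, p.length = 2) {p : QPath V} :
    p ∈ pathsB R ↔ p.arrows.IsChain (fun a b => ¬ Rel R a b) := by
  rw [List.isChain_iff_forall_rel_of_append_cons_cons]
  constructor
  · rintro h a b l l' hl ⟨q, hq, hq'⟩
    exact h q (QPath.isSubpath_of_append (l := l) (l' := l') (by simp [hl, hq']) (by simp [hq'])) hq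
  · intro h q hq hqR
    obtain ⟨a, b, hab⟩ := List.length_eq_two.1 (hR q hqR)
    obtain ⟨l, l', hl⟩ := hq.isInfix
    exact @h a b l l' (by simp [← hl, hab]) ⟨q, hqR, hab⟩

theorem mem_pathsΓ_iff {R : Set (QPath V)} {p : QPath V} :
    p ∈ pathsΓ R ↔ p.arrows.IsChain (Rel R) := by
  rw [List.isChain_iff_forall_rel_of_append_cons_cons]
  constructor
  · intro h a b l l' hl
    have hw := p.isWalk
    rw [hl, isWalk_append] at hw
    obtain ⟨v, -, hw⟩ := hw
    let q : QPath V := ⟨v, [a, b], b.left, hw.1, hw.2.1, rfl⟩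
    have hq : q.IsSubpath p :=
      QPath.isSubpath_of_append (l := l) (l' := l') (by simp [hl, q]) (by simp [q])
    exact ⟨q, h q hq rfl, rfl⟩
  · intro h q hq hq2
    obtain ⟨a, b, hab⟩ := List.length_eq_two.1 hq2
    obtain ⟨l, l', hl⟩ := hq.isInfix
    exact (mem_of_rel hab).1 (@h a b l l' (by simp [← hl, hab]))

theorem triv_mem_pathsB {R : Set (QPath V)} (hR : ∀ p ∈ R, p.length = 2) (e : V) :
    QPath.triv e ∈ pathsB R := (mem_pathsB_iff hR).2 List.isChain_nil

theorem ofArrow_mem_pathsB {R : Set (QPath V)} (hR : ∀ p ∈ R, p.length = 2)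
    (a : Quiver.Total V) : QPath.ofArrow a ∈ pathsB R :=
  (mem_pathsB_iff hR).2 (List.isChain_singleton a)

theorem triv_mem_pathsΓ {R : Set (QPath V)} (e : V) : QPath.triv e ∈ pathsΓ R :=
  mem_pathsΓ_iff.2 List.isChain_nil

end PathLists

/-! ### The partial product on the paths that avoid the relations -/

section BPaths

variable {V : Type*} [Quiver V]

/-- The paths that have no subpath in `R`, as a type. -/
abbrev BPath (R : Set (QPath V)) : Type _ := {p : QPath V // p ∈ pathsB R}

variable {R : Set (QPath V)}

open Classical in
/-- The product of two paths of `BPath R`, if their concatenation exists and is in `BPath R`. -/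
def bmul (p q : BPath R) : Option (BPath R) :=
  if h : ∃ h : p.1.src = q.1.tgt, p.1.comp q.1 h ∈ pathsB R then some ⟨_, h.2⟩ else none

theorem bmul_eq_some {p q r : BPath R} :
    bmul p q = some r ↔ ∃ h : p.1.src = q.1.tgt, p.1.comp q.1 h = r.1 := by
  unfold bmul
  split_ifs with h
  · simp [Subtype.ext_iff, h.1]
  · simp only [false_iff]
    rintro ⟨h1, h2⟩
    exact h ⟨h1, h2 ▸ r.2⟩

theorem bmul_eq_none (hR : ∀ p ∈ R, p.length = 2) {p q : BPath R} (h : p.1.src = q.1.tgt) :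
    bmul p q = none ↔
      ∃ a ∈ p.1.arrows.getLast?, ∃ b ∈ q.1.arrows.head?, Rel R a b := by
  have hp := (mem_pathsB_iff hR).1 p.2
  have hq := (mem_pathsB_iff hR).1 q.2
  have : bmul p q = none ↔ ¬ p.1.comp q.1 h ∈ pathsB R := by
    unfold bmul
    split_ifs with h'
    · simpa using h'.2
    · simpa [h] using h'
  rw [this, mem_pathsB_iff hR]
  simp only [QPath.comp, List.isChain_append, hp, hq, true_and]
  push Not
  rfl

theorem src_of_bmul {p q r : BPath R} (h : bmul p q = some r) : r.1.src = q.1.src := by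
  obtain ⟨_, h⟩ := bmul_eq_some.1 h
  rw [← h]; rfl

theorem tgt_of_bmul {p q r : BPath R} (h : bmul p q = some r) : r.1.tgt = p.1.tgt := by
  obtain ⟨_, h⟩ := bmul_eq_some.1 h
  rw [← h]; rfl

theorem src_eq_tgt_of_bmul {p q r : BPath R} (h : bmul p q = some r) : p.1.src = q.1.tgt :=
  (bmul_eq_some.1 h).1

theorem arrows_of_bmul {p q r : BPath R} (h : bmul p q = some r) :
    r.1.arrows = p.1.arrows ++ q.1.arrows := by
  obtain ⟨_, h⟩ := bmul_eq_some.1 h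
  rw [← h]; rfl

theorem bmul_eq_none_of_ne {p q : BPath R} (h : p.1.src ≠ q.1.tgt) : bmul p q = none := by
  unfold bmul
  rw [dif_neg]
  rintro ⟨h', -⟩
  exact h h'

theorem bmul_assoc (hR : ∀ p ∈ R, p.length = 2) (p q r : BPath R) :
    (bmul p q).bind (fun s => bmul s r) = (bmul q r).bind (fun s => bmul p s) := by
  have key : ∀ t, (bmul p q).bind (fun s => bmul s r) = some t ↔
      (bmul q r).bind (fun s => bmul p s) = some t := by
    intro t
    simp only [Option.bind_eq_some_iff]
    constructor
    · rintro ⟨s, hs, ht⟩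
      obtain ⟨h1, hs⟩ := bmul_eq_some.1 hs
      obtain ⟨h2, ht⟩ := bmul_eq_some.1 ht
      have h2' : q.1.src = r.1.tgt := by rw [← h2, ← hs]; rfl
      have hB : q.1.comp r.1 h2' ∈ pathsB R := by
        rw [mem_pathsB_iff hR]
        have := (mem_pathsB_iff hR).1 t.2
        rw [← ht] at this
        simp only [QPath.comp, ← hs, List.append_assoc] at this
        exact this.right_of_append
      refine ⟨⟨_, hB⟩, bmul_eq_some.2 ⟨h2', rfl⟩, bmul_eq_some.2 ⟨h1, ?_⟩⟩
      rw [← ht]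
      ext1 <;> simp [QPath.comp, ← hs]
    · rintro ⟨s, hs, ht⟩
      obtain ⟨h1, hs⟩ := bmul_eq_some.1 hs
      obtain ⟨h2, ht⟩ := bmul_eq_some.1 ht
      have h2' : p.1.src = q.1.tgt := by rw [h2, ← hs]; rfl
      have hB : p.1.comp q.1 h2' ∈ pathsB R := by
        rw [mem_pathsB_iff hR]
        have := (mem_pathsB_iff hR).1 t.2
        rw [← ht] at this
        simp only [QPath.comp, ← hs, ← List.append_assoc] at this
        exact this.left_of_append
      refine ⟨⟨_, hB⟩, bmul_eq_some.2 ⟨h2', rfl⟩, bmul_eq_some.2 ⟨h1, ?_⟩⟩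
      rw [← ht]
      ext1 <;> simp [QPath.comp, ← hs]
  exact Option.ext key

/-- The trivial path at a vertex, as an element of `BPath R`. -/
def bid (hR : ∀ p ∈ R, p.length = 2) (v : V) : BPath R := ⟨QPath.triv v, triv_mem_pathsB hR v⟩

theorem bid_bmul (hR : ∀ p ∈ R, p.length = 2) (p : BPath R) :
    bmul (bid hR p.1.tgt) p = some p := by
  refine bmul_eq_some.2 ⟨rfl, ?_⟩
  ext1 <;> simp [QPath.comp, bid, QPath.triv]

theorem bmul_bid (hR : ∀ p ∈ R, p.length = 2) (p : BPath R) :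
    bmul p (bid hR p.1.src) = some p := by
  refine bmul_eq_some.2 ⟨rfl, ?_⟩
  ext1 <;> simp [QPath.comp, bid, QPath.triv]

theorem eq_bid (hR : ∀ p ∈ R, p.length = 2) {p : BPath R} (h : p.1.arrows = []) :
    p = bid hR p.1.tgt := Subtype.ext (QPath.eq_triv h)

/-- Since the relations have length two, `pq ≠ 0` and `qr ≠ 0` imply that `pqr ≠ 0` as soon as `q`
is not trivial. -/
theorem bmul_ne_none_of_bmul (hR : ∀ p ∈ R, p.length = 2) {p q r s : BPath R}
    (hq : q.1.arrows ≠ []) (h : bmul p q ≠ none) (hs : bmul q r = some s) :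
    bmul p s ≠ none := by
  have h0 : p.1.src = q.1.tgt := by
    by_contra h'
    exact h (bmul_eq_none_of_ne h')
  rw [Ne, bmul_eq_none hR h0] at h
  rw [Ne, bmul_eq_none hR (h0.trans (tgt_of_bmul hs).symm), arrows_of_bmul hs]
  rwa [List.head?_append_of_ne_nil _ hq]

theorem bmul_eq_none_of_bmul (hR : ∀ p ∈ R, p.length = 2) {p q r s : BPath R}
    (h : bmul p q = none) (hs : bmul q r = some s) : bmul p s = none := by
  have := bmul_assoc hR p q r
  rw [h, hs] at this
  exact this.symm

/-- The last arrow of a path of positive length, as an element of `BPath R`. -/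
def hd (hR : ∀ p ∈ R, p.length = 2) (p : BPath R) (hp : p.1.arrows ≠ []) : BPath R :=
  ⟨p.1.lastArrow hp, ofArrow_mem_pathsB hR _⟩

/-- What remains of a path of positive length without its last arrow. -/
def tl (hR : ∀ p ∈ R, p.length = 2) (p : BPath R) (hp : p.1.arrows ≠ []) : BPath R :=
  ⟨p.1.dropLastArrow hp, (mem_pathsB_iff hR).2 ((mem_pathsB_iff hR).1 p.2).tail⟩

theorem hd_bmul_tl (hR : ∀ p ∈ R, p.length = 2) (p : BPath R) (hp : p.1.arrows ≠ []) :
    bmul (hd hR p hp) (tl hR p hp) = some p := by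
  refine bmul_eq_some.2 ⟨rfl, ?_⟩
  ext1
  · exact p.1.isWalk.head hp
  · simp [QPath.comp, hd, tl, QPath.lastArrow, QPath.ofArrow, QPath.dropLastArrow]
  · rfl

theorem eq_hd_of_bmul (hR : ∀ p ∈ R, p.length = 2) {p q r : BPath R}
    (hp : p.1.length = 1) (h : bmul p q = some r) (hr : r.1.arrows ≠ []) :
    hd hR r hr = p ∧ tl hR r hr = q := by
  obtain ⟨a, ha⟩ := List.length_eq_one_iff.1 hp
  have hr' := arrows_of_bmul h
  have h0 := src_eq_tgt_of_bmul h
  constructor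
  · refine Subtype.ext (QPath.ext_arrows ?_ (by simp [hd, QPath.lastArrow, QPath.ofArrow]))
    simp [hd, QPath.lastArrow, QPath.ofArrow, hr', ha]
  · have hs := src_of_bmul h
    refine Subtype.ext (QPath.ext ?_ ?_ hs)
    · have := p.1.isWalk
      rw [ha] at this
      simp only [tl, QPath.dropLastArrow, hr', ha, ← h0]
      exact this.2
    · simp [tl, QPath.dropLastArrow, hr', ha]

end BPaths

/-! ### The bar complex of words -/

section Words

variable (k : Type*) [Field k] {V : Type*} [Quiver V] {R : Set (QPath V)}

/-- The vector space with basis the words `x_0|x_1|⋯|x_n` in the paths of `BPath R`; it is the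
tensor algebra of the vector space underlying the algebra. -/
abbrev Words (R : Set (QPath V)) : Type _ := List (BPath R) →₀ k

/-- A word, as a basis element of `Words k R`. -/
def word (l : List (BPath R)) : Words k R := Finsupp.single l 1

variable {k}

@[simp]
theorem linearCombination_word {N : Type*} [AddCommGroup N] [Module k N]
    (f : List (BPath R) → N) (l : List (BPath R)) :
    Finsupp.linearCombination k f (word k l) = f l := by
  simp [word]

theorem words_hom_ext {N : Type*} [AddCommGroup N] [Module k N] {f g : Words k R →ₗ[k] N}
    (h : ∀ l, f (word k l) = g (word k l)) : f = g :=
  Finsupp.lhom_ext' fun l => LinearMap.ext_ring (h l)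

variable (k) in
/-- The span of the words with a given property. -/
def wordSpan (P : List (BPath R) → Prop) : Submodule k (Words k R) :=
  Submodule.span k (word k '' {l | P l})

theorem word_mem_wordSpan {P : List (BPath R) → Prop} {l : List (BPath R)} (h : P l) :
    word k l ∈ wordSpan k P := Submodule.subset_span ⟨l, h, rfl⟩

theorem wordSpan_mono {P Q : List (BPath R) → Prop} (h : ∀ l, P l → Q l) :
    wordSpan k P ≤ wordSpan k Q := by
  refine Submodule.span_mono ?_
  rintro _ ⟨l, hl, rfl⟩
  exact ⟨l, h l hl, rfl⟩

theorem eq_of_mem_wordSpan {N : Type*} [AddCommGroup N] [Module k N] {P : List (BPath R) → Prop}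
    {f g : Words k R →ₗ[k] N} (h : ∀ l, P l → f (word k l) = g (word k l)) {z : Words k R}
    (hz : z ∈ wordSpan k P) : f z = g z := by
  refine LinearMap.eqOn_span (s := word k '' {l | P l}) ?_ hz
  rintro _ ⟨l, hl, rfl⟩
  exact h l hl

theorem map_mem_of_mem_wordSpan {N : Type*} [AddCommGroup N] [Module k N]
    {P : List (BPath R) → Prop} {f : Words k R →ₗ[k] N} {W : Submodule k N}
    (h : ∀ l, P l → f (word k l) ∈ W) {z : Words k R} (hz : z ∈ wordSpan k P) : f z ∈ W := by
  refine (Submodule.span_le.2 ?_ : wordSpan k P ≤ W.comap f) hz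
  rintro _ ⟨l, hl, rfl⟩
  exact h l hl

variable (k) in
/-- The linear map that puts the letter `x` in front of a word. -/
def consW (x : BPath R) : Words k R →ₗ[k] Words k R :=
  Finsupp.linearCombination k fun l => word k (x :: l)

variable (k) in
/-- The linear map that puts the letter `y` at the end of a word. -/
def snocW (y : BPath R) : Words k R →ₗ[k] Words k R :=
  Finsupp.linearCombination k fun l => word k (l ++ [y])

@[simp]
theorem consW_word (x : BPath R) (l : List (BPath R)) :
    consW k x (word k l) = word k (x :: l) := by simp [consW]

@[simp]
theorem snocW_word (y : BPath R) (l : List (BPath R)) :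
    snocW k y (word k l) = word k (l ++ [y]) := by simp [snocW]

theorem snocW_consW (x y : BPath R) (z : Words k R) :
    snocW k y (consW k x z) = consW k x (snocW k y z) := by
  have : snocW k y ∘ₗ consW k x = consW k x ∘ₗ snocW k y := words_hom_ext fun l => by simp
  exact LinearMap.congr_fun this z

variable (k) in
/-- The word `s :: l`, or zero if the first letter is undefined. -/
def optW (o : Option (BPath R)) (l : List (BPath R)) : Words k R :=
  o.elim 0 fun s => word k (s :: l)

@[simp] theorem optW_none (l : List (BPath R)) : optW k none l = 0 := rfl

@[simp] theorem optW_some (s : BPath R) (l : List (BPath R)) :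
    optW k (some s) l = word k (s :: l) := rfl

variable (k) in
/-- Left multiplication of the first letter of a word by `x`. -/
def lmulFun (x : BPath R) : List (BPath R) → Words k R
  | [] => 0
  | q :: l => optW k (bmul x q) l

@[simp] theorem lmulFun_nil (x : BPath R) : lmulFun k x [] = 0 := rfl

@[simp] theorem lmulFun_cons (x q : BPath R) (l : List (BPath R)) :
    lmulFun k x (q :: l) = optW k (bmul x q) l := rfl

variable (k) in
/-- Left multiplication of the first letter of a word by `x`, as a linear map. -/
def lmulW (x : BPath R) : Words k R →ₗ[k] Words k R := Finsupp.linearCombination k (lmulFun k x)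

@[simp]
theorem lmulW_word (x : BPath R) (l : List (BPath R)) : lmulW k x (word k l) = lmulFun k x l := by
  simp [lmulW]

theorem lmulW_consW_none {x q : BPath R} (h : bmul x q = none) (z : Words k R) :
    lmulW k x (consW k q z) = 0 := by
  have : lmulW k x ∘ₗ consW k q = 0 := words_hom_ext fun l => by simp [lmulFun, h]
  exact LinearMap.congr_fun this z

theorem lmulW_consW_some {x q s : BPath R} (h : bmul x q = some s) (z : Words k R) :
    lmulW k x (consW k q z) = consW k s z := by
  have : lmulW k x ∘ₗ consW k q = consW k s := words_hom_ext fun l => by simp [lmulFun, h]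
  exact LinearMap.congr_fun this z

variable (k) in
/-- The bar differential of a word: the alternating sum of the words obtained by multiplying two
consecutive letters. -/
def barFun : List (BPath R) → Words k R
  | [] => 0
  | x :: l => lmulFun k x l - consW k x (barFun l)

theorem barFun_cons (x : BPath R) (l : List (BPath R)) :
    barFun k (x :: l) = lmulFun k x l - consW k x (barFun k l) := rfl

variable (k) in
/-- The bar differential. -/
def bar : Words k R →ₗ[k] Words k R := Finsupp.linearCombination k (barFun k)

@[simp]
theorem bar_word (l : List (BPath R)) : bar k (word k l) = barFun k l := by simp [bar]

theorem bar_consW (x : BPath R) (z : Words k R) :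
    bar k (consW k x z) = lmulW k x z - consW k x (bar k z) := by
  have : bar k ∘ₗ consW k x = lmulW k x - consW k x ∘ₗ bar k :=
    words_hom_ext fun l => by simp [barFun]
  exact LinearMap.congr_fun this z

theorem lmulW_lmulFun_none (hR : ∀ p ∈ R, p.length = 2) {x q : BPath R} (h : bmul x q = none)
    (l : List (BPath R)) : lmulW k x (lmulFun k q l) = 0 := by
  cases l with
  | nil => simp [lmulFun]
  | cons r l =>
    rcases hs : bmul q r with _ | s
    · simp [lmulFun, hs]
    · simp [lmulFun, hs, bmul_eq_none_of_bmul hR h hs]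

theorem lmulW_lmulFun_some (hR : ∀ p ∈ R, p.length = 2) {x q s : BPath R} (h : bmul x q = some s)
    (l : List (BPath R)) : lmulW k x (lmulFun k q l) = lmulFun k s l := by
  cases l with
  | nil => simp [lmulFun]
  | cons r l =>
    have := bmul_assoc hR x q r
    rw [h, Option.bind_some] at this
    rcases hs : bmul q r with _ | t
    · rw [hs, Option.bind_none] at this
      simp [lmulFun, hs, this]
    · rw [hs, Option.bind_some] at this
      simp [lmulFun, hs, this]

theorem bar_lmulFun (hR : ∀ p ∈ R, p.length = 2) (x : BPath R) (l : List (BPath R)) :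
    bar k (lmulFun k x l) = lmulW k x (barFun k l) := by
  cases l with
  | nil => simp [lmulFun, barFun]
  | cons q l =>
    rcases h : bmul x q with _ | s
    · simp [barFun, h, lmulW_lmulFun_none hR h, lmulW_consW_none h]
    · simp [barFun, h, lmulW_lmulFun_some hR h, lmulW_consW_some h]

theorem bar_barFun (hR : ∀ p ∈ R, p.length = 2) (l : List (BPath R)) :
    bar k (barFun k l) = 0 := by
  induction l with
  | nil => simp [barFun]
  | cons x l ih => simp [barFun, bar_lmulFun hR, bar_consW, ih]

theorem bar_bar (hR : ∀ p ∈ R, p.length = 2) (z : Words k R) : bar k (bar k z) = 0 := by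
  have : bar k ∘ₗ bar k = (0 : Words k R →ₗ[k] Words k R) :=
    words_hom_ext fun l => by simp [bar_barFun hR]
  exact LinearMap.congr_fun this z

theorem consW_mem_wordSpan {P Q : List (BPath R) → Prop} {x : BPath R}
    (h : ∀ l, P l → Q (x :: l)) {z : Words k R} (hz : z ∈ wordSpan k P) :
    consW k x z ∈ wordSpan k Q :=
  map_mem_of_mem_wordSpan (fun l hl => by
    rw [consW_word]; exact word_mem_wordSpan (h l hl)) hz

/-- Each word in the bar differential of `q|l` begins with `q` or with a multiple of it. -/
theorem barFun_cons_mem (q : BPath R) (l : List (BPath R)) :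
    barFun k (q :: l) ∈ wordSpan k fun m => ∃ q' m', m = q' :: m' ∧ m'.length + 1 = l.length ∧
      (q' = q ∨ ∃ r, bmul q r = some q') := by
  induction l generalizing q with
  | nil => simp [barFun, lmulFun]
  | cons r l ih =>
    rw [barFun]
    refine Submodule.sub_mem _ ?_ ?_
    · rcases h : bmul q r with _ | s
      · simp [lmulFun, h]
      · rw [lmulFun, h]
        exact word_mem_wordSpan ⟨s, l, rfl, rfl, Or.inr ⟨r, h⟩⟩
    · refine consW_mem_wordSpan ?_ (ih r)
      rintro _ ⟨q', m', rfl, hm', -⟩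
      exact ⟨q, q' :: m', rfl, by simpa using hm', Or.inl rfl⟩

/-! ### Words whose inner letters are composable and not trivial -/

/-- The letters of the word compose with each other and with a path starting at `v`, and none of
them is trivial, except perhaps the last one. -/
def IsNorm : V → List (BPath R) → Prop
  | _, [] => True
  | v, q :: l => q.1.tgt = v ∧ (q.1.arrows ≠ [] ∨ l = []) ∧ IsNorm q.1.src l

open Classical in
variable (k) in
/-- The contraction of the bar complex onto the words that satisfy `IsNorm`: where the first failure
occurs, it inserts a trivial path. -/
def normG (hR : ∀ p ∈ R, p.length = 2) : V → List (BPath R) → Words k R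
  | _, [] => 0
  | v, q :: l => if q.1.tgt = v ∧ (q.1.arrows ≠ [] ∨ l = []) then -consW k q (normG hR q.1.src l)
      else word k (bid hR v :: q :: l)

variable (k) in
/-- `normG`, applied behind the first letter. -/
def normHtpyFun (hR : ∀ p ∈ R, p.length = 2) : List (BPath R) → Words k R
  | [] => 0
  | x :: l => consW k x (normG k hR x.1.src l)

variable (k) in
/-- `normHtpyFun` as a linear map. -/
def normHtpy (hR : ∀ p ∈ R, p.length = 2) : Words k R →ₗ[k] Words k R :=
  Finsupp.linearCombination k (normHtpyFun k hR)

variable (k) in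
/-- `normG` as a linear map. -/
def normGW (hR : ∀ p ∈ R, p.length = 2) (v : V) : Words k R →ₗ[k] Words k R :=
  Finsupp.linearCombination k (normG k hR v)

@[simp]
theorem normHtpy_word (hR : ∀ p ∈ R, p.length = 2) (l : List (BPath R)) :
    normHtpy k hR (word k l) = normHtpyFun k hR l := by simp [normHtpy]

@[simp]
theorem normGW_word (hR : ∀ p ∈ R, p.length = 2) (v : V) (l : List (BPath R)) :
    normGW k hR v (word k l) = normG k hR v l := by simp [normGW]

theorem normHtpy_consW (hR : ∀ p ∈ R, p.length = 2) (x : BPath R) (z : Words k R) :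
    normHtpy k hR (consW k x z) = consW k x (normGW k hR x.1.src z) := by
  have : normHtpy k hR ∘ₗ consW k x = consW k x ∘ₗ normGW k hR x.1.src :=
    words_hom_ext fun l => by simp [normHtpyFun]
  exact LinearMap.congr_fun this z

theorem normG_eq_zero (hR : ∀ p ∈ R, p.length = 2) {v : V} {l : List (BPath R)}
    (h : IsNorm v l) : normG k hR v l = 0 := by
  induction l generalizing v with
  | nil => rfl
  | cons q l ih => rw [normG, if_pos ⟨h.1, h.2.1⟩, ih h.2.2, map_zero, neg_zero]

theorem tgt_eq_of_ext {q q' : BPath R} (h : q' = q ∨ ∃ r, bmul q r = some q') :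
    q'.1.tgt = q.1.tgt := by
  rcases h with rfl | ⟨r, hr⟩
  · rfl
  · exact tgt_of_bmul hr

theorem arrows_ne_nil_of_ext {q q' : BPath R} (h : q' = q ∨ ∃ r, bmul q r = some q')
    (hq : q.1.arrows ≠ []) : q'.1.arrows ≠ [] := by
  rcases h with rfl | ⟨r, hr⟩
  · exact hq
  · simp [arrows_of_bmul hr, hq]

open Classical in
/-- The homotopy formula for `normHtpy`: it contracts the words that violate `IsNorm` behind their
first letter, and leaves the others alone. -/
theorem bar_normHtpy_add (hR : ∀ p ∈ R, p.length = 2) (x : BPath R) {l : List (BPath R)}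
    (hl : l ≠ []) :
    bar k (normHtpyFun k hR (x :: l)) + normHtpy k hR (barFun k (x :: l)) =
      if IsNorm x.1.src l then 0 else word k (x :: l) := by
  induction l generalizing x with
  | nil => exact absurd rfl hl
  | cons q l ih =>
    have hlhs : bar k (normHtpyFun k hR (x :: q :: l)) + normHtpy k hR (barFun k (x :: q :: l)) =
        lmulW k x (normG k hR x.1.src (q :: l)) + normHtpy k hR (lmulFun k x (q :: l))
        - consW k x (bar k (normG k hR x.1.src (q :: l))
          + normGW k hR x.1.src (barFun k (q :: l))) := by
      rw [normHtpyFun, bar_consW, barFun, map_sub, normHtpy_consW, map_add]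
      abel
    rw [hlhs]
    by_cases hg : q.1.tgt = x.1.src ∧ (q.1.arrows ≠ [] ∨ l = [])
    · have hz : normGW k hR x.1.src (barFun k (q :: l)) = -normHtpy k hR (barFun k (q :: l)) := by
        rcases eq_or_ne l [] with rfl | hl'
        · simp [barFun, lmulFun]
        · refine eq_of_mem_wordSpan (g := -normHtpy k hR) ?_ (barFun_cons_mem q l)
          rintro _ ⟨q', m', rfl, -, hq'⟩
          have h1 := tgt_eq_of_ext hq'
          have h2 := arrows_ne_nil_of_ext hq' (hg.2.resolve_right hl')
          rw [LinearMap.neg_apply, normGW_word, normG, if_pos ⟨h1.trans hg.1, Or.inl h2⟩,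
            normHtpy_word, normHtpyFun]
      rw [hz, normG, if_pos hg, map_neg, map_neg]
      have h1 : lmulW k x (consW k q (normG k hR q.1.src l)) =
          normHtpy k hR (lmulFun k x (q :: l)) := by
        rcases h : bmul x q with _ | s
        · rw [lmulW_consW_none h, lmulFun, h, optW_none, map_zero]
        · rw [lmulW_consW_some h, lmulFun, h, optW_some, normHtpy_word, normHtpyFun, src_of_bmul h]
      rw [h1, neg_add_cancel, zero_sub, ← neg_add, map_neg, neg_neg]
      rcases eq_or_ne l [] with rfl | hl'
      · simp [barFun, lmulFun, normG, IsNorm, hg.1]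
      · have := ih q hl'
        rw [normHtpyFun] at this
        rw [this]
        have : IsNorm x.1.src (q :: l) ↔ IsNorm q.1.src l :=
          ⟨fun h => h.2.2, fun h => ⟨hg.1, hg.2, h⟩⟩
        simp only [this]
        split_ifs <;> simp
    · rw [if_neg (fun h => hg ⟨h.1, h.2.1⟩)]
      have hG : normG k hR x.1.src (q :: l) = word k (bid hR x.1.src :: q :: l) := by
        rw [normG, if_neg hg]
      rw [hG, lmulW_word, bar_word, lmulFun, bmul_bid, optW_some]
      by_cases hc : q.1.tgt = x.1.src
      · -- `q` is the trivial path, so the faces that multiply with it cancel in pairs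
        have hq : q.1.arrows = [] := by
          by_contra h
          exact hg ⟨hc, Or.inl h⟩
        have hl' : l ≠ [] := fun h => hg ⟨hc, Or.inr h⟩
        obtain rfl : q = bid hR x.1.src := by rw [eq_bid hR hq, hc]
        clear hG hlhs ih
        have h2 : normGW k hR x.1.src (lmulFun k (bid hR x.1.src) l) =
            normG k hR x.1.src l - word k (bid hR x.1.src :: l)
              + consW k (bid hR x.1.src) (lmulFun k (bid hR x.1.src) l) := by
          cases l with
          | nil => exact absurd rfl hl'
          | cons r l =>
            by_cases hr : r.1.tgt = x.1.src
            · have := bid_bmul hR r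
              rw [hr] at this
              simp [lmulFun, this]
            · have : bmul (bid hR x.1.src) r = none := bmul_eq_none_of_ne (Ne.symm hr)
              simp [lmulFun, this, normG, hr]
        have h3 : normGW k hR x.1.src (consW k (bid hR x.1.src) (barFun k l)) =
            consW k (bid hR x.1.src) (consW k (bid hR x.1.src) (barFun k l)) := by
          cases l with
          | nil => exact absurd rfl hl'
          | cons r l =>
            refine eq_of_mem_wordSpan (f := normGW k hR x.1.src ∘ₗ consW k (bid hR x.1.src))
              (g := consW k (bid hR x.1.src) ∘ₗ consW k (bid hR x.1.src)) ?_ (barFun_cons_mem r l)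
            rintro _ ⟨q', m', rfl, -, -⟩
            simp [normG, bid, QPath.triv]
        have h4 : bmul (bid hR x.1.src) (bid hR x.1.src) = some (bid hR x.1.src) :=
          bid_bmul hR (bid hR x.1.src)
        rw [lmulFun, bmul_bid, optW_some, normHtpy_word, normHtpyFun]
        simp only [barFun, map_sub, map_add, h2, h3, lmulFun_cons, h4, optW_some, consW_word]
        abel
      · have h1 : bmul x q = none := bmul_eq_none_of_ne (Ne.symm hc)
        have h2 : bmul (bid hR x.1.src) q = none := bmul_eq_none_of_ne (Ne.symm hc)
        have h3 : normGW k hR x.1.src (barFun k (q :: l)) =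
            consW k (bid hR x.1.src) (barFun k (q :: l)) := by
          refine eq_of_mem_wordSpan ?_ (barFun_cons_mem q l)
          rintro _ ⟨q', m', rfl, -, hq'⟩
          have h4 := tgt_eq_of_ext hq'
          rw [normGW_word, normG, if_neg (fun h => hc (h4.symm.trans h.1)), consW_word]
        rw [lmulFun, h1, optW_none, map_zero, h3, barFun, lmulFun, h2, optW_none]
        simp

end Words

/-! ### Splitting the first long letter of a word -/

section Koszul

variable {k : Type*} [Field k] {V : Type*} [Quiver V] {R : Set (QPath V)}

theorem arrows_ne_nil_of_two_le {p : BPath R} (h : 2 ≤ p.1.length) : p.1.arrows ≠ [] := by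
  intro h'
  simp [QPath.length, h'] at h

open Classical in
variable (k) in
/-- The contraction that cuts the last arrow off the first letter that is not an arrow, if all
letters before it are arrows with consecutive products zero and if the product of the arrow before
it and that letter is zero; the last letter of the word is never cut. -/
def splitE (hR : ∀ p ∈ R, p.length = 2) : List (BPath R) → Words k R
  | [] => 0
  | [_] => 0
  | p :: q :: l =>
    if h : 2 ≤ p.1.length then
      word k (hd hR p (arrows_ne_nil_of_two_le h) :: tl hR p (arrows_ne_nil_of_two_le h) :: q :: l)
    else -consW k p (if bmul p q = none then splitE hR (q :: l) else 0)

variable (k) in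
/-- `splitE` as a linear map. -/
def splitEW (hR : ∀ p ∈ R, p.length = 2) : Words k R →ₗ[k] Words k R :=
  Finsupp.linearCombination k (splitE k hR)

@[simp]
theorem splitEW_word (hR : ∀ p ∈ R, p.length = 2) (l : List (BPath R)) :
    splitEW k hR (word k l) = splitE k hR l := by simp [splitEW]

theorem splitE_of_bmul (hR : ∀ p ∈ R, p.length = 2) {a p s : BPath R} (ha : a.1.length = 1)
    (hp : p.1.arrows ≠ []) (hs : bmul a p = some s) {l : List (BPath R)} (hl : l ≠ []) :
    splitE k hR (s :: l) = word k (a :: p :: l) := by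
  obtain ⟨q, l, rfl⟩ := List.exists_cons_of_ne_nil hl
  have h2 : 2 ≤ s.1.length := by
    have := List.length_pos_iff.2 hp
    have h1 : a.1.arrows.length = 1 := ha
    rw [QPath.length, arrows_of_bmul hs, List.length_append]
    omega
  obtain ⟨e1, e2⟩ := eq_hd_of_bmul hR ha hs (arrows_ne_nil_of_two_le h2)
  rw [splitE, dif_pos h2, e1, e2]

theorem splitE_eq_zero_of_bmul_ne (hR : ∀ p ∈ R, p.length = 2) {a q : BPath R}
    (ha : a.1.length = 1) (h : bmul a q ≠ none) (l : List (BPath R)) :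
    splitE k hR (a :: q :: l) = 0 := by
  rw [splitE, dif_neg (by omega), if_neg h, map_zero, neg_zero]

theorem splitE_of_bmul_eq_none (hR : ∀ p ∈ R, p.length = 2) {a q : BPath R}
    (ha : a.1.length = 1) (h : bmul a q = none) (l : List (BPath R)) :
    splitE k hR (a :: q :: l) = -consW k a (splitE k hR (q :: l)) := by
  rw [splitE, dif_neg (by omega), if_pos h]

/-- The words `a_1|⋯|a_n|y` with arrows `a_i` and a path `y` that compose with each other and with
a path starting at `v`, such that the products `a_i a_{i+1}` are zero. -/
def IsKoszul : V → List (BPath R) → Prop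
  | _, [] => False
  | v, [y] => y.1.tgt = v
  | v, p :: q :: l => p.1.tgt = v ∧ p.1.length = 1 ∧ (l ≠ [] → bmul p q = none) ∧
      IsKoszul p.1.src (q :: l)

theorem bmul_hd_eq_none (hR : ∀ p ∈ R, p.length = 2) {a p : BPath R} (hp : p.1.arrows ≠ [])
    (h : bmul a p = none) : bmul a (hd hR p hp) = none := by
  by_contra h'
  exact bmul_ne_none_of_bmul hR (by simp [hd, QPath.lastArrow, QPath.ofArrow]) h'
    (hd_bmul_tl hR p hp) h

theorem bmul_eq_none_of_ext (hR : ∀ p ∈ R, p.length = 2) {a q q' : BPath R}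
    (h : q' = q ∨ ∃ r, bmul q r = some q') (hq : bmul a q = none) : bmul a q' = none := by
  rcases h with rfl | ⟨r, hr⟩
  · exact hq
  · exact bmul_eq_none_of_bmul hR hq hr

theorem bmul_ne_none_of_ext (hR : ∀ p ∈ R, p.length = 2) {a q q' : BPath R}
    (h : q' = q ∨ ∃ r, bmul q r = some q') (hq0 : q.1.arrows ≠ []) (hq : bmul a q ≠ none) :
    bmul a q' ≠ none := by
  rcases h with rfl | ⟨r, hr⟩
  · exact hq
  · exact bmul_ne_none_of_bmul hR hq0 hq hr

/-- If the arrow `a` annihilates the first letter, then it annihilates `splitE` of the word. -/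
theorem lmulW_splitE (hR : ∀ p ∈ R, p.length = 2) {a p : BPath R} (h : bmul a p = none)
    (l : List (BPath R)) : lmulW k a (splitE k hR (p :: l)) = 0 := by
  cases l with
  | nil => simp [splitE]
  | cons q l =>
    rw [splitE]
    split_ifs with h2
    · simp [bmul_hd_eq_none hR (arrows_ne_nil_of_two_le h2) h]
    · rw [map_neg, lmulW_consW_none h, neg_zero]
    · simp

theorem tl_ne_nil (hR : ∀ p ∈ R, p.length = 2) {p : BPath R} (h : 2 ≤ p.1.length) :
    (tl hR p (arrows_ne_nil_of_two_le h)).1.arrows ≠ [] := by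
  intro h'
  have := congrArg List.length h'
  simp only [tl, QPath.dropLastArrow, List.length_tail, List.length_nil] at this
  have h2 : 2 ≤ p.1.arrows.length := h
  omega

/-- The defect of the contraction `splitE` consists of words that satisfy `IsKoszul`. -/
theorem sub_bar_splitE_mem (hR : ∀ p ∈ R, p.length = 2) (v : V) (p : BPath R)
    {l : List (BPath R)} (hl : l ≠ []) (hv : IsNorm v (p :: l)) :
    word k (p :: l) - bar k (splitE k hR (p :: l)) - splitEW k hR (barFun k (p :: l)) ∈
      wordSpan k fun m => IsKoszul v m ∧ ∃ c m', m = c :: m' ∧ m' ≠ [] ∧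
        ∀ a, bmul a p = none → bmul a c = none := by
  induction l generalizing v p with
  | nil => exact absurd rfl hl
  | cons q l ih =>
    have hp : p.1.arrows ≠ [] := hv.2.1.resolve_right (by simp)
    by_cases h2 : 2 ≤ p.1.length
    · -- the first letter is cut as `p = a p'`
      have hcut := hd_bmul_tl hR p hp
      have hann : ∀ b, bmul b p = none → bmul b (hd hR p hp) = none :=
        fun b hb => bmul_hd_eq_none hR hp hb
      have ht := tl_ne_nil hR h2
      have h1 : splitE k hR (p :: q :: l) = word k (hd hR p hp :: tl hR p hp :: q :: l) := by
        rw [splitE, dif_pos h2]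
      have hsrc : (tl hR p hp).1.src = p.1.src := rfl
      have hv1 : (hd hR p hp).1.tgt = v := (tgt_of_bmul hcut).symm.trans hv.1
      have hsrc' : (hd hR p hp).1.src = (tl hR p hp).1.tgt := rfl
      have hlen : (hd hR p hp).1.length = 1 := rfl
      revert h1 hcut hann ht hsrc hv1 hsrc' hlen
      generalize hd hR p hp = a
      generalize tl hR p hp = p'
      intro hcut hann ht h1 hsrc hv1 hsrc' hlen
      have h3 : barFun k (p :: q :: l) = lmulW k a (barFun k (p' :: q :: l)) := by
        rw [← bar_lmulFun hR, lmulFun_cons, hcut, optW_some, bar_word]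
      rw [h1, bar_word, barFun, lmulFun_cons, hcut, optW_some, sub_sub_cancel, h3]
      rcases eq_or_ne l [] with rfl | hl'
      · have h4 : barFun k [p', q] = optW k (bmul p' q) [] := by simp [barFun]
        have h5 : splitEW k hR (lmulW k a (optW k (bmul p' q) [])) = 0 := by
          rcases h : bmul p' q with _ | s
          · simp
          · rcases h' : bmul a s with _ | t <;> simp [h', splitE]
        rw [h4, h5, sub_zero]
        rcases h : bmul p' q with _ | s
        · simp
        · rw [optW_some, consW_word]
          exact word_mem_wordSpan ⟨⟨hv1, hlen, by simp, by
            simp only [IsKoszul]; rw [tgt_of_bmul h, hsrc']⟩, a, _, rfl, by simp, hann⟩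
      · have h4 : splitEW k hR (lmulW k a (barFun k (p' :: q :: l))) =
            consW k a (barFun k (p' :: q :: l)) := by
          refine eq_of_mem_wordSpan (f := splitEW k hR ∘ₗ lmulW k a) ?_ (barFun_cons_mem p' _)
          rintro _ ⟨q', m', rfl, hm', hq'⟩
          have hne := bmul_ne_none_of_ext hR (a := a) hq' ht (by simp [hcut])
          obtain ⟨s, hs⟩ := Option.ne_none_iff_exists'.1 hne
          have hm'' : m' ≠ [] := by
            rintro rfl
            simp at hm'
            exact hl' hm'
          simp [hs, splitE_of_bmul hR hlen (arrows_ne_nil_of_ext hq' ht) hs hm'']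
        rw [h4, sub_self]
        exact Submodule.zero_mem _
    · have hlen : p.1.length = 1 := by
        have : 0 < p.1.arrows.length := List.length_pos_iff.2 hp
        simp only [QPath.length] at h2 ⊢
        omega
      rcases eq_or_ne l [] with rfl | hl'
      · have h1 : splitE k hR [p, q] = 0 := by
          rw [splitE, dif_neg h2]; simp [splitE]
        have h4 : barFun k [p, q] = optW k (bmul p q) [] := by simp [barFun]
        have h5 : splitEW k hR (optW k (bmul p q) []) = 0 := by
          rcases h : bmul p q with _ | s <;> simp [splitE]
        rw [h1, h4, h5, map_zero, sub_zero, sub_zero]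
        exact word_mem_wordSpan ⟨⟨hv.1, hlen, by simp, hv.2.2.1⟩, p, _, rfl, by simp, fun _ h => h⟩
      · have hq : q.1.arrows ≠ [] := hv.2.2.2.1.resolve_right hl'
        rcases h : bmul p q with _ | s
        · have h1 : splitE k hR (p :: q :: l) = -consW k p (splitE k hR (q :: l)) :=
            splitE_of_bmul_eq_none hR hlen h l
          have h3 : splitEW k hR (consW k p (barFun k (q :: l))) =
              -consW k p (splitEW k hR (barFun k (q :: l))) := by
            refine eq_of_mem_wordSpan (f := splitEW k hR ∘ₗ consW k p)
              (g := -(consW k p ∘ₗ splitEW k hR)) ?_ (barFun_cons_mem q l)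
            rintro _ ⟨q', m', rfl, hm', hq'⟩
            simp [splitE_of_bmul_eq_none hR hlen (bmul_eq_none_of_ext hR hq' h)]
          have h4 : word k (p :: q :: l) - bar k (splitE k hR (p :: q :: l)) -
              splitEW k hR (barFun k (p :: q :: l)) =
              consW k p (word k (q :: l) - bar k (splitE k hR (q :: l)) -
                splitEW k hR (barFun k (q :: l))) := by
            rw [h1, map_neg, bar_consW, lmulW_splitE hR h, barFun_cons p, map_sub, h3, lmulFun_cons,
              h]
            simp
          rw [h4]
          refine consW_mem_wordSpan ?_ (ih p.1.src q hl' hv.2.2)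
          rintro _ ⟨hm, c, m', rfl, hm', hc⟩
          exact ⟨⟨hv.1, hlen, fun _ => hc p h, hm⟩, p, _, rfl, by simp, fun _ h => h⟩
        · have h1 : splitE k hR (p :: q :: l) = 0 :=
            splitE_eq_zero_of_bmul_ne hR hlen (by simp [h]) l
          have h3 : splitEW k hR (consW k p (barFun k (q :: l))) = 0 := by
            refine eq_of_mem_wordSpan (f := splitEW k hR ∘ₗ consW k p) (g := 0) ?_
              (barFun_cons_mem q l)
            rintro _ ⟨q', m', rfl, hm', hq'⟩
            have := bmul_ne_none_of_ext hR (a := p) hq' hq (by simp [h])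
            simp [splitE_eq_zero_of_bmul_ne hR hlen this]
          rw [h1, barFun, map_sub, h3, lmulFun_cons, h, optW_some, splitEW_word,
            splitE_of_bmul hR hlen hq h hl']
          simp

variable (k) in
/-- `splitE`, applied behind the first letter. -/
def splitHtpyFun (hR : ∀ p ∈ R, p.length = 2) : List (BPath R) → Words k R
  | [] => 0
  | x :: l => -consW k x (splitE k hR l)

variable (k) in
/-- `splitHtpyFun` as a linear map. -/
def splitHtpy (hR : ∀ p ∈ R, p.length = 2) : Words k R →ₗ[k] Words k R :=
  Finsupp.linearCombination k (splitHtpyFun k hR)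

@[simp]
theorem splitHtpy_word (hR : ∀ p ∈ R, p.length = 2) (l : List (BPath R)) :
    splitHtpy k hR (word k l) = splitHtpyFun k hR l := by simp [splitHtpy]

theorem splitHtpy_consW (hR : ∀ p ∈ R, p.length = 2) (x : BPath R) (z : Words k R) :
    splitHtpy k hR (consW k x z) = -consW k x (splitEW k hR z) := by
  have : splitHtpy k hR ∘ₗ consW k x = -(consW k x ∘ₗ splitEW k hR) :=
    words_hom_ext fun l => by simp [splitHtpyFun]
  exact LinearMap.congr_fun this z

theorem sub_bar_splitHtpy (hR : ∀ p ∈ R, p.length = 2) (x : BPath R) (l : List (BPath R)) :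
    word k (x :: l) - bar k (splitHtpyFun k hR (x :: l)) - splitHtpy k hR (barFun k (x :: l)) =
      consW k x (word k l - bar k (splitE k hR l) - splitEW k hR (barFun k l))
        + lmulW k x (splitE k hR l) - splitHtpy k hR (lmulFun k x l) := by
  rw [splitHtpyFun, map_neg, bar_consW, barFun, map_sub, splitHtpy_consW]
  simp only [map_sub, consW_word]
  abel

/-! ### The combined contraction -/

open Classical in
variable (k) in
/-- The projection onto the span of the words whose inner letters are composable and not
trivial. -/
def normProj : Words k R →ₗ[k] Words k R :=
  Finsupp.linearCombination k fun l =>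
    if ∀ x m, l = x :: m → IsNorm x.1.src m then word k l else 0

open Classical in
theorem normProj_word_cons (x : BPath R) (l : List (BPath R)) :
    normProj k (word k (x :: l)) = if IsNorm x.1.src l then word k (x :: l) else 0 := by
  rw [normProj, linearCombination_word]
  refine if_congr ⟨fun h => h x l rfl, ?_⟩ rfl rfl
  rintro h _ _ ⟨⟩
  exact h

theorem sub_normHtpy (hR : ∀ p ∈ R, p.length = 2) {z : Words k R}
    (hz : z ∈ wordSpan k fun l => 2 ≤ l.length) :
    z - bar k (normHtpy k hR z) - normHtpy k hR (bar k z) = normProj k z := by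
  refine eq_of_mem_wordSpan
    (f := LinearMap.id - bar k ∘ₗ normHtpy k hR - normHtpy k hR ∘ₗ bar k) ?_ hz
  intro l hl
  match l, hl with
  | x :: q :: l, _ =>
    have := bar_normHtpy_add (k := k) hR x (l := q :: l) (by simp)
    rw [normProj_word_cons]
    simp only [LinearMap.sub_apply, LinearMap.id_apply, LinearMap.comp_apply, normHtpy_word,
      bar_word, sub_sub, this]
    split_ifs <;> simp

theorem bar_normProj (hR : ∀ p ∈ R, p.length = 2) {l : List (BPath R)} (hl : 2 ≤ l.length) :
    normProj k (barFun k l) = bar k (normProj k (word k l)) := by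
  match l, hl with
  | x :: q :: l, _ =>
    rcases eq_or_ne l [] with rfl | hl
    · rw [normProj_word_cons]
      by_cases h : q.1.tgt = x.1.src
      · have h1 : IsNorm x.1.src [q] := ⟨h, Or.inr rfl, trivial⟩
        rw [if_pos h1]
        rcases h2 : bmul x q with _ | s <;> simp [barFun, h2, normProj_word_cons, IsNorm]
      · have h1 : ¬ IsNorm x.1.src [q] := fun h' => h h'.1
        rw [if_neg h1]
        simp [barFun, bmul_eq_none_of_ne (Ne.symm h)]
    · rw [← sub_normHtpy hR (z := barFun k (x :: q :: l)), ← sub_normHtpy hR (z := word k _)]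
      · simp [bar_barFun hR, bar_bar hR]
      · exact word_mem_wordSpan (by simp)
      · refine wordSpan_mono ?_ (barFun_cons_mem x _)
        rintro _ ⟨q', m', rfl, hm', -⟩
        have := List.length_pos_iff.2 hl
        simp at hm' ⊢
        omega

variable (k) in
/-- The contraction of the bar complex that is `splitHtpy` on the words whose inner letters are
composable and not trivial, and `normHtpy` on the other words. -/
def htpy (hR : ∀ p ∈ R, p.length = 2) : Words k R →ₗ[k] Words k R :=
  normHtpy k hR + splitHtpy k hR ∘ₗ normProj k

theorem sub_htpy (hR : ∀ p ∈ R, p.length = 2) {l : List (BPath R)} (hl : 2 ≤ l.length) :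
    word k l - bar k (htpy k hR (word k l)) - htpy k hR (barFun k l) =
      normProj k (word k l) - bar k (splitHtpy k hR (normProj k (word k l)))
        - splitHtpy k hR (bar k (normProj k (word k l))) := by
  have h := sub_normHtpy (k := k) hR (word_mem_wordSpan (P := fun l => 2 ≤ l.length) hl)
  simp only [htpy, LinearMap.add_apply, LinearMap.comp_apply, map_add, bar_normProj hR hl]
  rw [bar_word] at h
  nth_rw 3 [← h]
  abel

theorem htpy_word_of_isNorm (hR : ∀ p ∈ R, p.length = 2) {x : BPath R} {l : List (BPath R)}
    (h : IsNorm x.1.src l) : htpy k hR (word k (x :: l)) = -consW k x (splitE k hR l) := by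
  simp [htpy, normProj_word_cons, h, normHtpyFun, normG_eq_zero hR h, splitHtpyFun]

theorem htpy_word_of_not_isNorm (hR : ∀ p ∈ R, p.length = 2) {x : BPath R} {l : List (BPath R)}
    (h : ¬ IsNorm x.1.src l) : htpy k hR (word k (x :: l)) = consW k x (normG k hR x.1.src l) := by
  simp [htpy, normProj_word_cons, h, normHtpyFun]

end Koszul

/-! ### Cyclic words and the Hochschild differential -/

section CyclicWords

variable (k : Type*) [Field k] {V : Type*} [Quiver V] {R : Set (QPath V)}

/-- The vector space with basis the tuples `(s, [p_1, …, p_m])` of paths of `BPath R`, for all `m`.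
It is the direct sum of the components of the Hochschild complex. -/
abbrev CWords (R : Set (QPath V)) : Type _ := BPath R × List (BPath R) →₀ k

/-- A tuple, as a basis element of `CWords k R`. -/
def cword (s : BPath R) (l : List (BPath R)) : CWords k R := Finsupp.single (s, l) 1

variable {k}

@[simp]
theorem linearCombination_cword {N : Type*} [AddCommGroup N] [Module k N]
    (f : BPath R × List (BPath R) → N) (s : BPath R) (l : List (BPath R)) :
    Finsupp.linearCombination k f (cword k s l) = f (s, l) := by
  simp [cword]

theorem cwords_hom_ext {N : Type*} [AddCommGroup N] [Module k N] {f g : CWords k R →ₗ[k] N}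
    (h : ∀ s l, f (cword k s l) = g (cword k s l)) : f = g :=
  Finsupp.lhom_ext' fun l => LinearMap.ext_ring (h l.1 l.2)

variable (k) in
/-- The linear map that sends a word `l` to the tuple `(s, l)`, or to zero if `s` is undefined. -/
def optC (o : Option (BPath R)) : Words k R →ₗ[k] CWords k R :=
  Finsupp.linearCombination k fun l => o.elim 0 fun s => cword k s l

@[simp] theorem optC_none (z : Words k R) : optC k none z = 0 := by
  have : optC k (none : Option (BPath R)) = 0 := words_hom_ext fun l => by simp [optC]
  rw [this, LinearMap.zero_apply]

@[simp] theorem optC_some_word (s : BPath R) (l : List (BPath R)) :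
    optC k (some s) (word k l) = cword k s l := by simp [optC]

/-- The tuple `(y x, l)` obtained from a word `x|l|y`. -/
def closeFun : List (BPath R) → CWords k R
  | [] => 0
  | x :: l => if h : l ≠ [] then optC k (bmul (l.getLast h) x) (word k l.dropLast) else 0

variable (k) in
/-- The linear map that sends a word `x|l|y` to the tuple `(y x, l)`. It identifies
`A ⊗_{A^e} B` with the Hochschild complex, where `B` is the two-sided bar complex. -/
def close : Words k R →ₗ[k] CWords k R := Finsupp.linearCombination k closeFun

@[simp]
theorem close_word (x y : BPath R) (l : List (BPath R)) :
    close k (word k (x :: (l ++ [y]))) = optC k (bmul y x) (word k l) := by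
  simp [close, closeFun]

@[simp]
theorem close_word_singleton (x : BPath R) : close k (word k [x]) = 0 := by
  simp [close, closeFun]

@[simp]
theorem close_word_nil : close k (word k ([] : List (BPath R))) = 0 := by
  simp [close, closeFun]

theorem close_consW_snocW (x y : BPath R) (z : Words k R) :
    close k (consW k x (snocW k y z)) = optC k (bmul y x) z := by
  have : close k ∘ₗ consW k x ∘ₗ snocW k y = optC k (bmul y x) := words_hom_ext fun l => by simp
  exact LinearMap.congr_fun this z

theorem words_hom_ext_ends {N : Type*} [AddCommGroup N] [Module k N] {f g : Words k R →ₗ[k] N}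
    (h0 : f (word k []) = g (word k [])) (h1 : ∀ x, f (word k [x]) = g (word k [x]))
    (h2 : ∀ x l y, f (word k (x :: (l ++ [y]))) = g (word k (x :: (l ++ [y])))) : f = g := by
  refine words_hom_ext fun l => ?_
  cases l with
  | nil => exact h0
  | cons x l =>
    rcases List.eq_nil_or_concat' l with rfl | ⟨l, y, rfl⟩
    · exact h1 x
    · exact h2 x l y

/-- The Hochschild differential of a tuple. -/
def hochFun (s : BPath R) : List (BPath R) → CWords k R
  | [] => 0
  | q :: l => optC k (bmul s q) (word k l) - optC k (some s) (barFun k (q :: l))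
      + (-1 : k) ^ (l.length + 1) •
        optC k (bmul ((q :: l).getLast (by simp)) s) (word k (q :: l).dropLast)

variable (k) in
/-- The Hochschild differential. -/
def hoch : CWords k R →ₗ[k] CWords k R := Finsupp.linearCombination k fun w => hochFun w.1 w.2

@[simp]
theorem hoch_cword (s : BPath R) (l : List (BPath R)) : hoch k (cword k s l) = hochFun s l := by
  simp [hoch]

/-- Right multiplication of the last letter of a word by `y`. -/
def rmulFun (y : BPath R) (l : List (BPath R)) : Words k R :=
  if h : l ≠ [] then (bmul (l.getLast h) y).elim 0 fun s => word k (l.dropLast ++ [s]) else 0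

theorem snocW_lmulFun (x y q : BPath R) (l : List (BPath R)) :
    lmulFun k x (q :: l ++ [y]) = snocW k y (lmulFun k x (q :: l)) := by
  rcases h : bmul x q with _ | s <;> simp [h]

theorem barFun_append_singleton (y : BPath R) (l : List (BPath R)) :
    barFun k (l ++ [y]) = snocW k y (barFun k l) + (-1 : k) ^ (l.length + 1) • rmulFun y l := by
  induction l with
  | nil => simp [barFun, rmulFun]
  | cons q l ih =>
    rw [List.cons_append, barFun_cons, ih, barFun_cons]
    cases l with
    | nil => rcases h : bmul q y with _ | s <;> simp [barFun, rmulFun, h]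
    | cons r l =>
      rw [snocW_lmulFun, map_sub, map_add, snocW_consW, map_smul]
      have : consW k q (rmulFun y (r :: l)) = rmulFun y (q :: r :: l) := by
        rcases h : bmul ((r :: l).getLast (by simp)) y with _ | s <;> simp [rmulFun, h]
      have hs : (-1 : k) ^ ((q :: r :: l).length + 1) = -(-1 : k) ^ ((r :: l).length + 1) := by
        rw [List.length_cons, pow_succ _ ((r :: l).length + 1), mul_neg_one]
      rw [this, hs, neg_smul]
      abel

theorem close_consW_rmulFun (hR : ∀ p ∈ R, p.length = 2) (x y : BPath R) (l : List (BPath R))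
    (q : BPath R) : close k (consW k x (rmulFun y (l ++ [q]))) =
      (bmul y x).elim 0 fun s => optC k (bmul q s) (word k l) := by
  have := bmul_assoc hR q y x
  rcases h : bmul q y with _ | s <;> rcases h' : bmul y x with _ | t <;>
    rw [h, h'] at this <;> simp at this <;>
    first | (simp [rmulFun, h, this]; done) | simp [rmulFun, h, this.symm]

theorem close_barFun (hR : ∀ p ∈ R, p.length = 2) (x y : BPath R) (l : List (BPath R)) :
    close k (barFun k (x :: (l ++ [y]))) = (bmul y x).elim 0 fun s => hochFun s l := by
  cases l with
  | nil =>
    have : barFun k (x :: ([] ++ [y])) = optW k (bmul x y) [] := by simp [barFun]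
    rw [this]
    rcases bmul x y with _ | s <;> rcases bmul y x with _ | t <;> simp [hochFun]
  | cons q l =>
    obtain ⟨l', z, hl⟩ := (List.eq_nil_or_concat' (q :: l)).resolve_left (by simp)
    have h1 : close k (lmulFun k x (q :: l ++ [y])) =
        (bmul y x).elim 0 fun s => optC k (bmul s q) (word k l) := by
      have := bmul_assoc hR y x q
      rcases h : bmul x q with _ | s <;> rcases h' : bmul y x with _ | t <;>
        rw [h, h'] at this <;> simp at this <;> first | (simp [h, this]; done) | simp [h, this.symm]
    have h2 : close k (consW k x (barFun k (q :: l ++ [y]))) =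
        optC k (bmul y x) (barFun k (q :: l)) + (-1 : k) ^ (l.length + 2) •
          (bmul y x).elim 0 fun s => optC k (bmul z s) (word k l') := by
      rw [barFun_append_singleton, map_add, map_add, close_consW_snocW, map_smul, map_smul, hl,
        close_consW_rmulFun hR, ← hl]
      rfl
    rw [barFun_cons, map_sub, h1, h2]
    rcases h : bmul y x with _ | s
    · simp
    · have h3 : (q :: l).getLast (by simp) = z := by simp [hl]
      have h4 : (q :: l).dropLast = l' := by simp [hl]
      simp only [Option.elim, hochFun, h3, h4, pow_succ (-1 : k) (l.length + 1)]
      simp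
      abel

theorem hoch_close (hR : ∀ p ∈ R, p.length = 2) (z : Words k R) :
    hoch k (close k z) = close k (bar k z) := by
  have : hoch k ∘ₗ close k = (close k ∘ₗ bar k : Words k R →ₗ[k] CWords k R) := by
    refine words_hom_ext_ends ?_ ?_ ?_
    · simp [barFun]
    · simp [barFun]
    · intro x l y
      simp only [LinearMap.comp_apply, close_word, bar_word, close_barFun hR]
      rcases bmul y x with _ | s <;> simp
  exact LinearMap.congr_fun this z

theorem cword_eq_close (hR : ∀ p ∈ R, p.length = 2) (s : BPath R) (l : List (BPath R)) :
    cword k s l = close k (word k (s :: (l ++ [bid hR s.1.tgt]))) := by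
  rw [close_word, bid_bmul, optC_some_word]

theorem hoch_hoch (hR : ∀ p ∈ R, p.length = 2) (z : CWords k R) : hoch k (hoch k z) = 0 := by
  have : hoch k ∘ₗ hoch k = (0 : CWords k R →ₗ[k] CWords k R) := by
    refine cwords_hom_ext fun s l => ?_
    simp only [LinearMap.comp_apply, LinearMap.zero_apply]
    rw [cword_eq_close hR, hoch_close hR, hoch_close hR, bar_bar hR, map_zero]
  exact LinearMap.congr_fun this z

/-! ### The contraction of the Hochschild complex -/

/-- The letters of the word are not trivial, compose with each other and with a path that starts
at `v`, and the last of them starts at `t`. -/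
def IsNormC (t : V) : V → List (BPath R) → Prop
  | v, [] => t = v
  | v, q :: l => q.1.tgt = v ∧ q.1.arrows ≠ [] ∧ IsNormC t q.1.src l

theorem isNorm_append_singleton (y : BPath R) (v : V) (l : List (BPath R)) :
    IsNorm v (l ++ [y]) ↔ IsNormC y.1.tgt v l := by
  induction l generalizing v with
  | nil => simp [IsNorm, IsNormC]
  | cons q l ih => simp [IsNorm, IsNormC, ih]

open Classical in
/-- `normG`, for a word without its last letter, which ends at `t`. -/
def normC (hR : ∀ p ∈ R, p.length = 2) (t : V) : V → List (BPath R) → Words k R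
  | v, [] => if t = v then 0 else word k [bid hR v]
  | v, q :: l => if q.1.tgt = v ∧ q.1.arrows ≠ [] then -consW k q (normC hR t q.1.src l)
      else word k (bid hR v :: q :: l)

theorem normG_append_singleton (hR : ∀ p ∈ R, p.length = 2) (y : BPath R) (v : V)
    (l : List (BPath R)) : normG k hR v (l ++ [y]) = snocW k y (normC hR y.1.tgt v l) := by
  induction l generalizing v with
  | nil =>
    simp only [List.nil_append, normG, normC]
    split_ifs <;> simp_all
  | cons q l ih =>
    rw [List.cons_append, normG, normC, ih]
    split_ifs <;> simp_all [snocW_consW]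

open Classical in
/-- `splitE`, for a word without its last letter. -/
def splitC (hR : ∀ p ∈ R, p.length = 2) : List (BPath R) → Words k R
  | [] => 0
  | [p] => if h : 2 ≤ p.1.length then
      word k [hd hR p (arrows_ne_nil_of_two_le h), tl hR p (arrows_ne_nil_of_two_le h)]
    else 0
  | p :: q :: l =>
    if h : 2 ≤ p.1.length then
      word k (hd hR p (arrows_ne_nil_of_two_le h) :: tl hR p (arrows_ne_nil_of_two_le h) :: q :: l)
    else -consW k p (if bmul p q = none then splitC hR (q :: l) else 0)

theorem splitE_append_singleton (hR : ∀ p ∈ R, p.length = 2) (y : BPath R)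
    (l : List (BPath R)) : splitE k hR (l ++ [y]) = snocW k y (splitC hR l) := by
  induction l with
  | nil => simp [splitE, splitC]
  | cons p l ih =>
    cases l with
    | nil =>
      simp only [List.cons_append, List.nil_append, splitE, splitC]
      split_ifs <;> simp
    | cons q l =>
      simp only [List.cons_append] at ih
      simp only [List.cons_append, splitE, splitC, ih]
      split_ifs <;> simp [snocW_consW]

open Classical in
/-- The contraction of the Hochschild complex induced by `htpy`. -/
def chtpyFun (hR : ∀ p ∈ R, p.length = 2) (s : BPath R) (l : List (BPath R)) : CWords k R :=
  optC k (some s) (if IsNormC s.1.tgt s.1.src l then -splitC hR l else normC hR s.1.tgt s.1.src l)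

variable (k) in
/-- `chtpyFun` as a linear map. -/
def chtpy (hR : ∀ p ∈ R, p.length = 2) : CWords k R →ₗ[k] CWords k R :=
  Finsupp.linearCombination k fun w => chtpyFun hR w.1 w.2

@[simp]
theorem chtpy_cword (hR : ∀ p ∈ R, p.length = 2) (s : BPath R) (l : List (BPath R)) :
    chtpy k hR (cword k s l) = chtpyFun hR s l := by
  simp [chtpy]

theorem chtpy_close (hR : ∀ p ∈ R, p.length = 2) (z : Words k R) :
    chtpy k hR (close k z) = close k (htpy k hR z) := by
  have : chtpy k hR ∘ₗ close k = (close k ∘ₗ htpy k hR : Words k R →ₗ[k] CWords k R) := by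
    refine words_hom_ext_ends ?_ ?_ ?_
    · have : normProj k (word k ([] : List (BPath R))) = word k [] := by simp [normProj]
      simp [htpy, normHtpyFun, splitHtpyFun, this]
    · intro x
      simp [htpy_word_of_isNorm hR (x := x) (l := []) trivial, splitE]
    · intro x l y
      simp only [LinearMap.comp_apply, close_word]
      have key : close k (htpy k hR (word k (x :: (l ++ [y])))) = optC k (bmul y x)
          (open Classical in if IsNormC y.1.tgt x.1.src l then -splitC hR l
            else normC hR y.1.tgt x.1.src l) := by
        split_ifs with h
        · rw [htpy_word_of_isNorm hR ((isNorm_append_singleton y _ l).2 h),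
            splitE_append_singleton, map_neg, close_consW_snocW, map_neg]
        · rw [htpy_word_of_not_isNorm hR (mt (isNorm_append_singleton y _ l).1 h),
            normG_append_singleton, close_consW_snocW]
      rw [key]
      rcases h : bmul y x with _ | s
      · simp
      · rw [optC_some_word, chtpy_cword, chtpyFun, src_of_bmul h, tgt_of_bmul h]
  exact LinearMap.congr_fun this z

/-- The sum of the lengths of the letters of a word. -/
def weight (l : List (BPath R)) : ℕ := (l.map fun p => p.1.length).sum

@[simp] theorem weight_nil : weight ([] : List (BPath R)) = 0 := rfl

@[simp] theorem weight_cons (p : BPath R) (l : List (BPath R)) :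
    weight (p :: l) = p.1.length + weight l := by simp [weight]

/-- The tuples `(s, [c_m, …, c_1])` of the pairs `(s, c_m ⋯ c_1)` in `B ⊙ Γ`. -/
def IsKoszulC (s : BPath R) (l : List (BPath R)) : Prop :=
  IsNormC s.1.tgt s.1.src l ∧ (∀ p ∈ l, p.1.length = 1) ∧ l.IsChain fun p q => bmul p q = none

variable (k R) in
/-- The image of the complex `k(B ⊙ Γ)` in the Hochschild complex. -/
def koszulSpan : Submodule k (CWords k R) :=
  Submodule.span k {z | ∃ s l, IsKoszulC s l ∧ z = cword k s l}

theorem cword_mem_koszulSpan {s : BPath R} {l : List (BPath R)} (h : IsKoszulC s l) :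
    cword k s l ∈ koszulSpan k R := Submodule.subset_span ⟨s, l, h, rfl⟩

theorem barFun_eq_zero_of_isChain {l : List (BPath R)}
    (h : l.IsChain fun p q => bmul p q = none) : barFun k l = 0 := by
  induction l with
  | nil => rfl
  | cons p l ih =>
    rw [barFun_cons, ih h.tail, map_zero, sub_zero]
    cases l with
    | nil => rfl
    | cons q l => rw [lmulFun_cons, (List.isChain_cons_cons.1 h).1, optW_none]

theorem isNormC_append_singleton {t v : V} {z : BPath R} {l : List (BPath R)} :
    IsNormC t v (l ++ [z]) ↔ IsNormC z.1.tgt v l ∧ z.1.arrows ≠ [] ∧ t = z.1.src := by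
  induction l generalizing v with
  | nil => simp [IsNormC]
  | cons q l ih => simp [IsNormC, ih, and_assoc]

theorem hochFun_mem_koszulSpan {s : BPath R} {l : List (BPath R)} (h : IsKoszulC s l) :
    hochFun s l ∈ koszulSpan k R := by
  cases l with
  | nil => exact Submodule.zero_mem _
  | cons q l =>
    obtain ⟨hn, h1, hc⟩ := h
    rw [hochFun, barFun_eq_zero_of_isChain hc, map_zero, sub_zero]
    refine Submodule.add_mem _ ?_ (Submodule.smul_mem _ _ ?_)
    · rcases hb : bmul s q with _ | r
      · simp
      · rw [optC_some_word]
        refine cword_mem_koszulSpan ⟨?_, fun p hp => h1 p (by simp [hp]), hc.tail⟩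
        rw [src_of_bmul hb, tgt_of_bmul hb]
        exact hn.2.2
    · obtain ⟨l', z, hl⟩ := (List.eq_nil_or_concat' (q :: l)).resolve_left (by simp)
      rw [hl] at hn h1 hc
      simp only [hl, List.dropLast_concat]
      rcases hb : bmul (List.getLast (l' ++ [z]) (by simp)) s with _ | r
      · simp
      · rw [List.getLast_append_singleton] at hb
        rw [optC_some_word]
        refine cword_mem_koszulSpan ⟨?_, fun p hp => h1 p (by simp [hp]), hc.left_of_append⟩
        rw [src_of_bmul hb, tgt_of_bmul hb]
        exact (isNormC_append_singleton.1 hn).1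

theorem splitC_eq_zero (hR : ∀ p ∈ R, p.length = 2) {l : List (BPath R)}
    (h1 : ∀ p ∈ l, p.1.length = 1) : (splitC hR l : Words k R) = 0 := by
  induction l with
  | nil => rfl
  | cons p l ih =>
    have hp := h1 p (by simp)
    have ih := ih fun q hq => h1 q (by simp [hq])
    cases l with
    | nil => simp [splitC, hp]
    | cons q l => simp [splitC, hp, ih]

theorem chtpyFun_eq_zero (hR : ∀ p ∈ R, p.length = 2) {s : BPath R} {l : List (BPath R)}
    (h : IsKoszulC s l) : (chtpyFun hR s l : CWords k R) = 0 := by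
  rw [chtpyFun, if_pos h.1, splitC_eq_zero hR h.2.1, neg_zero, map_zero]

theorem exists_of_isKoszul {v : V} {m : List (BPath R)} (h : IsKoszul v m) :
    ∃ l y, m = l ++ [y] ∧ IsNormC y.1.tgt v l ∧ (∀ p ∈ l, p.1.length = 1) ∧
      l.IsChain fun p q => bmul p q = none := by
  induction m generalizing v with
  | nil => exact h.elim
  | cons p m ih =>
    cases m with
    | nil => exact ⟨[], p, rfl, h, by simp, List.isChain_nil⟩
    | cons q m =>
      obtain ⟨h1, h2, h3, h4⟩ := h
      obtain ⟨l, y, hm, hn, hl, hc⟩ := ih h4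
      refine ⟨p :: l, y, by simp [hm], ⟨h1, ?_, hn⟩, by simpa [h2] using hl, ?_⟩
      · intro h
        simp [QPath.length, h] at h2
      · cases l with
        | nil => exact List.isChain_singleton p
        | cons q' l =>
          simp only [List.cons_append, List.cons.injEq] at hm
          obtain ⟨rfl, rfl⟩ := hm
          exact List.isChain_cons_cons.2 ⟨h3 (by simp), hc⟩

theorem length_hd_add_length_tl (hR : ∀ p ∈ R, p.length = 2) (p : BPath R)
    (hp : p.1.arrows ≠ []) : (hd hR p hp).1.length + (tl hR p hp).1.length = p.1.length := by
  have := congrArg List.length (arrows_of_bmul (hd_bmul_tl hR p hp))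
  rw [List.length_append] at this
  exact this.symm

/-- `splitC` preserves the weight, and its first letter is not trivial. -/
theorem splitC_mem (hR : ∀ p ∈ R, p.length = 2) (l : List (BPath R))
    (hl : ∀ p ∈ l, p.1.arrows ≠ []) :
    (splitC hR l : Words k R) ∈ wordSpan k fun m => weight m ≤ weight l ∧
      ∃ c m', m = c :: m' ∧ c.1.arrows ≠ [] := by
  induction l with
  | nil => simp [splitC]
  | cons p l ih =>
    have hp := hl p (by simp)
    have hhd : (hd hR p hp).1.arrows ≠ [] := by simp [hd, QPath.lastArrow, QPath.ofArrow]
    have hw := length_hd_add_length_tl hR p hp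
    cases l with
    | nil =>
      rw [splitC]
      split_ifs with h
      · exact word_mem_wordSpan ⟨by simp [hw], _, _, rfl, hhd⟩
      · simp
    | cons q l =>
      rw [splitC]
      split_ifs with h h'
      · exact word_mem_wordSpan ⟨by simp [← add_assoc, hw], _, _, rfl, hhd⟩
      · refine Submodule.neg_mem _ (consW_mem_wordSpan ?_ (ih fun q hq => hl q (by simp [hq])))
        rintro m ⟨hm, -⟩
        exact ⟨by rw [weight_cons p, weight_cons p]; omega, p, m, rfl, hp⟩
      · simp

theorem arrows_ne_nil_of_isNormC {t v : V} {l : List (BPath R)} (h : IsNormC t v l) :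
    ∀ p ∈ l, p.1.arrows ≠ [] := by
  induction l generalizing v with
  | nil => simp
  | cons q l ih => simpa [h.2.1] using ih h.2.2

variable (k) in
/-- The deformation of the identity of the Hochschild complex induced by the contraction. -/
def deform (hR : ∀ p ∈ R, p.length = 2) : CWords k R →ₗ[k] CWords k R :=
  LinearMap.id - hoch k ∘ₗ chtpy k hR - chtpy k hR ∘ₗ hoch k

theorem deform_apply (hR : ∀ p ∈ R, p.length = 2) (z : CWords k R) :
    deform k hR z = z - hoch k (chtpy k hR z) - chtpy k hR (hoch k z) := rfl

theorem deform_close (hR : ∀ p ∈ R, p.length = 2) (z : Words k R) :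
    deform k hR (close k z) = close k (z - bar k (htpy k hR z) - htpy k hR (bar k z)) := by
  rw [deform_apply, chtpy_close, hoch_close hR, hoch_close hR, chtpy_close, map_sub, map_sub]

/-- The deformation sends a tuple to the image of `k(B ⊙ Γ)`, up to tuples of lower weight. -/
theorem deform_cword_mem (hR : ∀ p ∈ R, p.length = 2) (s : BPath R) (l : List (BPath R)) :
    deform k hR (cword k s l) ∈ koszulSpan k R ⊔
      Submodule.span k {z | ∃ s' l', weight l' < weight l ∧ z = cword k s' l'} := by
  set y := bid hR s.1.tgt with hy
  rw [cword_eq_close hR, deform_close, bar_word, sub_htpy hR (by simp), normProj_word_cons]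
  by_cases hn : IsNorm s.1.src (l ++ [y])
  · rw [if_pos hn, splitHtpy_word, bar_word, sub_bar_splitHtpy, map_sub, map_add]
    have hn' := (isNorm_append_singleton y _ l).1 hn
    refine Submodule.sub_mem _ (Submodule.add_mem _ ?_ ?_) ?_
    · refine Submodule.mem_sup_left ?_
      cases l with
      | nil =>
        have : word k ([] ++ [y]) - bar k (splitE k hR ([] ++ [y])) -
            splitEW k hR (barFun k ([] ++ [y])) = word k ([] ++ [y]) := by simp [splitE, barFun]
        rw [this, consW_word, close_word, hy, bid_bmul, optC_some_word]
        exact cword_mem_koszulSpan ⟨hn', by simp, List.isChain_nil⟩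
      | cons q l =>
        refine map_mem_of_mem_wordSpan (f := close k ∘ₗ consW k s) ?_
          (sub_bar_splitE_mem hR s.1.src q (l := l ++ [y]) (by simp) hn)
        rintro m ⟨hm, -⟩
        obtain ⟨l', y', rfl, h1, h2, h3⟩ := exists_of_isKoszul hm
        rw [LinearMap.comp_apply, consW_word, close_word]
        rcases hb : bmul y' s with _ | r
        · simp
        · rw [optC_some_word]
          refine cword_mem_koszulSpan ⟨?_, h2, h3⟩
          rw [src_of_bmul hb, tgt_of_bmul hb]
          exact h1
    · refine Submodule.mem_sup_right ?_
      rw [splitE_append_singleton]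
      refine map_mem_of_mem_wordSpan (f := close k ∘ₗ lmulW k s ∘ₗ snocW k y) ?_
        (splitC_mem hR l (arrows_ne_nil_of_isNormC hn'))
      rintro _ ⟨hw, c, m', rfl, hc⟩
      have hc' : 0 < c.1.length := List.length_pos_iff.2 hc
      rw [weight_cons] at hw
      simp only [LinearMap.comp_apply, snocW_word, List.cons_append, lmulW_word, lmulFun_cons]
      rcases hb : bmul s c with _ | r
      · simp
      · rw [optW_some, close_word]
        rcases hb' : bmul y r with _ | r'
        · simp
        · rw [optC_some_word]
          exact Submodule.subset_span ⟨r', m', by omega, rfl⟩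
    · refine Submodule.mem_sup_right ?_
      cases l with
      | nil =>
        simp only [List.nil_append, lmulFun_cons]
        rcases bmul s y with _ | r <;> simp [splitHtpyFun, splitE]
      | cons q l =>
        have hq : 0 < q.1.length := List.length_pos_iff.2 hn'.2.1
        rw [List.cons_append, lmulFun_cons]
        rcases hb : bmul s q with _ | r
        · simp
        · rw [optW_some, splitHtpy_word, splitHtpyFun, splitE_append_singleton, map_neg,
            close_consW_snocW]
          refine Submodule.neg_mem _ ?_
          refine map_mem_of_mem_wordSpan ?_ (splitC_mem hR l (arrows_ne_nil_of_isNormC hn'.2.2))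
          rintro m ⟨hw, -⟩
          rcases hb' : bmul y r with _ | r'
          · simp
          · rw [optC_some_word]
            exact Submodule.subset_span ⟨r', m, by rw [weight_cons]; omega, rfl⟩
  · rw [if_neg hn]
    simp

theorem hoch_mem_koszulSpan {z : CWords k R} (hz : z ∈ koszulSpan k R) :
    hoch k z ∈ koszulSpan k R := by
  suffices h : koszulSpan k R ≤ (koszulSpan k R).comap (hoch k) from h hz
  refine Submodule.span_le.2 ?_
  rintro _ ⟨s, l, h, rfl⟩
  change hoch k (cword k s l) ∈ koszulSpan k R
  rw [hoch_cword]
  exact hochFun_mem_koszulSpan h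

theorem chtpy_eq_zero (hR : ∀ p ∈ R, p.length = 2) {z : CWords k R} (hz : z ∈ koszulSpan k R) :
    chtpy k hR z = 0 := by
  suffices h : koszulSpan k R ≤ LinearMap.ker (chtpy k hR) from h hz
  refine Submodule.span_le.2 ?_
  rintro _ ⟨s, l, h, rfl⟩
  change chtpy k hR (cword k s l) = 0
  rw [chtpy_cword, chtpyFun_eq_zero hR h]

theorem deform_of_mem_koszulSpan (hR : ∀ p ∈ R, p.length = 2) {z : CWords k R}
    (hz : z ∈ koszulSpan k R) : deform k hR z = z := by
  rw [deform_apply, chtpy_eq_zero hR hz, chtpy_eq_zero hR (hoch_mem_koszulSpan hz), map_zero,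
    sub_zero, sub_zero]

theorem hoch_deform (hR : ∀ p ∈ R, p.length = 2) (z : CWords k R) :
    hoch k (deform k hR z) = deform k hR (hoch k z) := by
  simp [deform_apply, hoch_hoch hR]

theorem iterate_deform_of_mem_koszulSpan (hR : ∀ p ∈ R, p.length = 2) {z : CWords k R}
    (hz : z ∈ koszulSpan k R) (n : ℕ) : (deform k hR)^[n] z = z :=
  Function.iterate_fixed (deform_of_mem_koszulSpan hR hz) n

/-- The elements that are moved to the image of `k(B ⊙ Γ)` by some iterate of the deformation. -/
def eventuallyKoszul (hR : ∀ p ∈ R, p.length = 2) : Submodule k (CWords k R) where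
  carrier := {z | ∃ n, (deform k hR)^[n] z ∈ koszulSpan k R}
  zero_mem' := ⟨0, Submodule.zero_mem _⟩
  add_mem' := by
    rintro z w ⟨n, hn⟩ ⟨m, hm⟩
    refine ⟨n + m, ?_⟩
    have h1 : (deform k hR)^[n + m] z = (deform k hR)^[m] ((deform k hR)^[n] z) := by
      rw [Nat.add_comm, Function.iterate_add_apply]
    rw [iterate_map_add, h1, Function.iterate_add_apply _ n m w,
      iterate_deform_of_mem_koszulSpan hR hn, iterate_deform_of_mem_koszulSpan hR hm]
    exact Submodule.add_mem _ hn hm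
  smul_mem' := by
    rintro c z ⟨n, hn⟩
    refine ⟨n, ?_⟩
    rw [← Module.End.pow_apply, map_smul, Module.End.pow_apply]
    exact Submodule.smul_mem _ _ hn

theorem eventuallyKoszul_eq_top (hR : ∀ p ∈ R, p.length = 2) :
    (eventuallyKoszul hR : Submodule k (CWords k R)) = ⊤ := by
  have hK : koszulSpan k R ≤ eventuallyKoszul hR := fun z hz => ⟨0, hz⟩
  have key : ∀ n s (l : List (BPath R)), weight l < n → cword k s l ∈ eventuallyKoszul hR := by
    intro n
    induction n with
    | zero => intro s l h; omega
    | succ n ih =>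
      intro s l h
      have h1 : deform k hR (cword k s l) ∈ eventuallyKoszul hR := by
        refine sup_le hK (Submodule.span_le.2 ?_) (deform_cword_mem hR s l)
        rintro _ ⟨s', l', h', rfl⟩
        exact ih s' l' (by omega)
      obtain ⟨m, hm⟩ := h1
      exact ⟨m + 1, by rwa [Function.iterate_succ_apply]⟩
  refine eq_top_iff.2 fun z _ => ?_
  induction z using Finsupp.induction_linear with
  | zero => exact Submodule.zero_mem _
  | add z w hz hw => exact Submodule.add_mem _ (hz trivial) (hw trivial)
  | single x c =>
    have : (Finsupp.single x c : CWords k R) = c • cword k x.1 x.2 := by simp [cword]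
    rw [this]
    exact Submodule.smul_mem _ _ (key _ _ _ (Nat.lt_succ_self _))

theorem exists_sub_iterate_deform (hR : ∀ p ∈ R, p.length = 2) {z : CWords k R}
    (hz : hoch k z = 0) (n : ℕ) : ∃ u, z = (deform k hR)^[n] z + hoch k u := by
  induction n with
  | zero => exact ⟨0, by simp⟩
  | succ n ih =>
    obtain ⟨u, hu⟩ := ih
    set w := (deform k hR)^[n] z with hw
    have hw0 : hoch k w = 0 := by
      have h1 : z - hoch k u = w := by rw [hu]; simp
      rw [← h1, map_sub, hz, hoch_hoch hR, sub_zero]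
    refine ⟨u + chtpy k hR w, ?_⟩
    rw [Function.iterate_succ_apply', ← hw, deform_apply, hw0, map_add]
    nth_rw 1 [hu]
    simp

/-- Every Hochschild cycle is homologous to one in the image of `k(B ⊙ Γ)`. -/
theorem exists_koszul_of_hoch_eq_zero (hR : ∀ p ∈ R, p.length = 2) {z : CWords k R}
    (hz : hoch k z = 0) : ∃ w ∈ koszulSpan k R, ∃ u, z = w + hoch k u := by
  obtain ⟨n, hn⟩ : z ∈ eventuallyKoszul hR := by rw [eventuallyKoszul_eq_top]; trivial
  exact ⟨_, hn, exists_sub_iterate_deform hR hz n⟩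

/-- A boundary in the image of `k(B ⊙ Γ)` is the boundary of an element of this image. -/
theorem exists_koszul_of_eq_hoch (hR : ∀ p ∈ R, p.length = 2) {z u : CWords k R}
    (hz : z ∈ koszulSpan k R) (h : z = hoch k u) : ∃ w ∈ koszulSpan k R, z = hoch k w := by
  obtain ⟨n, hn⟩ : u ∈ eventuallyKoszul hR := by rw [eventuallyKoszul_eq_top]; trivial
  refine ⟨_, hn, ?_⟩
  have h1 : Function.Commute (hoch k) (deform k hR) := hoch_deform hR
  rw [(h1.iterate_right n).eq, ← h, iterate_deform_of_mem_koszulSpan hR hz]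

end CyclicWords

/-! ### The basis of the monomial algebra -/

section AlgebraBasis

variable (k : Type*) [Field k] {V : Type*} [Quiver V] {R : Set (QPath V)}

open Classical in
variable (R) in
/-- The projection of the path algebra onto the span of the paths in `BPath R`. -/
def toBPath : PathAlgebra k V →ₗ[k] (BPath R →₀ k) :=
  Finsupp.linearCombination k fun p : QPath V =>
    if h : p ∈ pathsB R then Finsupp.single ⟨p, h⟩ 1 else 0

open Classical in
theorem toBPath_ofPath (p : QPath V) : toBPath k R (PathAlgebra.ofPath k p) =
    if h : p ∈ pathsB R then Finsupp.single ⟨p, h⟩ 1 else 0 :=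
  (Finsupp.linearCombination_single k (1 : k) p).trans (one_smul k _)

variable {k}

theorem pathAlgebra_hom_ext {N : Type*} [AddCommGroup N] [Module k N]
    {f g : PathAlgebra k V →ₗ[k] N}
    (h : ∀ p, f (PathAlgebra.ofPath k p) = g (PathAlgebra.ofPath k p)) : f = g := by
  refine LinearMap.ext_on PathAlgebra.span_ofPath ?_
  rintro _ ⟨p, rfl⟩
  exact h p

theorem ofPath_mul_ofPath_of_eq {p q : QPath V} (h : p.src = q.tgt) :
    PathAlgebra.ofPath k p * PathAlgebra.ofPath k q = PathAlgebra.ofPath k (p.comp q h) := by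
  rw [PathAlgebra.mul_def, PathAlgebra.ofPath_mul_ofPath, dif_pos h]

theorem ofPath_mul_ofPath_of_ne {p q : QPath V} (h : p.src ≠ q.tgt) :
    PathAlgebra.ofPath k p * PathAlgebra.ofPath k q = 0 := by
  rw [PathAlgebra.mul_def, PathAlgebra.ofPath_mul_ofPath, dif_neg h]

theorem not_mem_pathsB_comp_left (hR : ∀ p ∈ R, p.length = 2) {p q : QPath V} (h : p.src = q.tgt)
    (hp : p ∉ pathsB R) : p.comp q h ∉ pathsB R := by
  rw [mem_pathsB_iff hR] at hp ⊢
  exact fun h' => hp h'.left_of_append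

theorem not_mem_pathsB_comp_right (hR : ∀ p ∈ R, p.length = 2) {p q : QPath V}
    (h : p.src = q.tgt) (hq : q ∉ pathsB R) : p.comp q h ∉ pathsB R := by
  rw [mem_pathsB_iff hR] at hq ⊢
  exact fun h' => hq h'.right_of_append

theorem toBPath_mul_eq_zero (hR : ∀ p ∈ R, p.length = 2) (y : PathAlgebra k V)
    {x : PathAlgebra k V} (hx : toBPath k R x = 0) : toBPath k R (y * x) = 0 := by
  induction y using PathAlgebra.induction with
  | h0 => rw [zero_mul, map_zero]
  | hadd y z hy hz => rw [add_mul, map_add, hy, hz, add_zero]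
  | hsmul c y hy => rw [smul_mul_assoc, map_smul, hy, smul_zero]
  | hp q =>
    have : toBPath k R ∘ₗ LinearMap.mulLeft k (PathAlgebra.ofPath k q) =
        (Finsupp.linearCombination k fun p : BPath R =>
          toBPath k R (PathAlgebra.ofPath k q * PathAlgebra.ofPath k p.1)) ∘ₗ toBPath k R := by
      refine pathAlgebra_hom_ext fun p => ?_
      simp only [LinearMap.comp_apply, LinearMap.mulLeft_apply]
      rw [toBPath_ofPath k p]
      split_ifs with hp
      · simp
      · rw [map_zero]
        by_cases h : q.src = p.tgt
        · rw [ofPath_mul_ofPath_of_eq h, toBPath_ofPath,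
            dif_neg (not_mem_pathsB_comp_right hR h hp)]
        · rw [ofPath_mul_ofPath_of_ne h, map_zero]
    have := LinearMap.congr_fun this x
    simpa [hx] using this

theorem toBPath_mul_eq_zero' (hR : ∀ p ∈ R, p.length = 2) (y : PathAlgebra k V)
    {x : PathAlgebra k V} (hx : toBPath k R x = 0) : toBPath k R (x * y) = 0 := by
  induction y using PathAlgebra.induction with
  | h0 => rw [mul_zero, map_zero]
  | hadd y z hy hz => rw [mul_add, map_add, hy, hz, add_zero]
  | hsmul c y hy => rw [mul_smul_comm, map_smul, hy, smul_zero]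
  | hp q =>
    have : toBPath k R ∘ₗ LinearMap.mulRight k (PathAlgebra.ofPath k q) =
        (Finsupp.linearCombination k fun p : BPath R =>
          toBPath k R (PathAlgebra.ofPath k p.1 * PathAlgebra.ofPath k q)) ∘ₗ toBPath k R := by
      refine pathAlgebra_hom_ext fun p => ?_
      simp only [LinearMap.comp_apply, LinearMap.mulRight_apply]
      rw [toBPath_ofPath k p]
      split_ifs with hp
      · simp
      · rw [map_zero]
        by_cases h : p.src = q.tgt
        · rw [ofPath_mul_ofPath_of_eq h, toBPath_ofPath,
            dif_neg (not_mem_pathsB_comp_left hR h hp)]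
        · rw [ofPath_mul_ofPath_of_ne h, map_zero]
    have := LinearMap.congr_fun this x
    simpa [hx] using this

theorem toBPath_eq_zero_of_mem (hR : ∀ p ∈ R, p.length = 2) {x : PathAlgebra k V}
    (hx : x ∈ relIdeal k R) : toBPath k R x = 0 := by
  let J : TwoSidedIdeal (PathAlgebra k V) := TwoSidedIdeal.mk' {x | toBPath k R x = 0}
    (map_zero _) (fun {x y} hx hy => by
      simp only [Set.mem_ofPred_eq] at hx hy ⊢; rw [map_add, hx, hy, add_zero])
    (fun {x} hx => by simp only [Set.mem_ofPred_eq] at hx ⊢; rw [map_neg, hx, neg_zero])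
    (fun {x y} hy => toBPath_mul_eq_zero hR x hy) (fun {x y} hx => toBPath_mul_eq_zero' hR y hx)
  have hJ : relIdeal k R ≤ J := by
    refine TwoSidedIdeal.span_le.2 ?_
    rintro _ ⟨p, hp, rfl⟩
    have : toBPath k R (PathAlgebra.ofPath k p) = 0 := by
      rw [toBPath_ofPath, dif_neg]
      intro h
      exact h p ⟨QPath.triv p.tgt, QPath.triv p.src, rfl, rfl, by
        ext1 <;> simp [QPath.comp, QPath.triv]⟩ hp
    simpa [J, TwoSidedIdeal.mem_mk'] using this
  have := hJ hx
  simpa [J, TwoSidedIdeal.mem_mk'] using this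

/-- A path is zero in the monomial algebra if and only if it has a subpath in `R`. -/
theorem ofPath_mem_relIdeal_iff (hR : ∀ p ∈ R, p.length = 2) {p : QPath V} :
    PathAlgebra.ofPath k p ∈ relIdeal k R ↔ p ∉ pathsB R := by
  constructor
  · intro h hp
    have := toBPath_eq_zero_of_mem hR h
    rw [toBPath_ofPath, dif_pos hp] at this
    simp at this
  · intro hp
    simp only [pathsB, Set.mem_ofPred_eq, not_forall, not_not] at hp
    obtain ⟨q, ⟨u, v, hu, hv, rfl⟩, hq⟩ := hp
    have h1 : PathAlgebra.ofPath k q ∈ relIdeal k R := TwoSidedIdeal.subset_span ⟨q, hq, rfl⟩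
    rw [← ofPath_mul_ofPath_of_eq, ← ofPath_mul_ofPath_of_eq]
    exact TwoSidedIdeal.mul_mem_right _ _ _ (TwoSidedIdeal.mul_mem_left _ _ _ h1)

variable (k) in
/-- The class of a path in the monomial algebra. -/
def mkPath (p : BPath R) : MonomialAlgebra k R := MonomialAlgebra.mk R (PathAlgebra.ofPath k p.1)

theorem mk_eq_zero_of_mem {x : PathAlgebra k V} (hx : x ∈ relIdeal k R) :
    MonomialAlgebra.mk R x = 0 :=
  (RingCon.eq _).2 ((TwoSidedIdeal.mem_iff _ _).1 hx)

theorem mkPath_mul_mkPath (hR : ∀ p ∈ R, p.length = 2) (p q : BPath R) :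
    mkPath k p * mkPath k q = (bmul p q).elim 0 (mkPath k) := by
  rw [mkPath, mkPath, ← MonomialAlgebra.mk_mul]
  by_cases h : p.1.src = q.1.tgt
  · rw [ofPath_mul_ofPath_of_eq h]
    rcases hb : bmul p q with _ | r
    · rw [Option.elim_none]
      refine mk_eq_zero_of_mem ((ofPath_mem_relIdeal_iff hR).2 fun hB => ?_)
      have : bmul p q = some ⟨_, hB⟩ := bmul_eq_some.2 ⟨h, rfl⟩
      rw [hb] at this
      simp at this
    · obtain ⟨_, h'⟩ := bmul_eq_some.1 hb
      rw [h']
      rfl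
  · rw [ofPath_mul_ofPath_of_ne h, bmul_eq_none_of_ne h]
    rfl

/-- The projection `MonomialAlgebra.mk` as a linear map. -/
def mkLinear : PathAlgebra k V →ₗ[k] MonomialAlgebra k R where
  toFun := MonomialAlgebra.mk R
  map_add' _ _ := rfl
  map_smul' _ _ := rfl

variable (k) in
/-- The coordinates of an element of the monomial algebra. -/
def coordB (hR : ∀ p ∈ R, p.length = 2) : MonomialAlgebra k R →ₗ[k] (BPath R →₀ k) where
  toFun a := Quotient.liftOn' a (fun x : PathAlgebra k V => toBPath k R x) fun x y h => by
    have h' : x - y ∈ relIdeal k R := (TwoSidedIdeal.rel_iff _ _ _).1 h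
    have := toBPath_eq_zero_of_mem hR h'
    rwa [map_sub, sub_eq_zero] at this
  map_add' a b := by
    obtain ⟨x, rfl⟩ := MonomialAlgebra.mk_surjective R a
    obtain ⟨y, rfl⟩ := MonomialAlgebra.mk_surjective R b
    exact map_add (toBPath k R) x y
  map_smul' c a := by
    obtain ⟨x, rfl⟩ := MonomialAlgebra.mk_surjective R a
    exact map_smul (toBPath k R) c x

theorem coordB_mk (hR : ∀ p ∈ R, p.length = 2) (x : PathAlgebra k V) :
    coordB k hR (MonomialAlgebra.mk R x) = toBPath k R x := rfl

variable (k) in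
/-- The monomial algebra has as a basis the classes of the paths in `BPath R`. -/
def basisB (hR : ∀ p ∈ R, p.length = 2) : Module.Basis (BPath R) k (MonomialAlgebra k R) :=
  Module.Basis.mk (v := mkPath k)
    (by
      refine LinearIndependent.of_comp (coordB k hR) ?_
      have : coordB k hR ∘ mkPath k = fun p : BPath R => Finsupp.single p (1 : k) := by
        funext p
        rw [Function.comp_apply, mkPath, coordB_mk, toBPath_ofPath, dif_pos p.2]
      rw [this]
      exact Finsupp.linearIndependent_single_one k (BPath R))
    (by
      have h1 : LinearMap.range (mkLinear : PathAlgebra k V →ₗ[k] MonomialAlgebra k R) = ⊤ :=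
        LinearMap.range_eq_top.2 (MonomialAlgebra.mk_surjective R)
      rw [← h1, LinearMap.range_eq_map, ← PathAlgebra.span_ofPath, Submodule.map_span,
        Submodule.span_le]
      rintro _ ⟨_, ⟨p, rfl⟩, rfl⟩
      by_cases hp : p ∈ pathsB R
      · exact Submodule.subset_span ⟨⟨p, hp⟩, rfl⟩
      · have : (mkLinear (PathAlgebra.ofPath k p) : MonomialAlgebra k R) = 0 :=
          mk_eq_zero_of_mem ((ofPath_mem_relIdeal_iff hR).2 hp)
        rw [this]
        exact Submodule.zero_mem _)

@[simp]
theorem basisB_apply (hR : ∀ p ∈ R, p.length = 2) (p : BPath R) :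
    basisB k hR p = mkPath k p := by simp [basisB]

end AlgebraBasis

/-! ### Tensor powers as spans of words -/

section TensorWords

variable {k : Type*} [Field k] {V : Type*} [Quiver V] {R : Set (QPath V)}

variable (k) in
/-- The basis of a tensor power of the monomial algebra made of the tensors of paths. -/
def basisT (hR : ∀ p ∈ R, p.length = 2) (n : ℕ) :
    Module.Basis (Fin n → BPath R) k (⨂[k] _ : Fin n, MonomialAlgebra k R) :=
  Basis.piTensorProduct fun _ => basisB k hR

@[simp]
theorem basisT_apply (hR : ∀ p ∈ R, p.length = 2) {n : ℕ} (f : Fin n → BPath R) :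
    basisT k hR n f = PiTensorProduct.tprod k fun i => mkPath k (f i) := by
  simp [basisT]

variable (k) in
/-- The identification of the tensor powers with spans of words. -/
def toWords (hR : ∀ p ∈ R, p.length = 2) (n : ℕ) :
    (⨂[k] _ : Fin n, MonomialAlgebra k R) →ₗ[k] Words k R :=
  Finsupp.lmapDomain k k List.ofFn ∘ₗ (basisT k hR n).repr.toLinearMap

variable (k) in
/-- The identification of the components of the Hochschild complex with spans of tuples. -/
def toCWords (hR : ∀ p ∈ R, p.length = 2) (m : ℕ) :
    (⨂[k] _ : Fin (m + 1), MonomialAlgebra k R) →ₗ[k] CWords k R :=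
  Finsupp.lmapDomain k k (fun f => (f 0, List.ofFn fun j : Fin m => f j.succ)) ∘ₗ
    (basisT k hR (m + 1)).repr.toLinearMap

theorem toWords_tprod (hR : ∀ p ∈ R, p.length = 2) {n : ℕ} (f : Fin n → BPath R) :
    toWords k hR n (PiTensorProduct.tprod k fun i => mkPath k (f i)) = word k (List.ofFn f) := by
  rw [← basisT_apply hR f]
  simp [toWords, word, -basisT_apply]

theorem toCWords_tprod (hR : ∀ p ∈ R, p.length = 2) {m : ℕ} (f : Fin (m + 1) → BPath R) :
    toCWords k hR m (PiTensorProduct.tprod k fun i => mkPath k (f i)) =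
      cword k (f 0) (List.ofFn fun j : Fin m => f j.succ) := by
  rw [← basisT_apply hR f]
  simp [toCWords, cword, -basisT_apply]

theorem toCWords_injective (hR : ∀ p ∈ R, p.length = 2) (m : ℕ) :
    Function.Injective (toCWords k hR m) := by
  refine (Finsupp.mapDomain_injective ?_).comp (basisT k hR (m + 1)).repr.injective
  intro f g h
  rw [Prod.mk.injEq] at h
  have h2 := List.ofFn_injective h.2
  funext i
  refine Fin.cases h.1 (fun j => congrFun h2 j) i

/-- A multilinear map on tuples of elements of the monomial algebra is determined by its values on
tuples of paths. -/
theorem multilinear_ext (hR : ∀ p ∈ R, p.length = 2) {n : ℕ} {N : Type*} [AddCommGroup N]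
    [Module k N] {f g : MultilinearMap k (fun _ : Fin n => MonomialAlgebra k R) N}
    (h : ∀ x : Fin n → BPath R, (f fun i => mkPath k (x i)) = g fun i => mkPath k (x i)) :
    f = g := by
  refine Module.Basis.ext_multilinear (fun _ => basisB k hR) fun v => ?_
  simpa using h v

theorem mkPath_cons (s : BPath R) {n : ℕ} (x : Fin n → BPath R) :
    (Fin.cons (mkPath k s) fun i => mkPath k (x i) : Fin (n + 1) → MonomialAlgebra k R) =
      fun i => mkPath k ((Fin.cons s x : Fin (n + 1) → BPath R) i) := by
  funext i
  refine Fin.cases ?_ (fun j => ?_) i <;> simp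

theorem toWords_cons (hR : ∀ p ∈ R, p.length = 2) (s : BPath R) {n : ℕ}
    (g : Fin n → MonomialAlgebra k R) :
    toWords k hR (n + 1) (PiTensorProduct.tprod k (Fin.cons (mkPath k s) g)) =
      consW k s (toWords k hR n (PiTensorProduct.tprod k g)) := by
  have : (toWords k hR (n + 1)).compMultilinearMap
      ((PiTensorProduct.tprod k).curryLeft (mkPath k s)) =
      (consW k s ∘ₗ toWords k hR n).compMultilinearMap (PiTensorProduct.tprod k) := by
    refine multilinear_ext hR fun x => ?_
    simp only [LinearMap.compMultilinearMap_apply, MultilinearMap.curryLeft_apply,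
      LinearMap.comp_apply, toWords_tprod, consW_word, mkPath_cons]
    rw [List.ofFn_succ]
    simp
  exact MultilinearMap.congr_fun this g

theorem toCWords_cons (hR : ∀ p ∈ R, p.length = 2) (s : BPath R) {n : ℕ}
    (g : Fin n → MonomialAlgebra k R) :
    toCWords k hR n (PiTensorProduct.tprod k (Fin.cons (mkPath k s) g)) =
      optC k (some s) (toWords k hR n (PiTensorProduct.tprod k g)) := by
  have : (toCWords k hR n).compMultilinearMap
      ((PiTensorProduct.tprod k).curryLeft (mkPath k s)) =
      (optC k (some s) ∘ₗ toWords k hR n).compMultilinearMap (PiTensorProduct.tprod k) := by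
    refine multilinear_ext hR fun x => ?_
    simp only [LinearMap.compMultilinearMap_apply, MultilinearMap.curryLeft_apply,
      LinearMap.comp_apply, toWords_tprod, optC_some_word, mkPath_cons, toCWords_tprod]
    simp
  exact MultilinearMap.congr_fun this g

theorem tprod_cons_zero {n : ℕ} (g : Fin n → MonomialAlgebra k R) :
    PiTensorProduct.tprod k (Fin.cons 0 g : Fin (n + 1) → MonomialAlgebra k R) = 0 :=
  (PiTensorProduct.tprod k).map_coord_zero 0 (by simp)

theorem toWords_cons_mul (hR : ∀ p ∈ R, p.length = 2) (p q : BPath R) {n : ℕ}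
    (x : Fin n → BPath R) :
    toWords k hR (n + 1) (PiTensorProduct.tprod k
      (Fin.cons (mkPath k p * mkPath k q) fun i => mkPath k (x i))) =
      optW k (bmul p q) (List.ofFn x) := by
  rw [mkPath_mul_mkPath hR]
  rcases bmul p q with _ | s
  · rw [Option.elim_none, tprod_cons_zero, map_zero, optW_none]
  · rw [Option.elim_some, toWords_cons, toWords_tprod, consW_word, optW_some]

theorem toCWords_cons_mul (hR : ∀ p ∈ R, p.length = 2) (p q : BPath R) {n : ℕ}
    (x : Fin n → BPath R) :
    toCWords k hR n (PiTensorProduct.tprod k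
      (Fin.cons (mkPath k p * mkPath k q) fun i => mkPath k (x i))) =
      optC k (bmul p q) (word k (List.ofFn x)) := by
  rw [mkPath_mul_mkPath hR]
  rcases bmul p q with _ | s
  · rw [Option.elim_none, tprod_cons_zero, map_zero, optC_none]
  · rw [Option.elim_some, toCWords_cons, toWords_tprod]

theorem contractNth_zero_eq {A : Type*} [Mul A] {m : ℕ} (f : Fin (m + 2) → A) :
    Fin.contractNth (0 : Fin (m + 1)).castSucc (· * ·) f =
      Fin.cons (f 0 * f 1) fun j : Fin m => f j.succ.succ := by
  funext i
  refine Fin.cases ?_ (fun j => ?_) i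
  · simp [Fin.contractNth]
  · simp [Fin.contractNth]

theorem contractNth_succ_eq {A : Type*} [Mul A] {m : ℕ} (i : Fin (m + 1)) (f : Fin (m + 3) → A) :
    Fin.contractNth i.succ.castSucc (· * ·) f =
      Fin.cons (f 0) (Fin.contractNth i.castSucc (· * ·) fun j => f j.succ) := by
  funext j
  refine Fin.cases ?_ (fun j => ?_) j
  · simp [Fin.contractNth]
  · simp [Fin.contractNth]

theorem sum_toWords_contractNth (hR : ∀ p ∈ R, p.length = 2) {m : ℕ} (f : Fin (m + 2) → BPath R) :
    ∑ i : Fin (m + 1), (-1 : k) ^ (i : ℕ) • toWords k hR (m + 1) (PiTensorProduct.tprod k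
      (Fin.contractNth i.castSucc (· * ·) fun j => mkPath k (f j))) =
      barFun k (List.ofFn f) := by
  induction m with
  | zero =>
    rw [Fin.sum_univ_one, contractNth_zero_eq,
      toWords_cons_mul hR (f 0) (f 1) fun j : Fin 0 => f j.succ.succ]
    simp [List.ofFn_succ, barFun]
  | succ m ih =>
    rw [Fin.sum_univ_succ, contractNth_zero_eq,
      toWords_cons_mul hR (f 0) (f 1) fun j : Fin (m + 1) => f j.succ.succ]
    have h1 : ∀ i : Fin (m + 1), (-1 : k) ^ (i.succ : ℕ) • toWords k hR (m + 2)
        (PiTensorProduct.tprod k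
          (Fin.contractNth i.succ.castSucc (· * ·) fun j => mkPath k (f j))) =
        -consW k (f 0) ((-1 : k) ^ (i : ℕ) • toWords k hR (m + 1) (PiTensorProduct.tprod k
          (Fin.contractNth i.castSucc (· * ·) fun j => mkPath k (f j.succ)))) := by
      intro i
      rw [contractNth_succ_eq, toWords_cons, map_smul, Fin.val_succ, pow_succ, mul_neg_one,
        neg_smul]
    rw [Finset.sum_congr rfl fun i _ => h1 i, Finset.sum_neg_distrib, ← map_sum,
      ih fun j => f j.succ, List.ofFn_succ (f := f), barFun_cons,
      List.ofFn_succ (f := fun j : Fin (m + 2) => f j.succ), lmulFun_cons, sub_eq_add_neg]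
    simp

theorem cyclicFace_eq {A : Type*} [Mul A] {m : ℕ} (f : Fin (m + 2) → A) :
    cyclicFace f = Fin.cons (f (Fin.last (m + 1)) * f 0) fun j : Fin m => f j.succ.castSucc := by
  funext i
  refine Fin.cases ?_ (fun j => ?_) i
  · simp [cyclicFace]
  · simp [cyclicFace]

theorem hochschildD_tprod {A : Type*} [NonUnitalRing A] [Module k A] [IsScalarTower k A A]
    [SMulCommClass k A A] {m : ℕ} (x : Fin (m + 2) → A) :
    hochschildD k A m (PiTensorProduct.tprod k x) =
      ∑ i : Fin (m + 1), (-1 : k) ^ (i : ℕ) •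
        PiTensorProduct.tprod k (Fin.contractNth i.castSucc (· * ·) x)
      + (-1 : k) ^ (m + 1) • PiTensorProduct.tprod k (cyclicFace x) := by
  simp [hochschildD, tprodComp]

theorem hochFun_of_eq_append {s q z : BPath R} {l l' : List (BPath R)} (h : q :: l = l' ++ [z]) :
    (hochFun s (q :: l) : CWords k R) = optC k (bmul s q) (word k l)
      - optC k (some s) (barFun k (q :: l))
      + (-1 : k) ^ (l.length + 1) • optC k (bmul z s) (word k l') := by
  have h1 : (q :: l).getLast (by simp) = z := by simp [h]
  have h2 : (q :: l).dropLast = l' := by simp [h]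
  rw [hochFun, h1, h2]

/-- The identification of the Hochschild complex with the span of tuples respects the
differentials. -/
theorem hoch_toCWords (hR : ∀ p ∈ R, p.length = 2) (m : ℕ)
    (z : ⨂[k] _ : Fin (m + 2), MonomialAlgebra k R) :
    hoch k (toCWords k hR (m + 1) z) =
      toCWords k hR m (hochschildD k (MonomialAlgebra k R) m z) := by
  have : hoch k ∘ₗ toCWords k hR (m + 1) =
      toCWords k hR m ∘ₗ hochschildD k (MonomialAlgebra k R) m := by
    refine (basisT k hR (m + 2)).ext fun f => ?_
    rw [basisT_apply, LinearMap.comp_apply, LinearMap.comp_apply, toCWords_tprod, hoch_cword,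
      hochschildD_tprod, map_add, map_sum, map_smul, cyclicFace_eq]
    rw [toCWords_cons_mul hR (f (Fin.last (m + 1))) (f 0) fun j : Fin m => f j.succ.castSucc]
    have hl : f 1 :: List.ofFn (fun j : Fin m => f j.succ.succ) =
        List.ofFn (fun j : Fin m => f j.succ.castSucc) ++ [f (Fin.last (m + 1))] := by
      have h1 := List.ofFn_succ (f := fun j : Fin (m + 1) => f j.succ)
      have h2 := List.ofFn_succ_last (f := fun j : Fin (m + 1) => f j.succ)
      exact h1.symm.trans h2
    have hl' : List.ofFn (fun j : Fin (m + 1) => f j.succ) =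
        f 1 :: List.ofFn (fun j : Fin m => f j.succ.succ) := List.ofFn_succ
    rw [hl', hochFun_of_eq_append hl, ← hl', List.length_ofFn]
    congr 1
    rw [Fin.sum_univ_succ, contractNth_zero_eq, map_smul,
      toCWords_cons_mul hR (f 0) (f 1) fun j : Fin m => f j.succ.succ, sub_eq_add_neg]
    congr 1
    · simp
    · cases m with
      | zero => simp [barFun]
      | succ m =>
        rw [← sum_toWords_contractNth hR fun j => f j.succ, map_sum, ← Finset.sum_neg_distrib]
        refine Finset.sum_congr rfl fun i _ => ?_
        rw [contractNth_succ_eq, map_smul, map_smul, toCWords_cons, Fin.val_succ, pow_succ,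
          mul_neg_one, neg_smul]
  exact LinearMap.congr_fun this z

end TensorWords

/-! ### Bases of homology classes -/

section HomologyBasis

variable {k : Type*} [Field k] {X : ℕ → Type*} [∀ n, AddCommGroup (X n)] [∀ n, Module k (X n)]

theorem homologyFreelySpannedBy_iff (d : ∀ n, X (n + 1) →ₗ[k] X n) (n : ℕ) {ι : Type*}
    (z : ι → X n) : HomologyFreelySpannedBy d n z ↔ (∀ i, z i ∈ cycles d n) ∧
      (∀ c : ι →₀ k, Finsupp.linearCombination k z c ∈ boundaries d n → c = 0) ∧
      ∀ w ∈ cycles d n, ∃ c : ι →₀ k, w - Finsupp.linearCombination k z c ∈ boundaries d n := by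
  have key : ∀ (hz : ∀ i, z i ∈ cycles d n) (c : ι →₀ k),
      Finsupp.linearCombination k (fun i => (Submodule.Quotient.mk ⟨z i, hz i⟩ : Homology d n)) c =
        Submodule.Quotient.mk ⟨Finsupp.linearCombination k z c,
          Submodule.sum_mem _ fun i _ => Submodule.smul_mem _ _ (hz i)⟩ := by
    intro hz c
    have h1 : Finsupp.linearCombination k
        (fun i => (Submodule.Quotient.mk ⟨z i, hz i⟩ : Homology d n)) =
        Submodule.mkQ _ ∘ₗ Finsupp.linearCombination k fun i => (⟨z i, hz i⟩ : cycles d n) := by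
      ext i
      simp
    rw [h1, LinearMap.comp_apply, Submodule.mkQ_apply]
    congr 1
    apply Subtype.ext
    have h2 : (cycles d n).subtype ∘ₗ Finsupp.linearCombination k
        (fun i => (⟨z i, hz i⟩ : cycles d n)) = Finsupp.linearCombination k z := by
      ext i
      simp
    exact LinearMap.congr_fun h2 c
  constructor
  · rintro ⟨hz, b, hb⟩
    have hb' : (b : ι → Homology d n) = fun i => Submodule.Quotient.mk ⟨z i, hz i⟩ := funext hb
    refine ⟨hz, fun c hc => ?_, fun w hw => ?_⟩
    · have h1 := b.linearIndependent
      rw [hb', linearIndependent_iff] at h1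
      refine h1 c ?_
      rw [key hz, Submodule.Quotient.mk_eq_zero]
      exact hc
    · refine ⟨b.repr (Submodule.Quotient.mk ⟨w, hw⟩), ?_⟩
      have h1 := b.linearCombination_repr (Submodule.Quotient.mk ⟨w, hw⟩)
      rw [hb', key hz, eq_comm, Submodule.Quotient.eq] at h1
      exact h1
  · rintro ⟨hz, h1, h2⟩
    refine ⟨hz, Module.Basis.mk (v := fun i => (Submodule.Quotient.mk ⟨z i, hz i⟩ : Homology d n))
      ?_ ?_, fun i => by rw [Module.Basis.mk_apply]⟩
    · rw [linearIndependent_iff]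
      intro c hc
      rw [key hz, Submodule.Quotient.mk_eq_zero] at hc
      exact h1 c hc
    · rintro w -
      obtain ⟨⟨w, hw⟩, rfl⟩ := Submodule.Quotient.mk_surjective _ w
      obtain ⟨c, hc⟩ := h2 w hw
      rw [← Finsupp.range_linearCombination]
      refine ⟨c, ?_⟩
      rw [key hz, eq_comm, Submodule.Quotient.eq]
      exact hc

end HomologyBasis

/-! ### The comparison of the two complexes -/

section Comparison

variable {k : Type*} [Field k] {V : Type*} [Quiver V] {R : Set (QPath V)}

/-- An arrow, as an element of `BPath R`. -/
def arrowB (hR : ∀ p ∈ R, p.length = 2) (a : Quiver.Total V) : BPath R :=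
  ⟨QPath.ofArrow a, ofArrow_mem_pathsB hR a⟩

theorem arrowB_injective (hR : ∀ p ∈ R, p.length = 2) : Function.Injective (arrowB hR) := by
  intro a b h
  have := congrArg (fun p : BPath R => p.1.arrows) h
  simpa [arrowB, QPath.ofArrow] using this

theorem isNormC_map_arrowB (hR : ∀ p ∈ R, p.length = 2) {t v : V} {l : List (Quiver.Total V)} :
    IsNormC t v (l.map (arrowB hR)) ↔ IsWalk v l t := by
  induction l generalizing v with
  | nil => exact eq_comm
  | cons a l ih =>
    simp only [List.map_cons, IsNormC, IsWalk, ih]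
    simp [arrowB, QPath.ofArrow]

theorem bmul_arrowB (hR : ∀ p ∈ R, p.length = 2) {a b : Quiver.Total V} (h : a.left = b.right) :
    bmul (arrowB hR a) (arrowB hR b) = none ↔ Rel R a b := by
  rw [bmul_eq_none hR (show (arrowB hR a).1.src = (arrowB hR b).1.tgt from h)]
  simp [arrowB, QPath.ofArrow]

theorem isChain_map_arrowB (hR : ∀ p ∈ R, p.length = 2) {t v : V} {l : List (Quiver.Total V)}
    (hl : IsWalk v l t) :
    ((l.map (arrowB hR)).IsChain fun p q => bmul p q = none) ↔ l.IsChain (Rel R) := by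
  induction l generalizing v with
  | nil => simp
  | cons a l ih =>
    cases l with
    | nil => simp
    | cons b l =>
      have := ih hl.2
      rw [List.map_cons] at this
      rw [List.map_cons, List.map_cons, List.isChain_cons_cons, List.isChain_cons_cons, this,
        bmul_arrowB hR hl.2.1.symm]

theorem exists_map_arrowB (hR : ∀ p ∈ R, p.length = 2) {l : List (BPath R)}
    (hl : ∀ p ∈ l, p.1.length = 1) : ∃ m : List (Quiver.Total V), l = m.map (arrowB hR) := by
  induction l with
  | nil => exact ⟨[], rfl⟩
  | cons p l ih =>
    obtain ⟨m, rfl⟩ := ih fun q hq => hl q (by simp [hq])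
    obtain ⟨a, ha⟩ := List.length_eq_one_iff.1 (hl p (by simp))
    refine ⟨a :: m, ?_⟩
    rw [List.map_cons]
    congr 1
    exact Subtype.ext (QPath.ext_arrows (by simp [ha, arrowB, QPath.ofArrow]) (by simp [ha]))

/-- The tuple `(α, [c_m, …, c_1])` of a pair `(α, c_m ⋯ c_1)`. -/
def pairToTuple (hR : ∀ p ∈ R, p.length = 2) (m : ℕ) (x : pairs R m) :
    BPath R × List (BPath R) :=
  (⟨x.1.1, x.2.1⟩, x.1.2.arrows.map (arrowB hR))

theorem pairToTuple_injective (hR : ∀ p ∈ R, p.length = 2) (m : ℕ) :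
    Function.Injective (pairToTuple hR m) := by
  rintro ⟨⟨α, γ⟩, hx⟩ ⟨⟨α', γ'⟩, hy⟩ h
  rw [pairToTuple, pairToTuple, Prod.mk.injEq, Subtype.mk.injEq,
    (arrowB_injective hR).list_map.eq_iff] at h
  obtain ⟨h1, h2⟩ := h
  simp only at h1 h2
  subst h1
  refine Subtype.ext (Prod.ext rfl (QPath.ext ?_ h2 ?_))
  · exact hx.2.2.2.1.symm.trans hy.2.2.2.1
  · exact hx.2.2.2.2.symm.trans hy.2.2.2.2

theorem isKoszulC_pairToTuple (hR : ∀ p ∈ R, p.length = 2) {m : ℕ} (x : pairs R m) :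
    IsKoszulC (pairToTuple hR m x).1 (pairToTuple hR m x).2 := by
  obtain ⟨⟨α, γ⟩, h1, h2, h3, h4, h5⟩ := x
  refine ⟨(isNormC_map_arrowB hR).2 ?_, ?_, ?_⟩
  · have := γ.isWalk
    simp only at h4 h5
    simpa only [pairToTuple, h4, h5] using this
  · intro p hp
    simp only [pairToTuple, List.mem_map] at hp
    obtain ⟨a, -, rfl⟩ := hp
    rfl
  · exact (isChain_map_arrowB hR γ.isWalk).2 (mem_pathsΓ_iff.1 h2)

theorem exists_pairToTuple (hR : ∀ p ∈ R, p.length = 2) {s : BPath R} {l : List (BPath R)}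
    (h : IsKoszulC s l) : ∃ x : pairs R l.length, pairToTuple hR _ x = (s, l) := by
  obtain ⟨h1, h2, h3⟩ := h
  obtain ⟨m, rfl⟩ := exists_map_arrowB hR h2
  rw [isNormC_map_arrowB] at h1
  rw [isChain_map_arrowB hR h1] at h3
  exact ⟨⟨(s.1, ⟨s.1.src, m, s.1.tgt, h1⟩), s.2, mem_pathsΓ_iff.2 h3, by simp [QPath.length],
    rfl, rfl⟩, rfl⟩

variable (k) in
/-- The embedding of a component of `k(B ⊙ Γ)` into the span of tuples. -/
def chainsToC (hR : ∀ p ∈ R, p.length = 2) (m : ℕ) : Chains k R m →ₗ[k] CWords k R :=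
  Finsupp.lmapDomain k k (pairToTuple hR m)

theorem chainsToC_single (hR : ∀ p ∈ R, p.length = 2) (m : ℕ) (x : pairs R m) :
    chainsToC k hR m (Finsupp.single x 1) =
      cword k ⟨x.1.1, x.2.1⟩ (x.1.2.arrows.map (arrowB hR)) := by
  simp [chainsToC, cword, pairToTuple]

theorem chainsToC_injective (hR : ∀ p ∈ R, p.length = 2) (m : ℕ) :
    Function.Injective (chainsToC k hR m) :=
  Finsupp.mapDomain_injective (pairToTuple_injective hR m)

theorem toCWords_toHochschild (hR : ∀ p ∈ R, p.length = 2) (m : ℕ) (z : Chains k R m) :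
    toCWords k hR m (toHochschild k R m z) = chainsToC k hR m z := by
  have : toCWords k hR m ∘ₗ toHochschild k R m = chainsToC k hR m := by
    refine Finsupp.lhom_ext' fun x => LinearMap.ext_ring ?_
    have hm : x.1.2.arrows.length = m := x.2.2.2.1
    have h1 : toHochschild k R m (Finsupp.single x 1) = PiTensorProduct.tprod k
        (Fin.cons (mkPath k ⟨x.1.1, x.2.1⟩)
          fun j : Fin m => mkPath k (arrowB hR (x.1.2.arrows.get (Fin.cast hm.symm j)))) :=
      (Finsupp.linearCombination_single k (1 : k) x).trans (one_smul k _)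
    simp only [LinearMap.comp_apply, Finsupp.lsingle_apply]
    rw [h1, toCWords_cons, toWords_tprod hR
      (fun j : Fin m => arrowB hR (x.1.2.arrows.get (Fin.cast hm.symm j))), optC_some_word,
      chainsToC_single]
    congr 1
    refine List.ext_getElem (by simp [hm]) fun i h2 h3 => ?_
    simp
  exact LinearMap.congr_fun this z

open Classical in
theorem chainsToC_pair (hR : ∀ p ∈ R, p.length = 2) {m : ℕ} {α γ : QPath V}
    (h2 : γ ∈ pathsΓ R) (h3 : γ.length = m) (h4 : α.src = γ.tgt) (h5 : α.tgt = γ.src) :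
    chainsToC k hR m (pair k R m α γ) =
      if h : α ∈ pathsB R then cword k ⟨α, h⟩ (γ.arrows.map (arrowB hR)) else 0 := by
  by_cases h : α ∈ pathsB R
  · rw [pair, dif_pos (show (α, γ) ∈ pairs R m from ⟨h, h2, h3, h4, h5⟩), dif_pos h,
      chainsToC_single]
  · rw [pair, dif_neg (fun h' => h h'.1), dif_neg h, map_zero]

theorem optC_bmul (p q : BPath R) (h : p.1.src = q.1.tgt) (l : List (BPath R)) :
    optC k (bmul p q) (word k l) =
      (open Classical in if h' : p.1.comp q.1 h ∈ pathsB R then cword k ⟨_, h'⟩ l else 0) := by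
  split_ifs with h'
  · have : bmul p q = some ⟨_, h'⟩ := bmul_eq_some.2 ⟨h, rfl⟩
    rw [this, optC_some_word]
  · have : bmul p q = none := by
      rcases hb : bmul p q with _ | r
      · rfl
      · obtain ⟨_, h2⟩ := bmul_eq_some.1 hb
        exact absurd (h2 ▸ r.2) h'
    rw [this, optC_none]

theorem chainsD_single {m : ℕ} {α γ : QPath V} (hx : (α, γ) ∈ pairs R (m + 1))
    (hne : γ.arrows ≠ []) (h1 : α.src = (γ.lastArrow hne).tgt)
    (h2 : (γ.firstArrow hne).src = α.tgt) :
    chainsD k R m (Finsupp.single ⟨(α, γ), hx⟩ 1) =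
      pair k R m (α.comp (γ.lastArrow hne) h1) (γ.dropLastArrow hne) +
        (-1 : k) ^ (m + 1) • pair k R m ((γ.firstArrow hne).comp α h2) (γ.dropFirstArrow hne) :=
  (Finsupp.linearCombination_single k (1 : k) _).trans (one_smul k _)

theorem hoch_chainsToC (hR : ∀ p ∈ R, p.length = 2) (m : ℕ) (z : Chains k R (m + 1)) :
    hoch k (chainsToC k hR (m + 1) z) = chainsToC k hR m (chainsD k R m z) := by
  have : hoch k ∘ₗ chainsToC k hR (m + 1) = chainsToC k hR m ∘ₗ chainsD k R m := by
    refine Finsupp.lhom_ext' fun x => LinearMap.ext_ring ?_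
    simp only [LinearMap.comp_apply, Finsupp.lsingle_apply]
    rw [chainsToC_single, hoch_cword]
    have hK := isKoszulC_pairToTuple hR x
    have hne := pairs_ne_nil x
    obtain ⟨⟨α, γ⟩, hx⟩ := x
    obtain ⟨h1, h2, h3, h4, h5⟩ := id hx
    simp only at h1 h2 h3 h4 h5 hne ⊢
    have hΓ := mem_pathsΓ_iff.1 h2
    have hlen : γ.arrows.length = m + 1 := h3
    obtain ⟨c, l, hcl⟩ := List.exists_cons_of_ne_nil hne
    obtain ⟨l', c', hcl'⟩ := (List.eq_nil_or_concat' γ.arrows).resolve_left hne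
    have hm : l.length = m := by simpa [hcl] using hlen
    have e1 : γ.arrows.head hne = c := by simp [hcl]
    have e2 : γ.arrows.getLast hne = c' := by simp [hcl']
    have hcat : arrowB hR c :: l.map (arrowB hR) = l'.map (arrowB hR) ++ [arrowB hR c'] := by
      rw [← List.map_cons, ← hcl, hcl']
      simp
    have h6 : γ.arrows.map (arrowB hR) = arrowB hR c :: l.map (arrowB hR) := by simp [hcl]
    have e5 : (γ.dropLastArrow hne).arrows = l := by simp [QPath.dropLastArrow, hcl]
    have e6 : (γ.dropFirstArrow hne).arrows = l' := by simp [QPath.dropFirstArrow, hcl']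
    subst e1 e2
    have hs1 : α.src = (γ.lastArrow hne).tgt := h4.trans (γ.isWalk.head hne).symm
    have hs2 : (γ.firstArrow hne).src = α.tgt := (γ.isWalk.getLast hne).trans h5.symm
    have hbar := barFun_eq_zero_of_isChain (k := k) hK.2.2
    simp only [pairToTuple, h6] at hbar
    have p1 := chainsToC_pair (k := k) hR (m := m) (α := α.comp (γ.lastArrow hne) hs1)
      (γ := γ.dropLastArrow hne) (mem_pathsΓ_iff.2 hΓ.tail)
      (by simp [QPath.length, QPath.dropLastArrow, hlen]) rfl h5
    have p2 := chainsToC_pair (k := k) hR (m := m) (α := (γ.firstArrow hne).comp α hs2)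
      (γ := γ.dropFirstArrow hne) (mem_pathsΓ_iff.2 hΓ.dropLast)
      (by simp [QPath.length, QPath.dropFirstArrow, hlen]) h4 rfl
    rw [chainsD_single hx hne hs1 hs2, map_add, map_smul, p1, p2, h6,
      hochFun_of_eq_append hcat, hbar, map_zero, sub_zero, List.length_map, hm,
      optC_bmul (⟨α, h1⟩ : BPath R) (arrowB hR (γ.arrows.head hne)) hs1,
      optC_bmul (arrowB hR (γ.arrows.getLast hne)) (⟨α, h1⟩ : BPath R) hs2]
    simp only [e5, e6]
    rfl
  exact LinearMap.congr_fun this z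

theorem hochschildD_toHochschild (hR : ∀ p ∈ R, p.length = 2) (m : ℕ) (z : Chains k R (m + 1)) :
    hochschildD k (MonomialAlgebra k R) m (toHochschild k R (m + 1) z) =
      toHochschild k R m (chainsD k R m z) := by
  apply toCWords_injective hR m
  rw [← hoch_toCWords, toCWords_toHochschild, toCWords_toHochschild, hoch_chainsToC]

variable (k R) in
/-- The projection onto the span of the tuples `(s, l)` with `l` of length `m`. -/
def gradeProj (m : ℕ) : CWords k R →ₗ[k] CWords k R :=
  Finsupp.linearCombination k fun w => if w.2.length = m then cword k w.1 w.2 else 0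

theorem gradeProj_cword (m : ℕ) (s : BPath R) (l : List (BPath R)) :
    gradeProj k R m (cword k s l) = if l.length = m then cword k s l else 0 := by
  simp [gradeProj]

theorem exists_toCWords (hR : ∀ p ∈ R, p.length = 2) (s : BPath R) (l : List (BPath R)) :
    ∃ x, toCWords k hR l.length x = cword k s l := by
  refine ⟨PiTensorProduct.tprod k fun i =>
    mkPath k ((Fin.cons s l.get : Fin (l.length + 1) → BPath R) i), ?_⟩
  rw [toCWords_tprod]
  simp

theorem gradeProj_toCWords (hR : ∀ p ∈ R, p.length = 2) (m n : ℕ)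
    (x : ⨂[k] _ : Fin (m + 1), MonomialAlgebra k R) :
    gradeProj k R n (toCWords k hR m x) = if m = n then toCWords k hR m x else 0 := by
  have : gradeProj k R n ∘ₗ toCWords k hR m = if m = n then toCWords k hR m else 0 := by
    refine (basisT k hR (m + 1)).ext fun f => ?_
    rw [basisT_apply, LinearMap.comp_apply, toCWords_tprod, gradeProj_cword, List.length_ofFn]
    split_ifs
    · rw [toCWords_tprod]
    · rfl
  rw [← LinearMap.comp_apply, this]
  split_ifs <;> rfl

theorem exists_gradeProj_eq_toCWords (hR : ∀ p ∈ R, p.length = 2) (m : ℕ) (z : CWords k R) :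
    ∃ x, gradeProj k R m z = toCWords k hR m x := by
  suffices h : LinearMap.range (gradeProj k R m) ≤ LinearMap.range (toCWords k hR m) by
    obtain ⟨x, hx⟩ := h ⟨z, rfl⟩
    exact ⟨x, hx.symm⟩
  rw [gradeProj, Finsupp.range_linearCombination, Submodule.span_le]
  rintro _ ⟨⟨s, l⟩, rfl⟩
  simp only
  split_ifs with h
  · subst h
    obtain ⟨x, hx⟩ := exists_toCWords (k := k) hR s l
    exact ⟨x, hx⟩
  · exact Submodule.zero_mem _

theorem exists_gradeProj_eq_chainsToC (hR : ∀ p ∈ R, p.length = 2) (m : ℕ) {z : CWords k R}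
    (hz : z ∈ koszulSpan k R) : ∃ x, gradeProj k R m z = chainsToC k hR m x := by
  suffices h : koszulSpan k R ≤
      (LinearMap.range (chainsToC k hR m)).comap (gradeProj k R m) by
    obtain ⟨x, hx⟩ := h hz
    exact ⟨x, hx.symm⟩
  refine Submodule.span_le.2 ?_
  rintro _ ⟨s, l, h, rfl⟩
  change gradeProj k R m (cword k s l) ∈ LinearMap.range (chainsToC k hR m)
  rw [gradeProj_cword]
  split_ifs with hl
  · subst hl
    obtain ⟨x, hx⟩ := exists_pairToTuple hR h
    refine ⟨Finsupp.single x 1, ?_⟩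
    rw [chainsToC, Finsupp.lmapDomain_apply, Finsupp.mapDomain_single, hx, cword]
  · exact Submodule.zero_mem _

theorem hoch_toCWords_zero (hR : ∀ p ∈ R, p.length = 2)
    (x : ⨂[k] _ : Fin (0 + 1), MonomialAlgebra k R) : hoch k (toCWords k hR 0 x) = 0 := by
  have : hoch k ∘ₗ toCWords k hR 0 = 0 := by
    refine (basisT k hR 1).ext fun f => ?_
    rw [basisT_apply, LinearMap.comp_apply, toCWords_tprod, hoch_cword]
    simp [hochFun]
  exact LinearMap.congr_fun this x

theorem gradeProj_hoch (hR : ∀ p ∈ R, p.length = 2) (m : ℕ) (z : CWords k R) :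
    gradeProj k R m (hoch k z) = hoch k (gradeProj k R (m + 1) z) := by
  have : gradeProj k R m ∘ₗ hoch k = hoch k ∘ₗ gradeProj k R (m + 1) := by
    refine cwords_hom_ext fun s l => ?_
    obtain ⟨x, hx⟩ := exists_toCWords (k := k) hR s l
    rw [LinearMap.comp_apply, LinearMap.comp_apply, ← hx, gradeProj_toCWords]
    clear hx
    generalize l.length = n at x
    cases n with
    | zero => rw [hoch_toCWords_zero]; simp
    | succ n =>
      rw [hoch_toCWords, gradeProj_toCWords]
      by_cases h : n = m
      · simp [h, hoch_toCWords]
      · simp [h]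
  exact LinearMap.congr_fun this z

theorem hochschildD_comp (hR : ∀ p ∈ R, p.length = 2) (m : ℕ)
    (x : ⨂[k] _ : Fin (m + 3), MonomialAlgebra k R) :
    hochschildD k (MonomialAlgebra k R) m (hochschildD k (MonomialAlgebra k R) (m + 1) x) = 0 := by
  apply toCWords_injective hR m
  rw [← hoch_toCWords, ← hoch_toCWords, hoch_hoch hR, map_zero]

theorem toHochschild_injective (hR : ∀ p ∈ R, p.length = 2) (m : ℕ) :
    Function.Injective (toHochschild k R m) := by
  intro x y h
  apply chainsToC_injective hR m
  rw [← toCWords_toHochschild, h, toCWords_toHochschild]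

/-- The canonical morphism is a quasi-isomorphism, so it suffices to know the homology of
`k(B ⊙ Γ)`. -/
theorem HomologyFreelySpannedBy.hhFreelySpannedBy (hR : ∀ p ∈ R, p.length = 2) {m : ℕ} {ι : Type*}
    {z : ι → Chains k R m}
    (h : HomologyFreelySpannedBy (X := fun n => Chains k R n) (chainsD k R) m z) :
    HHFreelySpannedBy k R m z := by
  refine ⟨h, ?_⟩
  rw [homologyFreelySpannedBy_iff] at h ⊢
  obtain ⟨h1, h2, h3⟩ := h
  have hlin : ∀ c : ι →₀ k, Finsupp.linearCombination k (fun i => toHochschild k R m (z i)) c =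
      toHochschild k R m (Finsupp.linearCombination k z c) := by
    intro c
    rw [← LinearMap.comp_apply]
    congr 1
    ext i
    simp
  refine ⟨fun i => ?_, fun c hc => ?_, fun w hw => ?_⟩
  · cases m with
    | zero => exact Submodule.mem_top
    | succ m =>
      have hi : chainsD k R m (z i) = 0 := h1 i
      change hochschildD k (MonomialAlgebra k R) m _ = 0
      rw [hochschildD_toHochschild hR, hi, map_zero]
  · apply h2 c
    rw [hlin] at hc
    obtain ⟨u, hu⟩ := hc
    have hK : chainsToC k hR m (Finsupp.linearCombination k z c) ∈ koszulSpan k R := by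
      generalize Finsupp.linearCombination k z c = w
      induction w using Finsupp.induction_linear with
      | zero => rw [map_zero]; exact Submodule.zero_mem _
      | add v w hv hw => rw [map_add]; exact Submodule.add_mem _ hv hw
      | single x a =>
        rw [← Finsupp.smul_single_one, map_smul, chainsToC_single]
        exact Submodule.smul_mem _ _ (cword_mem_koszulSpan (isKoszulC_pairToTuple hR x))
    obtain ⟨v, hv, hv'⟩ := exists_koszul_of_eq_hoch hR (u := toCWords k hR (m + 1) u) hK (by
      rw [hoch_toCWords, hu, toCWords_toHochschild])
    obtain ⟨y, hy⟩ := exists_gradeProj_eq_chainsToC hR (m + 1) hv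
    refine ⟨y, ?_⟩
    apply chainsToC_injective hR m
    rw [← hoch_chainsToC, ← hy, ← gradeProj_hoch hR, ← hv', ← toCWords_toHochschild,
      gradeProj_toCWords, if_pos rfl]
  · have hw0 : hoch k (toCWords k hR m w) = 0 := by
      cases m with
      | zero => exact hoch_toCWords_zero hR w
      | succ m =>
        have hw : hochschildD k (MonomialAlgebra k R) m w = 0 := hw
        rw [hoch_toCWords, hw, map_zero]
    obtain ⟨v, hv, u, hu⟩ := exists_koszul_of_hoch_eq_zero hR hw0
    obtain ⟨y, hy⟩ := exists_gradeProj_eq_chainsToC hR m hv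
    obtain ⟨x, hx⟩ := exists_gradeProj_eq_toCWords hR (m + 1) u
    have hw1 : w = toHochschild k R m y + hochschildD k (MonomialAlgebra k R) m x := by
      apply toCWords_injective hR m
      rw [map_add, toCWords_toHochschild, ← hy, ← hoch_toCWords, ← hx, ← gradeProj_hoch hR,
        ← map_add, ← hu, gradeProj_toCWords, if_pos rfl]
    have hyc : y ∈ cycles (X := fun n => Chains k R n) (chainsD k R) m := by
      cases m with
      | zero => exact Submodule.mem_top
      | succ m =>
        have hw : hochschildD k (MonomialAlgebra k R) m w = 0 := hw
        change chainsD k R m y = 0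
        apply toHochschild_injective hR m
        rw [hw1, map_add, hochschildD_comp hR, add_zero, hochschildD_toHochschild hR] at hw
        rw [hw, map_zero]
    obtain ⟨c, y', hy'⟩ := h3 y hyc
    refine ⟨c, toHochschild k R (m + 1) y' + x, ?_⟩
    rw [hlin, hw1, map_add, hochschildD_toHochschild hR, hy', map_sub]
    abel

end Comparison

/-! ### Junctions of a cycle -/

section Junctions

variable {V : Type*} [Quiver V]

namespace Cyc

theorem length_pos (D : Cyc V) : 0 < D.path.arrows.length := List.length_pos_iff.2 D.ne_nil

theorem rot_arrows (D : Cyc V) : D.rot.path.arrows = D.path.arrows.rotate 1 :=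
  rot_iterate_arrows D 1

theorem length_rot (D : Cyc V) : D.rot.path.arrows.length = D.path.arrows.length := by
  rw [rot_arrows, List.length_rotate]

theorem rot_injective : Function.Injective (rot : Cyc V → Cyc V) := by
  intro C D h
  have := congrArg (fun E : Cyc V => E.path.arrows) h
  simp only [rot_arrows] at this
  exact ext_arrows (List.rotate_injective 1 this)

theorem rot_iterate_length (D : Cyc V) : rot^[D.path.arrows.length] D = D :=
  ext_arrows (by rw [rot_iterate_arrows, List.rotate_length])

theorem rot_surjective : Function.Surjective (rot : Cyc V → Cyc V) := by
  intro D
  obtain ⟨n, hn⟩ := Nat.exists_eq_succ_of_ne_zero D.length_pos.ne'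
  have := D.rot_iterate_length
  rw [hn, Function.iterate_succ_apply'] at this
  exact ⟨_, this⟩

theorem period_pos (D : Cyc V) : 0 < D.period :=
  Function.IsPeriodicPt.minimalPeriod_pos D.length_pos D.rot_iterate_length

theorem circuit_rot (D : Cyc V) : D.rot.circuit = D.circuit :=
  (Quotient.sound (s := conj V) ⟨1, rfl⟩).symm

theorem circuit_rot_iterate (D : Cyc V) (n : ℕ) : (rot^[n] D).circuit = D.circuit :=
  (Quotient.sound (s := conj V) ⟨n, rfl⟩).symm

theorem exists_rot_iterate_of_circuit_eq {D E : Cyc V} (h : D.circuit = E.circuit) :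
    ∃ n, rot^[n] D = E := Quotient.exact (s := conj V) h

end Cyc

/-- The composite of the arrow number `i` of a cycle with the next one is a relation. The arrows
are numbered cyclically, beginning with `0` at the left end. -/
def junc (R : Set (QPath V)) (D : Cyc V) (i : ℕ) : Prop :=
  ∃ a ∈ D.path.arrows[i % D.path.arrows.length]?,
    ∃ b ∈ D.path.arrows[(i + 1) % D.path.arrows.length]?, Rel R a b

variable {R : Set (QPath V)}

theorem junc_mod (D : Cyc V) (i : ℕ) : junc R D (i % D.path.arrows.length) ↔ junc R D i := by
  simp only [junc, Nat.mod_mod, Nat.mod_add_mod]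

theorem junc_rot (D : Cyc V) (i : ℕ) : junc R D.rot i ↔ junc R D (i + 1) := by
  have hl := D.length_pos
  simp only [junc, Cyc.rot_arrows, List.length_rotate]
  rw [List.getElem?_rotate (Nat.mod_lt _ hl), List.getElem?_rotate (Nat.mod_lt _ hl),
    Nat.mod_add_mod, Nat.mod_add_mod]

theorem junc_iff (D : Cyc V) {i : ℕ} (hi : i + 1 < D.path.arrows.length) :
    junc R D i ↔ Rel R (D.path.arrows[i]) (D.path.arrows[i + 1]) := by
  rw [junc, Nat.mod_eq_of_lt hi, Nat.mod_eq_of_lt (Nat.lt_of_succ_lt hi)]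
  simp [List.getElem?_eq_getElem hi, List.getElem?_eq_getElem (Nat.lt_of_succ_lt hi)]

theorem junc_last (D : Cyc V) : junc R D (D.path.arrows.length - 1) ↔
    Rel R (D.path.arrows.getLast D.ne_nil) (D.path.arrows.head D.ne_nil) := by
  have hl := D.length_pos
  rw [junc, Nat.mod_eq_of_lt (by omega), Nat.sub_add_cancel hl, Nat.mod_self,
    ← List.getLast?_eq_getElem?, ← List.head?_eq_getElem?,
    List.getLast?_eq_some_getLast D.ne_nil, List.head?_eq_some_head D.ne_nil]
  simp

theorem forall_junc_iff {P : Prop → Prop} (D : Cyc V) : (∀ i, P (junc R D i)) ↔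
    ∀ i < D.path.arrows.length, P (junc R D i) := by
  refine ⟨fun h i _ => h i, fun h i => ?_⟩
  rw [← junc_mod]
  exact h _ (Nat.mod_lt _ D.length_pos)

theorem forall_junc_rot {P : Prop → Prop} (D : Cyc V) :
    (∀ i, P (junc R D.rot i)) ↔ ∀ i, P (junc R D i) := by
  refine ⟨fun h i => ?_, fun h i => by rw [junc_rot]; exact h _⟩
  have hl := D.length_pos
  have h1 := h (i + D.path.arrows.length - 1)
  rw [junc_rot, Nat.sub_add_cancel (by omega), ← junc_mod, Nat.add_mod_right, junc_mod] at h1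
  exact h1

theorem isChain_append_self_iff {S : Quiver.Total V → Quiver.Total V → Prop} (D : Cyc V) :
    (D.path.arrows ++ D.path.arrows).IsChain S ↔
      (∀ (i : ℕ) (hi : i + 1 < D.path.arrows.length), S (D.path.arrows[i]) (D.path.arrows[i + 1])) ∧
      S (D.path.arrows.getLast D.ne_nil) (D.path.arrows.head D.ne_nil) := by
  rw [List.isChain_append, List.isChain_iff_getElem, List.getLast?_eq_some_getLast D.ne_nil,
    List.head?_eq_some_head D.ne_nil]
  simp

theorem isComplete_iff (D : Cyc V) : D.IsComplete R ↔ ∀ i, junc R D i := by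
  rw [Cyc.IsComplete, mem_pathsΓ_iff, forall_junc_iff (P := fun p => p)]
  refine (isChain_append_self_iff D).trans ⟨?_, fun h => ⟨fun i hi => ?_, ?_⟩⟩
  · rintro ⟨h1, h2⟩ i hi
    rcases Nat.lt_or_ge (i + 1) D.path.arrows.length with h | h
    · exact (junc_iff D h).2 (h1 i h)
    · obtain rfl : i = D.path.arrows.length - 1 := by omega
      exact (junc_last D).2 h2
  · exact (junc_iff D hi).1 (h i (by omega))
  · exact (junc_last D).1 (h _ (Nat.sub_lt D.length_pos one_pos))

theorem isCocomplete_iff (hR : ∀ p ∈ R, p.length = 2) (D : Cyc V) :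
    D.IsCocomplete R ↔ ∀ i, ¬ junc R D i := by
  rw [Cyc.IsCocomplete, mem_pathsB_iff hR, forall_junc_iff (P := fun p => ¬ p)]
  refine (isChain_append_self_iff D).trans ⟨?_, fun h => ⟨fun i hi => ?_, ?_⟩⟩
  · rintro ⟨h1, h2⟩ i hi
    rcases Nat.lt_or_ge (i + 1) D.path.arrows.length with h | h
    · exact mt (junc_iff D h).1 (h1 i h)
    · obtain rfl : i = D.path.arrows.length - 1 := by omega
      exact mt (junc_last D).1 h2
  · exact mt (junc_iff D hi).2 (h i (by omega))
  · exact mt (junc_last D).2 (h _ (Nat.sub_lt D.length_pos one_pos))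

/-- The cycle `D` is the product `αγ` of a pair `(α, γ)` in `B ⊙ Γ_m`. -/
def IsCut (R : Set (QPath V)) (m : ℕ) (D : Cyc V) : Prop :=
  m ≤ D.path.arrows.length ∧ (∀ i, i + m + 2 ≤ D.path.arrows.length → ¬ junc R D i) ∧
    ∀ i, D.path.arrows.length ≤ i + m → i + 2 ≤ D.path.arrows.length → junc R D i

theorem isCut_iff (m : ℕ) (D : Cyc V) : IsCut R m D ↔ m ≤ D.path.arrows.length ∧
    (D.path.arrows.take (D.path.arrows.length - m)).IsChain (fun a b => ¬ Rel R a b) ∧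
    (D.path.arrows.drop (D.path.arrows.length - m)).IsChain (Rel R) := by
  rw [IsCut, List.isChain_iff_getElem, List.isChain_iff_getElem]
  refine and_congr_right fun hm => and_congr ⟨fun h i hi => ?_, fun h i hi => ?_⟩
    ⟨fun h i hi => ?_, fun h i h1 h2 => ?_⟩
  · rw [List.length_take] at hi
    rw [List.getElem_take, List.getElem_take]
    exact mt (junc_iff D (by omega)).2 (h i (by omega))
  · have := h i (by rw [List.length_take]; omega)
    rw [List.getElem_take, List.getElem_take] at this
    exact mt (junc_iff D (by omega)).1 this
  · rw [List.length_drop] at hi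
    rw [List.getElem_drop, List.getElem_drop]
    exact (junc_iff D (by omega)).1 (h _ (by omega) (by omega))
  · have := h (i - (D.path.arrows.length - m)) (by rw [List.length_drop]; omega)
    rw [List.getElem_drop, List.getElem_drop] at this
    rw [junc_iff D (by omega)]
    convert this using 2 <;> omega

/-- All junctions of the cycle are of the same kind: it is complete or cocomplete. -/
def IsPure (R : Set (QPath V)) (D : Cyc V) : Prop := (∀ i, junc R D i) ∨ ∀ i, ¬ junc R D i

theorem isPure_rot (D : Cyc V) : IsPure R D.rot ↔ IsPure R D :=
  or_congr (forall_junc_rot (P := fun p => p) D) (forall_junc_rot (P := fun p => ¬ p) D)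

theorem isCut_rot_of_isPure {D : Cyc V} (hD : IsPure R D) (m : ℕ) :
    IsCut R m D.rot ↔ IsCut R m D := by
  have h : ∀ i, junc R D.rot i ↔ junc R D i := by
    intro i
    rw [junc_rot]
    rcases hD with h | h <;> simp [h]
  simp only [IsCut, Cyc.length_rot, h]

/-- A cycle cut in degree `m` but not in degree `m + 1` is cut in degree `m - 1`: the junction where
the two components meet is not a relation, so the last arrow of the second component can be moved to
the first one. -/
theorem isCut_pred_of_not_isCut_succ {m : ℕ} {D : Cyc V} (h : IsCut R m D)
    (h' : ¬ IsCut R (m + 1) D) : ∃ n, m = n + 1 ∧ IsCut R n D := by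
  have hl := D.length_pos
  obtain ⟨h1, h2, h3⟩ := h
  have hm : m ≠ 0 := by
    rintro rfl
    exact h' ⟨hl, fun i hi => h2 i (by omega), fun i _ _ => by omega⟩
  obtain ⟨n, rfl⟩ := Nat.exists_eq_succ_of_ne_zero hm
  refine ⟨n, rfl, by omega, fun i hi hj => ?_, fun i hi hi' => h3 i (by omega) hi'⟩
  rcases Nat.lt_or_ge (i + n + 2) D.path.arrows.length with h | h
  · exact h2 i (by omega) hj
  · refine h' ⟨by omega, fun i hi => h2 i (by omega), fun i' h4 h5 => ?_⟩
    rcases Nat.lt_or_ge i i' with h6 | h6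
    · exact h3 i' (by omega) h5
    · obtain rfl : i = i' := by omega
      exact hj

/-- A cycle is not cut in degrees that differ by two, because one junction would have to be of both
kinds. -/
theorem not_isCut_succ_succ {n : ℕ} {D : Cyc V} (h : IsCut R n D) : ¬ IsCut R (n + 2) D := by
  rintro ⟨h1, -, h3⟩
  refine h.2.1 (D.path.arrows.length - (n + 2)) (by omega) (h3 _ (by omega) (by omega))

/-- A cycle that is neither complete nor cocomplete, cut in degree `m` both before and after a
rotation, moves to degree `m + 1` in exactly one of its two forms. -/
theorem isCut_succ_rot_iff {m : ℕ} {D : Cyc V} (hD : ¬ IsPure R D) (h : IsCut R m D)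
    (h' : IsCut R m D.rot) : IsCut R (m + 1) D.rot ↔ ¬ IsCut R (m + 1) D := by
  have hl := D.length_pos
  obtain ⟨h1, h2, h3⟩ := h
  obtain ⟨-, h5, h6⟩ := h'
  simp only [Cyc.length_rot, junc_rot] at h5 h6
  set l := D.path.arrows.length with hldef
  have hcp : ¬ ∀ i < l, junc R D i := fun h =>
    hD (Or.inl ((forall_junc_iff (P := fun p => p) D).2 h))
  have hco : ¬ ∀ i < l, ¬ junc R D i := fun h =>
    hD (Or.inr ((forall_junc_iff (P := fun p => ¬ p) D).2 h))
  have h5' : ∀ i, 1 ≤ i → i + m + 1 ≤ l → ¬ junc R D i := by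
    intro i hi hi'
    have := h5 (i - 1) (by omega)
    rwa [Nat.sub_add_cancel hi] at this
  have h6' : ∀ i, l + 1 ≤ i + m → i + 1 ≤ l → junc R D i := by
    intro i hi hi'
    have := h6 (i - 1) (by omega) (by omega)
    rwa [Nat.sub_add_cancel (by omega)] at this
  have hm0 : m ≠ 0 := by
    rintro rfl
    refine hco fun i hi => ?_
    rcases Nat.eq_zero_or_pos i with rfl | h
    · rcases Nat.lt_or_ge 1 l with h | h
      · exact h2 0 (by omega)
      · -- a loop is complete or cocomplete
        exfalso
        by_cases hj : junc R D 0
        · exact hcp fun i hi => by rwa [show i = 0 by omega]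
        · exact hco fun i hi => by rwa [show i = 0 by omega]
    · exact h5' i h (by omega)
  have hml : m < l := by
    by_contra hml
    obtain rfl : m = l := by omega
    refine hcp fun i hi => ?_
    rcases Nat.eq_zero_or_pos i with rfl | h
    · rcases Nat.lt_or_ge 1 l with h | h
      · exact h3 0 (by omega) (by omega)
      · exfalso
        by_cases hj : junc R D 0
        · exact hcp fun i hi => by rwa [show i = 0 by omega]
        · exact hco fun i hi => by rwa [show i = 0 by omega]
    · exact h6' i (by omega) (by omega)
  have e1 : IsCut R (m + 1) D ↔ junc R D (l - m - 1) := by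
    refine ⟨fun h => h.2.2 _ (by omega) (by omega), fun h => ⟨by omega, fun i hi => h2 i (by omega),
      fun i hi hi' => ?_⟩⟩
    rcases Nat.lt_or_ge (l - m - 1) i with h7 | h7
    · exact h3 i (by omega) hi'
    · rwa [show i = l - m - 1 by omega]
  have e2 : IsCut R (m + 1) D.rot ↔ junc R D (l - m) := by
    simp only [IsCut, Cyc.length_rot, junc_rot, ← hldef]
    refine ⟨fun h => ?_, fun h => ⟨by omega, fun i hi => h5 i (by omega), fun i hi hi' => ?_⟩⟩
    · have := h.2.2 (l - m - 1) (by omega) (by omega)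
      rwa [Nat.sub_add_cancel (by omega)] at this
    · rcases Nat.lt_or_ge (l - m - 1) i with h7 | h7
      · exact h6 i (by omega) hi'
      · rwa [show i + 1 = l - m by omega]
  rw [e1, e2]
  constructor
  · intro h7 h8
    refine hcp fun i hi => ?_
    rcases Nat.lt_or_ge i (l - m - 1) with h9 | h9
    · -- then `l - m - 1` is a positive index, which contradicts `h8`
      exact absurd h8 (h5' _ (by omega) (by omega))
    · rcases Nat.lt_or_ge (l - m) i with h10 | h10
      · exact h6' i (by omega) (by omega)
      · rcases (show i = l - m - 1 ∨ i = l - m by omega) with rfl | rfl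
        · exact h8
        · exact h7
  · intro h8
    by_contra h7
    refine hco fun i hi => ?_
    rcases Nat.lt_or_ge i (l - m - 1) with h9 | h9
    · exact h2 i (by omega)
    · rcases Nat.lt_or_ge (l - m) i with h10 | h10
      · exact absurd (h3 (l - m) (by omega) (by omega)) h7
      · rcases (show i = l - m - 1 ∨ i = l - m by omega) with rfl | rfl
        · exact h8
        · exact h7

end Junctions

/-! ### Chains as functions on cycles -/

section CycleChains

variable {k : Type*} [Field k] {V : Type*} [Quiver V] {R : Set (QPath V)}

/-- The cycle `αγ` of a pair `(α, γ)` whose components are not both trivial. -/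
def cycOf {m : ℕ} (x : pairs R m) (hx : x.1.1.arrows ++ x.1.2.arrows ≠ []) : Cyc V :=
  ⟨x.1.1.comp x.1.2 x.2.2.2.2.1, hx, x.2.2.2.2.2.symm⟩

/-- Two pairs of composable paths with the same nontrivial product are equal if their second
components have the same length. -/
theorem composable_ext {α γ α' γ' : QPath V} (h1 : α.src = γ.tgt) (h1' : α'.src = γ'.tgt)
    (h : α.arrows ++ γ.arrows = α'.arrows ++ γ'.arrows) (hne : α.arrows ++ γ.arrows ≠ [])
    (hl : γ.length = γ'.length) : (α, γ) = (α', γ') := by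
  obtain ⟨ha, hg⟩ := List.append_inj' h hl
  have hc : α.comp γ h1 = α'.comp γ' h1' := QPath.ext_arrows h hne
  have h8 : α.tgt = α'.tgt := (QPath.ext_iff.1 hc).1
  have h9 : γ.src = γ'.src := (QPath.ext_iff.1 hc).2.2
  have h10 : α.src = α'.src := by
    have e1 := α.isWalk
    have e2 := α'.isWalk
    rw [← ha, ← h8] at e2
    by_cases hn : α.arrows = []
    · rw [hn] at e1 e2
      exact e1.symm.trans e2
    · exact (e1.getLast hn).symm.trans (e2.getLast hn)
  exact Prod.ext (QPath.ext h8 ha h10) (QPath.ext (h1.symm.trans (h10.trans h1')) hg h9)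

theorem pairs_ext {m : ℕ} {x y : pairs R m}
    (h : x.1.1.arrows ++ x.1.2.arrows = y.1.1.arrows ++ y.1.2.arrows)
    (hx : x.1.1.arrows ++ x.1.2.arrows ≠ []) : x = y :=
  Subtype.ext (composable_ext x.2.2.2.2.1 y.2.2.2.2.1 h hx
    (x.2.2.2.1.trans y.2.2.2.1.symm))

theorem isCut_of_pair (hR : ∀ p ∈ R, p.length = 2) {m : ℕ} (x : pairs R m) {D : Cyc V}
    (h : x.1.1.arrows ++ x.1.2.arrows = D.path.arrows) : IsCut R m D := by
  obtain ⟨⟨α, γ⟩, h1, h2, h3, h4, h5⟩ := x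
  simp only at h h1 h2 h3
  have h3' : γ.arrows.length = m := h3
  have h6 : D.path.arrows.length - m = α.arrows.length := by
    rw [← h, List.length_append, h3', Nat.add_sub_cancel]
  rw [isCut_iff, h6, ← h, List.take_left, List.drop_left, List.length_append, h3']
  exact ⟨Nat.le_add_left _ _, (mem_pathsB_iff hR).1 h1, mem_pathsΓ_iff.1 h2⟩

theorem exists_pair_of_isCut (hR : ∀ p ∈ R, p.length = 2) {m : ℕ} {D : Cyc V}
    (h : IsCut R m D) : ∃ x : pairs R m, x.1.1.arrows ++ x.1.2.arrows = D.path.arrows := by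
  rw [isCut_iff] at h
  obtain ⟨h1, h2, h3⟩ := h
  have hw := D.path.isWalk
  rw [← List.take_append_drop (D.path.arrows.length - m) D.path.arrows, isWalk_append] at hw
  obtain ⟨v, hw1, hw2⟩ := hw
  refine ⟨⟨(⟨D.path.tgt, _, v, hw1⟩, ⟨v, _, D.path.src, hw2⟩), (mem_pathsB_iff hR).2 h2,
    mem_pathsΓ_iff.2 h3, ?_, rfl, D.closed.symm⟩, List.take_append_drop _ _⟩
  simp only [QPath.length, List.length_drop]
  omega

open Classical in
variable (k R) in
/-- The basis element `(α, γ)` of degree `m` with `αγ = D`, if there is one, and zero otherwise. -/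
def cut (m : ℕ) (D : Cyc V) : Chains k R m :=
  if h : ∃ x : pairs R m, x.1.1.arrows ++ x.1.2.arrows = D.path.arrows then
    Finsupp.single h.choose 1 else 0

theorem cut_eq_single {m : ℕ} (x : pairs R m) {D : Cyc V}
    (h : x.1.1.arrows ++ x.1.2.arrows = D.path.arrows) : cut k R m D = Finsupp.single x 1 := by
  have hex : ∃ x : pairs R m, x.1.1.arrows ++ x.1.2.arrows = D.path.arrows := ⟨x, h⟩
  rw [cut, dif_pos hex]
  congr 1
  have := hex.choose_spec
  exact pairs_ext (this.trans h.symm) fun h0 => D.ne_nil (this.symm.trans h0)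

theorem cut_of_not_isCut (hR : ∀ p ∈ R, p.length = 2) {m : ℕ} {D : Cyc V} (h : ¬ IsCut R m D) :
    cut k R m D = 0 := dif_neg fun ⟨x, hx⟩ => h (isCut_of_pair hR x hx)

theorem pair_eq_cut {m : ℕ} {α γ : QPath V} {D : Cyc V} (hl : γ.length = m)
    (h1 : α.src = γ.tgt) (h : α.arrows ++ γ.arrows = D.path.arrows) :
    pair k R m α γ = cut k R m D := by
  by_cases hx : (α, γ) ∈ pairs R m
  · rw [pair, dif_pos hx, cut_eq_single ⟨(α, γ), hx⟩ h]
  · rw [pair, dif_neg hx, cut, dif_neg]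
    rintro ⟨x, hx'⟩
    rw [composable_ext h1 x.2.2.2.2.1 (h.trans hx'.symm)
      (fun h0 => D.ne_nil (h.symm.trans h0)) (hl.trans x.2.2.2.1.symm)] at hx
    exact hx x.2

variable (k R) in
/-- The pair of trivial paths at a vertex in degree zero, and zero in other degrees. -/
def vert (m : ℕ) (e : V) : Chains k R m := pair k R m (QPath.triv e) (QPath.triv e)

theorem vert_eq_single {m : ℕ} {e : V} (h : (QPath.triv e, QPath.triv e) ∈ pairs R m) :
    vert k R m e = Finsupp.single ⟨_, h⟩ 1 := dif_pos h

theorem triv_mem_pairs (hR : ∀ p ∈ R, p.length = 2) (e : V) :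
    (QPath.triv e, QPath.triv e) ∈ pairs R 0 :=
  ⟨triv_mem_pathsB hR e, triv_mem_pathsΓ e, rfl, rfl, rfl⟩

theorem vert_succ (m : ℕ) (e : V) : vert k R (m + 1) e = 0 :=
  dif_neg fun h => by simpa [QPath.length, QPath.triv] using h.2.2.1

theorem eq_vertex_of_nil {m : ℕ} {x : pairs R m} (h : x.1.1.arrows ++ x.1.2.arrows = []) :
    m = 0 ∧ x.1 = (QPath.triv x.1.1.tgt, QPath.triv x.1.1.tgt) := by
  rw [List.append_eq_nil_iff] at h
  refine ⟨?_, Prod.ext (QPath.eq_triv h.1) ?_⟩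
  · rw [← x.2.2.2.1, QPath.length, h.2, List.length_nil]
  · exact (QPath.eq_triv h.2).trans
      (congrArg _ (x.2.2.2.2.1.symm.trans (QPath.src_eq_tgt_of_nil h.1).symm))

/-- Chains are linear combinations of the elements `cut k R m D` and of pairs of trivial paths. -/
theorem chains_induction (hR : ∀ p ∈ R, p.length = 2) {m : ℕ} {P : Chains k R m → Prop}
    (h0 : P 0) (hadd : ∀ z w, P z → P w → P (z + w)) (hsmul : ∀ (c : k) z, P z → P (c • z))
    (hcut : ∀ D, IsCut R m D → P (cut k R m D))
    (hv : ∀ e, P (vert k R m e)) (z : Chains k R m) : P z := by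
  induction z using Finsupp.induction_linear with
  | zero => exact h0
  | add z w hz hw => exact hadd z w hz hw
  | single x c =>
    rw [← Finsupp.smul_single_one]
    refine hsmul c _ ?_
    by_cases hx : x.1.1.arrows ++ x.1.2.arrows = []
    · obtain ⟨rfl, h⟩ := eq_vertex_of_nil hx
      have := hv x.1.1.tgt
      rw [vert_eq_single (triv_mem_pairs hR _)] at this
      rwa [show x = ⟨_, triv_mem_pairs hR x.1.1.tgt⟩ from Subtype.ext h]
    · have h := hcut (cycOf x hx) (isCut_of_pair hR x rfl)
      rwa [cut_eq_single x rfl] at h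

/-- The differential of the basis element of degree `m + 1` on a cycle `rot E`. Its two terms are
basis elements on `rot E` and on `E`. -/
theorem chainsD_cut_rot (hR : ∀ p ∈ R, p.length = 2) {m : ℕ} {E : Cyc V}
    (h : IsCut R (m + 1) E.rot) : chainsD k R m (cut k R (m + 1) E.rot) =
      cut k R m E.rot + (-1 : k) ^ (m + 1) • cut k R m E := by
  obtain ⟨x, hx⟩ := exists_pair_of_isCut hR h
  rw [cut_eq_single x hx]
  have hne := pairs_ne_nil x
  obtain ⟨⟨α, γ⟩, hx1⟩ := x
  obtain ⟨h1, h2, h3, h4, h5⟩ := id hx1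
  simp only at h1 h2 h3 h4 h5 hx hne
  have h6 : α.src = (γ.lastArrow hne).tgt := h4.trans (γ.isWalk.head hne).symm
  have h7 : (γ.firstArrow hne).src = α.tgt := (γ.isWalk.getLast hne).trans h5.symm
  have hlen : γ.arrows.length = m + 1 := h3
  rw [chainsD_single hx1 hne h6 h7, pair_eq_cut (D := E.rot), pair_eq_cut (D := E)]
  · simp [QPath.dropFirstArrow, QPath.length, hlen]
  · exact h4
  · -- rotating both sides gives the cycle `αγ`
    refine List.rotate_injective 1 ?_
    beta_reduce
    rw [Cyc.rot_arrows] at hx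
    rw [← hx]
    simp only [QPath.comp, QPath.firstArrow, QPath.ofArrow, QPath.dropFirstArrow,
      List.cons_append, List.rotate_cons_succ, List.rotate_zero,
      List.append_assoc]
    rw [List.dropLast_append_getLast hne, List.nil_append]
  · simp [QPath.dropLastArrow, QPath.length, hlen]
  · rfl
  · rw [← hx]
    simp [QPath.comp, QPath.lastArrow, QPath.ofArrow, QPath.dropLastArrow]

open Classical in
variable (k R) in
/-- The coordinates of a chain with respect to the basis elements `cut k R m D`, as a function on
cycles. -/
def coord (m : ℕ) : Chains k R m →ₗ[k] (Cyc V →₀ k) :=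
  Finsupp.linearCombination k fun x : pairs R m =>
    if h : x.1.1.arrows ++ x.1.2.arrows ≠ [] then Finsupp.single (cycOf x h) 1 else 0

open Classical in
variable (k R) in
/-- The coordinates of a chain with respect to the pairs of trivial paths. -/
def vcoord (m : ℕ) : Chains k R m →ₗ[k] (V →₀ k) :=
  Finsupp.linearCombination k fun x : pairs R m =>
    if x.1.1.arrows ++ x.1.2.arrows ≠ [] then 0 else Finsupp.single x.1.1.tgt 1

theorem coord_cut (hR : ∀ p ∈ R, p.length = 2) {m : ℕ} {D : Cyc V} (h : IsCut R m D) :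
    coord k R m (cut k R m D) = Finsupp.single D 1 := by
  obtain ⟨x, hx⟩ := exists_pair_of_isCut hR h
  have hne : x.1.1.arrows ++ x.1.2.arrows ≠ [] := hx ▸ D.ne_nil
  rw [cut_eq_single x hx, coord, Finsupp.linearCombination_single, one_smul, dif_pos hne]
  congr 1
  exact Cyc.ext_arrows hx

theorem vcoord_cut (hR : ∀ p ∈ R, p.length = 2) {m : ℕ} (D : Cyc V) :
    vcoord k R m (cut k R m D) = 0 := by
  by_cases h : IsCut R m D
  · obtain ⟨x, hx⟩ := exists_pair_of_isCut hR h
    have hne : x.1.1.arrows ++ x.1.2.arrows ≠ [] := hx ▸ D.ne_nil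
    rw [cut_eq_single x hx, vcoord, Finsupp.linearCombination_single, one_smul, if_pos hne]
  · rw [cut_of_not_isCut hR h, map_zero]

theorem coord_vert (hR : ∀ p ∈ R, p.length = 2) (m : ℕ) (e : V) :
    coord k R m (vert k R m e) = 0 := by
  cases m with
  | zero =>
    rw [vert_eq_single (triv_mem_pairs hR e), coord, Finsupp.linearCombination_single, one_smul,
      dif_neg]
    simp [QPath.triv]
  | succ m => rw [vert_succ, map_zero]

theorem vcoord_vert_zero (hR : ∀ p ∈ R, p.length = 2) (e : V) :
    vcoord k R 0 (vert k R 0 e) = Finsupp.single e 1 := by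
  rw [vert_eq_single (triv_mem_pairs hR e), vcoord, Finsupp.linearCombination_single, one_smul,
    if_neg]
  · rfl
  · simp [QPath.triv]

variable (k R) in
/-- The chain without pairs of trivial paths whose coordinates are given by a function on cycles;
its values at cycles that cannot be cut in degree `m` are ignored. -/
def ofCoord (m : ℕ) : (Cyc V →₀ k) →ₗ[k] Chains k R m := Finsupp.linearCombination k (cut k R m)

theorem ofCoord_single (m : ℕ) (D : Cyc V) :
    ofCoord k R m (Finsupp.single D 1) = cut k R m D := by
  rw [ofCoord, Finsupp.linearCombination_single, one_smul]

theorem vcoord_ofCoord (hR : ∀ p ∈ R, p.length = 2) {m : ℕ} (f : Cyc V →₀ k) :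
    vcoord k R m (ofCoord k R m f) = 0 := by
  rw [ofCoord, Finsupp.linearCombination_apply, map_finsuppSum]
  simp [vcoord_cut hR]

open Classical in
theorem coord_ofCoord (hR : ∀ p ∈ R, p.length = 2) {m : ℕ} (f : Cyc V →₀ k) (D : Cyc V) :
    coord k R m (ofCoord k R m f) D = if IsCut R m D then f D else 0 := by
  induction f using Finsupp.induction_linear with
  | zero => simp
  | add f g hf hg =>
    rw [map_add, map_add, Finsupp.add_apply, hf, hg]
    split_ifs <;> simp
  | single E c =>
    rw [← Finsupp.smul_single_one, map_smul, map_smul, ofCoord_single]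
    by_cases hE : IsCut R m E
    · rw [coord_cut hR hE]
      by_cases h : E = D
      · subst h
        simp [hE]
      · simp [Finsupp.single_eq_of_ne' h]
    · rw [cut_of_not_isCut hR hE]
      by_cases h : E = D
      · subst h
        simp [hE]
      · simp [Finsupp.single_eq_of_ne' h]

theorem isCut_of_coord_ne_zero (hR : ∀ p ∈ R, p.length = 2) {m : ℕ} {z : Chains k R m} {D : Cyc V}
    (h : coord k R m z D ≠ 0) : IsCut R m D := by
  classical
  contrapose! h
  induction z using chains_induction hR with
  | h0 => simp
  | hadd z w hz hw => rw [map_add, Finsupp.add_apply, hz, hw, add_zero]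
  | hsmul c z hz => rw [map_smul, Finsupp.smul_apply, hz, smul_zero]
  | hcut E hE =>
    rw [coord_cut hR hE, Finsupp.single_eq_of_ne']
    rintro rfl
    exact h hE
  | hv e => rw [coord_vert hR, Finsupp.zero_apply]

/-- A chain is recovered from its coordinates. -/
theorem chain_eq (hR : ∀ p ∈ R, p.length = 2) {m : ℕ} (z : Chains k R m) :
    z = ofCoord k R m (coord k R m z) +
      Finsupp.linearCombination k (vert k R m) (vcoord k R m z) := by
  induction z using chains_induction hR with
  | h0 => simp
  | hadd z w hz hw =>
    simp only [map_add]
    nth_rewrite 1 [hz, hw]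
    abel
  | hsmul c z hz =>
    simp only [map_smul]
    nth_rewrite 1 [hz]
    rw [smul_add]
  | hcut D hD => rw [coord_cut hR hD, ofCoord_single, vcoord_cut hR, map_zero, add_zero]
  | hv e =>
    rw [coord_vert hR, map_zero, zero_add]
    cases m with
    | zero => rw [vcoord_vert_zero hR, Finsupp.linearCombination_single, one_smul]
    | succ m => rw [vert_succ, map_zero, map_zero]

theorem chain_ext (hR : ∀ p ∈ R, p.length = 2) {m : ℕ} {z w : Chains k R m}
    (h : coord k R m z = coord k R m w) (hv : vcoord k R m z = vcoord k R m w) : z = w := by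
  rw [chain_eq hR z, chain_eq hR w, h, hv]

open Classical in
/-- The differential in coordinates: at `D`, it compares the values at `D` and at `rot D`. -/
theorem coord_chainsD (hR : ∀ p ∈ R, p.length = 2) {m : ℕ} (z : Chains k R (m + 1)) (D : Cyc V) :
    coord k R m (chainsD k R m z) D = if IsCut R m D then
      coord k R (m + 1) z D + (-1 : k) ^ (m + 1) * coord k R (m + 1) z D.rot else 0 := by
  induction z using chains_induction hR with
  | h0 => simp
  | hadd z w hz hw =>
    rw [map_add, map_add, map_add, Finsupp.add_apply, hz, hw]
    split_ifs <;> simp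
    ring
  | hsmul c z hz =>
    rw [map_smul, map_smul, map_smul, Finsupp.smul_apply, hz]
    split_ifs <;> simp
    ring
  | hcut E hE =>
    obtain ⟨E, rfl⟩ := Cyc.rot_surjective E
    have key : ∀ F : Cyc V, coord k R m (cut k R m F) D =
        if IsCut R m D then Finsupp.single F (1 : k) D else 0 := fun F => by
      rw [← ofCoord_single, coord_ofCoord hR]
    rw [chainsD_cut_rot hR hE, map_add, map_smul, Finsupp.add_apply, Finsupp.smul_apply, key, key,
      coord_cut hR hE]
    have : Finsupp.single E.rot (1 : k) D.rot = Finsupp.single E (1 : k) D := by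
      simp only [Finsupp.single_apply, Cyc.rot_injective.eq_iff]
    rw [this]
    split_ifs <;> simp
  | hv e => simp [vert_succ]

theorem vcoord_chainsD (hR : ∀ p ∈ R, p.length = 2) {m : ℕ} (z : Chains k R (m + 1)) :
    vcoord k R m (chainsD k R m z) = 0 := by
  induction z using chains_induction hR with
  | h0 => simp
  | hadd z w hz hw => rw [map_add, map_add, hz, hw, add_zero]
  | hsmul c z hz => rw [map_smul, map_smul, hz, smul_zero]
  | hcut E hE =>
    obtain ⟨E, rfl⟩ := Cyc.rot_surjective E
    rw [chainsD_cut_rot hR hE, map_add, map_smul, vcoord_cut hR, vcoord_cut hR, smul_zero, add_zero]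
  | hv e => simp [vert_succ]

end CycleChains

/-! ### Functions on the orbit of a cycle -/

section Orbits

variable {k : Type*} [Field k] {V : Type*} [Quiver V]

theorem pow_eq_pow_of_iterate_rot_eq {δ : k} {D : Cyc V} (hδ : δ ^ D.period = 1) {a b : ℕ}
    (h : Cyc.rot^[a] D = Cyc.rot^[b] D) : δ ^ a = δ ^ b := by
  rw [pow_eq_pow_mod a hδ, pow_eq_pow_mod b hδ]
  congr 1
  refine Function.iterate_injOn_Iio_minimalPeriod (Nat.mod_lt _ D.period_pos)
    (Nat.mod_lt _ D.period_pos) ?_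
  simp only [Cyc.period, Function.iterate_mod_minimalPeriod_eq]
  exact h

open Classical in
/-- The function on cycles that is `δ ^ n` at `rot^n(D)` and vanishes outside the circuit of `D`.
It is of use if `δ` to the period of `D` is `1`. -/
def turn (δ : k) (D E : Cyc V) : k :=
  if h : ∃ n, Cyc.rot^[n] D = E then δ ^ h.choose else 0

theorem turn_iterate {δ : k} {D : Cyc V} (hδ : δ ^ D.period = 1) (n : ℕ) :
    turn δ D (Cyc.rot^[n] D) = δ ^ n := by
  have h : ∃ n', Cyc.rot^[n'] D = Cyc.rot^[n] D := ⟨n, rfl⟩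
  rw [turn, dif_pos h]
  exact pow_eq_pow_of_iterate_rot_eq hδ h.choose_spec

theorem turn_self {δ : k} {D : Cyc V} (hδ : δ ^ D.period = 1) : turn δ D D = 1 := by
  simpa using turn_iterate hδ 0

theorem turn_of_circuit_ne (δ : k) {D E : Cyc V} (h : E.circuit ≠ D.circuit) :
    turn δ D E = 0 :=
  dif_neg fun ⟨n, hn⟩ => h (hn ▸ D.circuit_rot_iterate n)

theorem turn_rot {δ : k} {D : Cyc V} (hδ : δ ^ D.period = 1) (E : Cyc V) :
    turn δ D E.rot = δ * turn δ D E := by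
  by_cases h : E.circuit = D.circuit
  · obtain ⟨n, rfl⟩ := Cyc.exists_rot_iterate_of_circuit_eq h.symm
    rw [← Function.iterate_succ_apply' Cyc.rot n D, turn_iterate hδ, turn_iterate hδ, pow_succ']
  · rw [turn_of_circuit_ne δ h, turn_of_circuit_ne δ (by rwa [Cyc.circuit_rot]), mul_zero]

/-- The function `turn δ D` as a finite sum over the circuit of `D`. -/
def orbitSum (δ : k) (D : Cyc V) : Cyc V →₀ k :=
  ∑ i ∈ Finset.range D.period, δ ^ i • Finsupp.single (Cyc.rot^[i] D) 1

theorem orbitSum_apply {δ : k} {D : Cyc V} (hδ : δ ^ D.period = 1) (E : Cyc V) :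
    orbitSum δ D E = turn δ D E := by
  classical
  rw [orbitSum, Finsupp.finsetSum_apply]
  by_cases h : E.circuit = D.circuit
  · obtain ⟨n, rfl⟩ := Cyc.exists_rot_iterate_of_circuit_eq h.symm
    have hn := Nat.mod_lt n D.period_pos
    have hmod : Cyc.rot^[n % D.period] D = Cyc.rot^[n] D :=
      Function.iterate_mod_minimalPeriod_eq
    rw [Finset.sum_eq_single (n % D.period)]
    · rw [hmod, Finsupp.smul_apply, Finsupp.single_eq_same, turn_iterate hδ, smul_eq_mul, mul_one,
        ← pow_eq_pow_mod n hδ]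
    · intro i hi hne
      rw [Finsupp.smul_apply, Finsupp.single_eq_of_ne', smul_zero]
      intro h'
      refine hne (Function.iterate_injOn_Iio_minimalPeriod (Finset.mem_range.1 hi) hn ?_)
      exact h'.trans hmod.symm
    · exact fun h' => absurd (Finset.mem_range.2 hn) h'
  · rw [turn_of_circuit_ne δ h]
    refine Finset.sum_eq_zero fun i _ => ?_
    rw [Finsupp.smul_apply, Finsupp.single_eq_of_ne', smul_zero]
    rintro rfl
    exact h (D.circuit_rot_iterate i)

end Orbits

/-! ### The homology of the small complex -/

section SmallHomology

variable {k : Type*} [Field k] {V : Type*} [Quiver V] {R : Set (QPath V)}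

theorem neg_one_pow_mul_self (m : ℕ) : (-1 : k) ^ m * (-1) ^ m = 1 := by
  rw [← mul_pow, neg_mul_neg, one_mul, one_pow]

open Classical in
variable (k R) in
/-- The sign by which the rotation of `D` acts on the classes of degree `m` of its circuit. In the
higher of the two degrees in which a complete or cocomplete `D` can be cut, the class is a function
multiplied by this sign under rotation; in the lower one, the classes of `rot D` and `D` differ by
this sign. -/
def rotSign (m : ℕ) (D : Cyc V) : k := if IsCut R (m + 1) D then (-1) ^ m else (-1) ^ (m + 1)

variable (k R) in
/-- The circuit of the cycle `D` contributes a homology class in degree `m`: it is complete or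
cocomplete, it can be cut in this degree, and the sign of the full rotation is `1`. -/
def Contributes (m : ℕ) (D : Cyc V) : Prop :=
  IsPure R D ∧ IsCut R m D ∧ rotSign k R m D ^ D.period = 1

open Classical in
variable (k R) in
/-- A chain of degree `m` representing the homology class contributed by the circuit of `D`. -/
def classChain (m : ℕ) (D : Cyc V) : Chains k R m :=
  if IsCut R (m + 1) D then cut k R m D else ofCoord k R m (orbitSum ((-1) ^ (m + 1)) D)

open Classical in
variable (k R) in
/-- A linear form that detects the homology class contributed by the circuit of `D`. -/
def classForm (m : ℕ) (D : Cyc V) : Chains k R m →ₗ[k] k :=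
  (if IsCut R (m + 1) D then Finsupp.linearCombination k (turn ((-1) ^ m) D)
    else Finsupp.lapply D) ∘ₗ coord k R m

theorem isPure_iterate (D : Cyc V) (n : ℕ) : IsPure R (Cyc.rot^[n] D) ↔ IsPure R D := by
  induction n with
  | zero => rfl
  | succ n ih => rw [Function.iterate_succ_apply', isPure_rot, ih]

theorem isCut_iterate_of_isPure {D : Cyc V} (hD : IsPure R D) (m n : ℕ) :
    IsCut R m (Cyc.rot^[n] D) ↔ IsCut R m D := by
  induction n with
  | zero => rfl
  | succ n ih =>
    rw [Function.iterate_succ_apply', isCut_rot_of_isPure ((isPure_iterate D n).2 hD), ih]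

theorem coord_classChain_of_circuit_ne (hR : ∀ p ∈ R, p.length = 2) {m : ℕ} {D E : Cyc V}
    (hD : Contributes k R m D) (h : E.circuit ≠ D.circuit) :
    coord k R m (classChain k R m D) E = 0 := by
  obtain ⟨-, h1, h2⟩ := hD
  rw [classChain]
  split_ifs with hc
  · rw [coord_cut hR h1, Finsupp.single_eq_of_ne']
    rintro rfl
    exact h rfl
  · rw [rotSign, if_neg hc] at h2
    rw [coord_ofCoord hR, orbitSum_apply h2, turn_of_circuit_ne _ h, ite_self]

theorem vcoord_classChain (hR : ∀ p ∈ R, p.length = 2) (m : ℕ) (D : Cyc V) :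
    vcoord k R m (classChain k R m D) = 0 := by
  rw [classChain]
  split_ifs
  · exact vcoord_cut hR D
  · exact vcoord_ofCoord hR _

theorem classForm_of_circuit_ne (hR : ∀ p ∈ R, p.length = 2) {m : ℕ} {D E : Cyc V}
    (hE : Contributes k R m E) (h : E.circuit ≠ D.circuit) :
    classForm k R m D (classChain k R m E) = 0 := by
  rw [classForm, LinearMap.comp_apply]
  split_ifs
  · rw [Finsupp.linearCombination_apply, Finsupp.sum]
    refine Finset.sum_eq_zero fun F _ => ?_
    by_cases hF : F.circuit = E.circuit
    · rw [turn_of_circuit_ne _ (hF ▸ h), smul_zero]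
    · rw [coord_classChain_of_circuit_ne hR hE hF, zero_smul]
  · exact coord_classChain_of_circuit_ne hR hE (Ne.symm h)

theorem classForm_self (hR : ∀ p ∈ R, p.length = 2) {m : ℕ} {D : Cyc V}
    (hD : Contributes k R m D) : classForm k R m D (classChain k R m D) = 1 := by
  obtain ⟨-, h1, h2⟩ := hD
  rw [classForm, classChain, LinearMap.comp_apply]
  by_cases hc : IsCut R (m + 1) D
  · rw [rotSign, if_pos hc] at h2
    rw [if_pos hc, if_pos hc, coord_cut hR h1, Finsupp.linearCombination_single, turn_self h2,
      one_smul]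
  · rw [rotSign, if_neg hc] at h2
    rw [if_neg hc, if_neg hc, Finsupp.lapply_apply, coord_ofCoord hR, if_pos h1, orbitSum_apply h2,
      turn_self h2]

theorem classForm_vert (hR : ∀ p ∈ R, p.length = 2) (m : ℕ) (D : Cyc V) (e : V) :
    classForm k R m D (vert k R m e) = 0 := by
  rw [classForm, LinearMap.comp_apply, coord_vert hR, map_zero]

theorem classForm_chainsD (hR : ∀ p ∈ R, p.length = 2) {m : ℕ} {D : Cyc V}
    (hD : Contributes k R m D) (z : Chains k R (m + 1)) :
    classForm k R m D (chainsD k R m z) = 0 := by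
  obtain ⟨h0, h1, h2⟩ := hD
  rw [classForm, LinearMap.comp_apply]
  by_cases hc : IsCut R (m + 1) D
  · rw [rotSign, if_pos hc] at h2
    rw [if_pos hc]
    induction z using chains_induction hR with
    | h0 => simp
    | hadd z w hz hw => rw [map_add, map_add, map_add, hz, hw, add_zero]
    | hsmul c z hz => rw [map_smul, map_smul, map_smul, hz, smul_zero]
    | hv e => rw [vert_succ, map_zero, map_zero, map_zero]
    | hcut E hE =>
      obtain ⟨E, rfl⟩ := Cyc.rot_surjective E
      rw [chainsD_cut_rot hR hE, map_add, map_smul, map_add, map_smul]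
      by_cases h : E.circuit = D.circuit
      · obtain ⟨n, rfl⟩ := Cyc.exists_rot_iterate_of_circuit_eq h.symm
        have h3 := (isCut_iterate_of_isPure h0 m n).2 h1
        rw [coord_cut hR ((isCut_rot_of_isPure ((isPure_iterate D n).2 h0) m).2 h3),
          coord_cut hR h3, Finsupp.linearCombination_single, Finsupp.linearCombination_single,
          turn_rot h2, one_smul, one_smul, smul_eq_mul, pow_succ]
        ring
      · have h' : E.rot.circuit ≠ D.circuit := by rwa [Cyc.circuit_rot]
        have key : ∀ F : Cyc V, F.circuit ≠ D.circuit → Finsupp.linearCombination k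
            (turn ((-1 : k) ^ m) D) (coord k R m (cut k R m F)) = 0 := by
          intro F hF
          by_cases hF' : IsCut R m F
          · rw [coord_cut hR hF', Finsupp.linearCombination_single, turn_of_circuit_ne _ hF,
              smul_zero]
          · rw [cut_of_not_isCut hR hF', map_zero, map_zero]
        rw [key _ h, key _ h', smul_zero, add_zero]
  · have h3 : ∀ E : Cyc V, ¬ IsCut R (m + 1) E → coord k R (m + 1) z E = 0 := fun E hE => by
      by_contra hne
      exact hE (isCut_of_coord_ne_zero hR hne)
    rw [if_neg hc, Finsupp.lapply_apply, coord_chainsD hR, h3 D hc,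
      h3 D.rot (mt (isCut_rot_of_isPure h0 _).1 hc), mul_zero, add_zero, ite_self]

theorem chainsD_classChain (hR : ∀ p ∈ R, p.length = 2) {n : ℕ} {D : Cyc V}
    (hD : Contributes k R (n + 1) D) : chainsD k R n (classChain k R (n + 1) D) = 0 := by
  obtain ⟨h0, h1, h2⟩ := id hD
  refine chain_ext hR ?_ (by rw [vcoord_chainsD hR, map_zero])
  ext E
  rw [coord_chainsD hR, map_zero, Finsupp.zero_apply]
  split_ifs with hE
  swap
  · rfl
  by_cases h : E.circuit = D.circuit
  swap
  · rw [coord_classChain_of_circuit_ne hR hD h,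
      coord_classChain_of_circuit_ne hR hD (by rwa [Cyc.circuit_rot]), mul_zero, add_zero]
  obtain ⟨j, rfl⟩ := Cyc.exists_rot_iterate_of_circuit_eq h.symm
  -- a cycle cannot be cut in three successive degrees
  have hc : ¬ IsCut R (n + 2) D :=
    not_isCut_succ_succ ((isCut_iterate_of_isPure h0 n j).1 hE)
  have h3 := (isCut_iterate_of_isPure h0 (n + 1) j).2 h1
  have h4 := (isCut_rot_of_isPure ((isPure_iterate D j).2 h0) (n + 1)).2 h3
  rw [rotSign, if_neg hc] at h2
  rw [classChain, if_neg hc, coord_ofCoord hR, coord_ofCoord hR, if_pos h3, if_pos h4,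
    orbitSum_apply h2, orbitSum_apply h2, turn_rot h2]
  have h5 := neg_one_pow_mul_self (k := k) (n + 1)
  generalize turn ((-1 : k) ^ (n + 1 + 1)) D (Cyc.rot^[j] D) = t
  linear_combination -t * h5

/-- A cycle of the complex whose coordinates vanish at the complete and the cocomplete cycles is a
boundary, and the same coordinates, read one degree higher, give a preimage. -/
theorem ofCoord_eq_chainsD_of_not_isPure (hR : ∀ p ∈ R, p.length = 2) {m : ℕ} {f : Cyc V →₀ k}
    (h1 : ∀ D, f D ≠ 0 → IsCut R m D ∧ ¬ IsPure R D)
    (h2 : ∀ n, m = n + 1 → ∀ D, IsCut R n D → f D + (-1) ^ m * f D.rot = 0) :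
    ofCoord k R m f = chainsD k R m (ofCoord k R (m + 1) f) := by
  refine chain_ext hR ?_ (by rw [vcoord_chainsD hR, vcoord_ofCoord hR])
  ext D
  rw [coord_ofCoord hR, coord_chainsD hR, coord_ofCoord hR, coord_ofCoord hR]
  by_cases hD : IsCut R m D
  swap
  · rw [if_neg hD, if_neg hD]
  rw [if_pos hD, if_pos hD]
  by_cases hp : IsPure R D
  · have h3 : f D = 0 := by
      by_contra h
      exact (h1 D h).2 hp
    have h4 : f D.rot = 0 := by
      by_contra h
      exact (h1 _ h).2 ((isPure_rot D).2 hp)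
    simp [h3, h4]
  have hrot : f D.rot ≠ 0 → (IsCut R (m + 1) D.rot ↔ ¬ IsCut R (m + 1) D) := fun h =>
    isCut_succ_rot_iff hp hD (h1 _ h).1
  by_cases hc : IsCut R (m + 1) D
  · rw [if_pos hc]
    by_cases h : f D.rot = 0
    · simp [h]
    · rw [if_neg ((hrot h).not.2 (not_not.2 hc)), mul_zero, add_zero]
  · obtain ⟨n, hn, hcut⟩ := isCut_pred_of_not_isCut_succ hD hc
    have h3 := h2 n hn D hcut
    rw [if_neg hc, zero_add]
    by_cases h : f D.rot = 0
    · rw [h, mul_zero, add_zero] at h3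
      simp [h, h3]
    · rw [if_pos ((hrot h).2 hc), pow_succ]
      linear_combination h3

/-- Modulo boundaries, the rotation acts by a sign on the basis elements of a circuit that are
the image of basis elements of the next degree. -/
theorem cut_iterate_mem (hR : ∀ p ∈ R, p.length = 2) {m : ℕ} {W : Submodule k (Chains k R m)}
    (hW : ∀ z, chainsD k R m z ∈ W) {D : Cyc V} (h0 : IsPure R D) (hc : IsCut R (m + 1) D)
    (n : ℕ) : cut k R m (Cyc.rot^[n] D) - ((-1 : k) ^ m) ^ n • cut k R m D ∈ W := by
  induction n with
  | zero => simp
  | succ n ih =>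
    rw [Function.iterate_succ_apply']
    have h1 : IsCut R (m + 1) (Cyc.rot^[n] D).rot := by
      rw [isCut_rot_of_isPure ((isPure_iterate D n).2 h0), isCut_iterate_of_isPure h0]
      exact hc
    have h2 := hW (cut k R (m + 1) (Cyc.rot^[n] D).rot)
    rw [chainsD_cut_rot hR h1] at h2
    have h3 := W.add_mem h2 (W.smul_mem ((-1 : k) ^ m) ih)
    convert h3 using 1
    rw [smul_sub, smul_smul, pow_succ, pow_succ]
    module

/-- The cycles of the complex are spanned by the boundaries, the pairs of trivial paths and the
chains `classChain k R m D`. -/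
theorem mem_of_mem_cycles (hR : ∀ p ∈ R, p.length = 2) {rep : Circuit V → Cyc V}
    (hrep : ∀ C, (rep C).circuit = C) {m : ℕ} {W : Submodule k (Chains k R m)}
    (hW : ∀ z, chainsD k R m z ∈ W) (hv : ∀ e, vert k R m e ∈ W)
    (hC : ∀ C, Contributes k R m (rep C) → classChain k R m (rep C) ∈ W) {z : Chains k R m}
    (hz : z ∈ cycles (X := fun n => Chains k R n) (chainsD k R) m) : z ∈ W := by
  classical
  have hcyc : ∀ n, m = n + 1 → ∀ D, IsCut R n D →
      coord k R m z D + (-1) ^ m * coord k R m z D.rot = 0 := by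
    rintro n rfl D hD
    have h1 : chainsD k R n z = 0 := hz
    have h2 := coord_chainsD hR z D
    rw [h1, map_zero, Finsupp.zero_apply, if_pos hD] at h2
    exact h2.symm
  have hrepE : ∀ E : Cyc V, ∃ n, Cyc.rot^[n] (rep E.circuit) = E := fun E =>
    Cyc.exists_rot_iterate_of_circuit_eq (hrep _)
  set f := coord k R m z with hf
  have hfc : ∀ D, f D ≠ 0 → IsCut R m D := fun D h => isCut_of_coord_ne_zero hR h
  rw [chain_eq hR z, ← hf]
  refine W.add_mem ?_ ?_
  swap
  · rw [Finsupp.linearCombination_apply]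
    exact W.sum_mem fun e _ => W.smul_mem _ (hv e)
  rw [← Finsupp.filter_add_filter_not f (IsPure R), map_add]
  refine W.add_mem ?_ ?_
  swap
  · rw [ofCoord_eq_chainsD_of_not_isPure hR]
    · exact hW _
    · intro D hD
      have h1 : ¬ IsPure R D := by
        by_contra h
        exact hD (Finsupp.filter_apply_neg (fun E => ¬ IsPure R E) f (not_not.2 h))
      rw [Finsupp.filter_apply_pos (fun E => ¬ IsPure R E) f h1] at hD
      exact ⟨hfc D hD, h1⟩
    · intro n hn D hD
      simp only [Finsupp.filter_apply, isPure_rot]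
      split_ifs
      · simp
      · exact hcyc n hn D hD
  set g := f.filter (IsPure R) with hg
  have hg1 : ∀ D, g D ≠ 0 → IsPure R D ∧ f D ≠ 0 := by
    intro D hD
    rw [hg, Finsupp.filter_apply] at hD
    split_ifs at hD with h
    · exact ⟨h, hD⟩
    · exact absurd rfl hD
  rw [← Finsupp.filter_add_filter_not g (IsCut R (m + 1)), map_add]
  refine W.add_mem ?_ ?_
  · rw [ofCoord, Finsupp.linearCombination_apply]
    refine W.sum_mem fun E hE => W.smul_mem _ ?_
    rw [Finsupp.mem_support_iff, Finsupp.filter_apply] at hE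
    split_ifs at hE with hc
    swap
    · exact absurd rfl hE
    obtain ⟨h0, h1⟩ := hg1 E hE
    have h2 := hfc E h1
    obtain ⟨n, hn⟩ := hrepE E
    set D := rep E.circuit with hD
    rw [← hn, isPure_iterate] at h0
    rw [← hn, isCut_iterate_of_isPure h0] at hc h2
    have key : cut k R m D ∈ W := by
      by_cases hs : ((-1 : k) ^ m) ^ D.period = 1
      · have := hC E.circuit ⟨h0, h2, by rw [rotSign, if_pos hc]; exact hs⟩
        rwa [classChain, if_pos hc] at this
      · -- the class is mapped by the rotation to a multiple of itself different from itself
        have h3 := cut_iterate_mem hR hW h0 hc D.period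
        have h4 : Cyc.rot^[D.period] D = D := Function.iterate_minimalPeriod
        rw [h4] at h3
        have h5 : cut k R m D - ((-1 : k) ^ m) ^ D.period • cut k R m D =
            (1 - ((-1 : k) ^ m) ^ D.period) • cut k R m D := by rw [sub_smul, one_smul]
        rw [h5] at h3
        exact (W.smul_mem_iff (sub_ne_zero.2 (Ne.symm hs))).1 h3
    have h3 := W.add_mem (cut_iterate_mem hR hW h0 hc n) (W.smul_mem (((-1 : k) ^ m) ^ n) key)
    rwa [sub_add_cancel, hn] at h3
  · set q := g.filter (fun D => ¬ IsCut R (m + 1) D) with hq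
    have hq1 : ∀ D, q D ≠ 0 → IsPure R D ∧ ¬ IsCut R (m + 1) D ∧ f D ≠ 0 := by
      intro D hD
      rw [hq, Finsupp.filter_apply] at hD
      split_ifs at hD with h
      · exact absurd rfl hD
      · exact ⟨(hg1 D hD).1, h, (hg1 D hD).2⟩
    have hq2 : ∀ D, IsPure R D → ¬ IsCut R (m + 1) D → q D = f D := by
      intro D h h'
      rw [hq, Finsupp.filter_apply_pos (fun D => ¬ IsCut R (m + 1) D) g h', hg,
        Finsupp.filter_apply_pos _ _ h]
    -- the coordinates change by a sign under rotation
    have hrot : ∀ D, q D.rot = (-1 : k) ^ (m + 1) * q D := by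
      intro D
      by_cases hD : IsPure R D ∧ ¬ IsCut R (m + 1) D
      · obtain ⟨h0, h1⟩ := hD
        rw [hq2 D h0 h1, hq2 D.rot ((isPure_rot D).2 h0) (mt (isCut_rot_of_isPure h0 _).1 h1)]
        by_cases h2 : IsCut R m D
        · obtain ⟨n, hn, hcut⟩ := isCut_pred_of_not_isCut_succ h2 h1
          have h3 := hcyc n hn D hcut
          have h4 := neg_one_pow_mul_self (k := k) m
          rw [pow_succ]
          linear_combination (-1 : k) ^ m * h3 - f D.rot * h4
        · have h3 : f D = 0 := by
            by_contra h
            exact h2 (hfc D h)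
          have h4 : f D.rot = 0 := by
            by_contra h
            exact h2 ((isCut_rot_of_isPure h0 _).1 (hfc _ h))
          rw [h3, h4, mul_zero]
      · have h3 : q D = 0 := by
          by_contra h
          exact hD ⟨(hq1 D h).1, (hq1 D h).2.1⟩
        have h4 : q D.rot = 0 := by
          by_contra h
          have h0 := (isPure_rot D).1 (hq1 _ h).1
          exact hD ⟨h0, mt (isCut_rot_of_isPure h0 _).2 (hq1 _ h).2.1⟩
        rw [h3, h4, mul_zero]
    have hiter : ∀ (D : Cyc V) (n : ℕ), q (Cyc.rot^[n] D) = ((-1 : k) ^ (m + 1)) ^ n * q D := by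
      intro D n
      induction n with
      | zero => simp
      | succ n ih =>
        rw [Function.iterate_succ_apply', hrot, ih, pow_succ' ((-1 : k) ^ (m + 1)), mul_assoc]
    have hper : ∀ D : Cyc V, q D ≠ 0 → ((-1 : k) ^ (m + 1)) ^ D.period = 1 := by
      intro D hD
      have h1 := hiter D D.period
      rw [show Cyc.rot^[D.period] D = D from Function.iterate_minimalPeriod] at h1
      exact mul_right_cancel₀ hD (h1.symm.trans (one_mul _).symm)
    have hsum : q = ∑ C ∈ q.support.image Cyc.circuit,
        q (rep C) • orbitSum ((-1 : k) ^ (m + 1)) (rep C) := by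
      ext E
      rw [Finsupp.finsetSum_apply]
      obtain ⟨n, hn⟩ := hrepE E
      have h1 := hiter (rep E.circuit) n
      rw [hn] at h1
      rw [Finset.sum_eq_single E.circuit]
      · rw [Finsupp.smul_apply, smul_eq_mul]
        by_cases h : q (rep E.circuit) = 0
        · rw [h1, h, mul_zero, zero_mul]
        · have h2 := hper _ h
          have h3 := turn_iterate h2 n
          rw [hn] at h3
          rw [orbitSum_apply h2, h3, h1, mul_comm]
      · intro C _ hne
        rw [Finsupp.smul_apply, smul_eq_mul]
        by_cases h : q (rep C) = 0
        · rw [h, zero_mul]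
        · rw [orbitSum_apply (hper _ h), turn_of_circuit_ne _ (by rw [hrep]; exact hne.symm),
            mul_zero]
      · intro hE
        have h2 : q E = 0 := by
          by_contra h
          exact hE (Finset.mem_image_of_mem _ (Finsupp.mem_support_iff.2 h))
        have h3 : q (rep E.circuit) = 0 := by
          rw [h2] at h1
          exact (mul_eq_zero.1 h1.symm).resolve_left
            (pow_ne_zero _ (pow_ne_zero _ (neg_ne_zero.2 one_ne_zero)))
        rw [h3, zero_smul, Finsupp.zero_apply]
    rw [hsum, map_sum]
    refine W.sum_mem fun C _ => ?_
    rw [map_smul]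
    by_cases h : q (rep C) = 0
    · rw [h, zero_smul]
      exact W.zero_mem
    · obtain ⟨h0, h1, h2⟩ := hq1 _ h
      have := hC C ⟨h0, hfc _ h2, by rw [rotSign, if_neg h1]; exact hper _ h⟩
      rw [classChain, if_neg h1] at this
      exact W.smul_mem _ this

/-- The homology of the complex has a basis made of the pairs of trivial paths, in degree zero, and
of one class for each contributing circuit. The basis may be indexed by any type in bijection with
these data. -/
theorem homologyFreelySpannedBy_chainsD (hR : ∀ p ∈ R, p.length = 2) {rep : Circuit V → Cyc V}
    (hrep : ∀ C, (rep C).circuit = C) {m : ℕ} {ι : Type*} {z : ι → Chains k R m}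
    (κ : ι → V ⊕ Circuit V) (hκ : Function.Injective κ)
    (hv : ∀ e, Sum.inl e ∈ Set.range κ ↔ m = 0)
    (hC : ∀ C, Sum.inr C ∈ Set.range κ ↔ Contributes k R m (rep C))
    (hz : ∀ i, z i = Sum.elim (vert k R m) (fun C => classChain k R m (rep C)) (κ i)) :
    HomologyFreelySpannedBy (X := fun n => Chains k R n) (chainsD k R) m z := by
  classical
  rw [homologyFreelySpannedBy_iff]
  -- the linear forms that detect the basis elements
  let φ : V ⊕ Circuit V → Chains k R m →ₗ[k] k :=
    Sum.elim (fun e => Finsupp.lapply e ∘ₗ vcoord k R m) fun C => classForm k R m (rep C)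
  have hφd : ∀ i w, φ (κ i) (chainsD k R m w) = 0 := by
    intro i w
    rcases h : κ i with e | C
    · simp [φ, vcoord_chainsD hR]
    · exact classForm_chainsD hR ((hC C).1 ⟨i, h⟩) w
  have hφz : ∀ i j, φ (κ i) (z j) = if j = i then 1 else 0 := by
    intro i j
    rw [hz j]
    rcases hi : κ i with e | C <;> rcases hj : κ j with e' | C'
    · obtain rfl := (hv e).1 ⟨i, hi⟩
      have h1 : j = i ↔ e' = e := by
        rw [← hκ.eq_iff, hi, hj, Sum.inl.injEq]
      simp only [φ, Sum.elim_inl, LinearMap.comp_apply, vcoord_vert_zero hR, Finsupp.lapply_apply,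
        Finsupp.single_apply, h1]
    · have h1 : j ≠ i := fun h => by rw [h, hi] at hj; cases hj
      simp only [φ, Sum.elim_inl, Sum.elim_inr, LinearMap.comp_apply, vcoord_classChain hR,
        map_zero, if_neg h1]
    · have h1 : j ≠ i := fun h => by rw [h, hi] at hj; cases hj
      simp only [φ, Sum.elim_inl, Sum.elim_inr, classForm_vert hR, if_neg h1]
    · have h1 : j = i ↔ C' = C := by
        rw [← hκ.eq_iff, hi, hj, Sum.inr.injEq]
      have h2 := (hC C').1 ⟨j, hj⟩
      simp only [φ, Sum.elim_inr]
      split_ifs with h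
      · obtain rfl := h1.1 h
        exact classForm_self hR h2
      · exact classForm_of_circuit_ne hR h2 (by rw [hrep, hrep]; exact fun h' => h (h1.2 h'))
  refine ⟨fun i => ?_, fun c hc => ?_, fun w hw => ?_⟩
  · rw [hz i]
    cases m with
    | zero => exact Submodule.mem_top
    | succ m =>
      rcases h : κ i with e | C
      · exact absurd ((hv e).1 ⟨i, h⟩) (Nat.succ_ne_zero m)
      · exact chainsD_classChain hR ((hC C).1 ⟨i, h⟩)
  · obtain ⟨w, hw⟩ := hc
    ext i
    have h1 := hφd i w
    rw [hw, Finsupp.linearCombination_apply, map_finsuppSum] at h1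
    simp only [map_smul, hφz, smul_eq_mul, mul_ite, mul_one, mul_zero] at h1
    rw [Finsupp.sum_ite_self_eq'] at h1
    exact h1
  · have h1 : w ∈ boundaries (X := fun n => Chains k R n) (chainsD k R) m ⊔
        Submodule.span k (Set.range z) := by
      have hzmem : ∀ i, z i ∈ boundaries (X := fun n => Chains k R n) (chainsD k R) m ⊔
          Submodule.span k (Set.range z) := fun i =>
        Submodule.mem_sup_right (Submodule.subset_span ⟨i, rfl⟩)
      refine mem_of_mem_cycles hR hrep
        (fun y => Submodule.mem_sup_left (LinearMap.mem_range_self (chainsD k R m) y)) (fun e => ?_)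
        (fun C h => ?_) hw
      · cases m with
        | zero =>
          obtain ⟨i, hi⟩ := (hv e).2 rfl
          have := hzmem i
          rwa [hz i, hi] at this
        | succ m =>
          rw [vert_succ]
          exact Submodule.zero_mem _
      · obtain ⟨i, hi⟩ := (hC C).2 h
        have := hzmem i
        rwa [hz i, hi] at this
    obtain ⟨b, hb, s, hs, rfl⟩ := Submodule.mem_sup.1 h1
    obtain ⟨c, rfl⟩ := Finsupp.mem_span_range_iff_exists_finsupp.1 hs
    refine ⟨c, ?_⟩
    rwa [Finsupp.linearCombination_apply, add_sub_cancel_right]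

end SmallHomology

/-! ### The circuits that contribute in each degree -/

section Contributions

variable {k : Type*} [Field k] {V : Type*} [Quiver V] {R : Set (QPath V)}

/-- A complete cycle can only be cut with a component of length at most one on the left. -/
theorem isCut_iff_of_forall_junc {D : Cyc V} (hD : ∀ i, junc R D i) (m : ℕ) :
    IsCut R m D ↔ D.path.length = m ∨ D.path.length = m + 1 := by
  have hl := D.length_pos
  refine ⟨fun h => ?_, fun h => ⟨?_, fun i hi => ?_, fun i _ _ => hD i⟩⟩
  · by_contra hm
    have h1 := h.1
    simp only [QPath.length] at hm
    exact h.2.1 0 (by omega) (hD 0)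
  all_goals
    simp only [QPath.length] at h
    omega

/-- A cocomplete cycle can only be cut with a component of length at most one on the right. -/
theorem isCut_iff_of_forall_not_junc {D : Cyc V} (hD : ∀ i, ¬ junc R D i) (m : ℕ) :
    IsCut R m D ↔ m ≤ 1 := by
  have hl := D.length_pos
  refine ⟨fun h => ?_, fun h => ⟨by omega, fun i _ => hD i, fun i _ _ => by omega⟩⟩
  by_contra hm
  have h1 := h.1
  exact hD _ (h.2.2 (D.path.arrows.length - 2) (by omega) (by omega))

theorem contributes_iff_of_isComplete {D : Cyc V} (hD : D.IsComplete R) (m : ℕ) :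
    Contributes k R m D ↔ (D.path.length = m ∨ D.path.length = m + 1) ∧
      (-1 : k) ^ ((D.path.length + 1) * D.period) = 1 := by
  rw [isComplete_iff] at hD
  rw [Contributes, isCut_iff_of_forall_junc hD, rotSign, isCut_iff_of_forall_junc hD,
    and_iff_right (show IsPure R D from Or.inl hD)]
  refine and_congr_right fun h => ?_
  rw [pow_mul]
  rcases h with h | h
  · rw [if_neg (by omega), h]
  · rw [if_pos (Or.inl h), h, pow_succ, pow_succ, mul_assoc, neg_mul_neg, one_mul, mul_one]

theorem contributes_iff_of_isCocomplete (hR : ∀ p ∈ R, p.length = 2) {D : Cyc V}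
    (hD : D.IsCocomplete R) (m : ℕ) : Contributes k R m D ↔ m ≤ 1 := by
  rw [isCocomplete_iff hR] at hD
  rw [Contributes, isCut_iff_of_forall_not_junc hD, rotSign, isCut_iff_of_forall_not_junc hD,
    and_iff_right (show IsPure R D from Or.inr hD)]
  refine and_iff_left_of_imp fun h => ?_
  rcases Nat.le_one_iff_eq_zero_or_eq_one.1 h with rfl | rfl <;> simp

theorem not_isCocomplete_of_isComplete (hR : ∀ p ∈ R, p.length = 2) {D : Cyc V}
    (hD : D.IsComplete R) : ¬ D.IsCocomplete R := fun h =>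
  (isCocomplete_iff hR D).1 h 0 ((isComplete_iff D).1 hD 0)

theorem isComplete_iterate (D : Cyc V) (n : ℕ) :
    (Cyc.rot^[n] D).IsComplete R ↔ D.IsComplete R := by
  induction n with
  | zero => rfl
  | succ n ih =>
    rw [Function.iterate_succ_apply', ← ih, isComplete_iff, isComplete_iff]
    exact forall_junc_rot (P := fun p => p) _

theorem isCocomplete_iterate (hR : ∀ p ∈ R, p.length = 2) (D : Cyc V) (n : ℕ) :
    (Cyc.rot^[n] D).IsCocomplete R ↔ D.IsCocomplete R := by
  induction n with
  | zero => rfl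
  | succ n ih =>
    rw [Function.iterate_succ_apply', ← ih, isCocomplete_iff hR, isCocomplete_iff hR]
    exact forall_junc_rot (P := fun p => ¬ p) _

theorem length_iterate (D : Cyc V) (n : ℕ) : (Cyc.rot^[n] D).path.length = D.path.length := by
  rw [QPath.length, Cyc.rot_iterate_arrows, List.length_rotate, QPath.length]

theorem period_iterate (D : Cyc V) (n : ℕ) : (Cyc.rot^[n] D).period = D.period :=
  Function.minimalPeriod_apply_iterate
    (Function.mk_mem_periodicPts D.length_pos D.rot_iterate_length) n

variable {rep : Circuit V → Cyc V}

/-- A property of cycles invariant under rotation holds for all cycles of a circuit if it holds for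
a chosen one. -/
theorem forall_circuit_iff (hrep : ∀ C, (rep C).circuit = C) {P : Cyc V → Prop}
    (hP : ∀ D n, P (Cyc.rot^[n] D) ↔ P D) (C : Circuit V) :
    (∀ D : Cyc V, D.circuit = C → P D) ↔ P (rep C) := by
  refine ⟨fun h => h _ (hrep C), fun h D hD => ?_⟩
  obtain ⟨n, rfl⟩ := Cyc.exists_rot_iterate_of_circuit_eq ((hrep C).trans hD.symm)
  exact (hP _ n).2 h

theorem circuit_isCocomplete_iff (hR : ∀ p ∈ R, p.length = 2)
    (hrep : ∀ C, (rep C).circuit = C) (C : Circuit V) :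
    C.IsCocomplete R ↔ (rep C).IsCocomplete R :=
  forall_circuit_iff hrep (P := fun D => D.IsCocomplete R) (isCocomplete_iterate hR) C

theorem mem_signedCompleteCircuits_iff (hrep : ∀ C, (rep C).circuit = C) {l : ℕ}
    {C : Circuit V} : C ∈ signedCompleteCircuits k R l ↔ (rep C).IsComplete R ∧
      (rep C).path.length = l ∧ (-1 : k) ^ ((l + 1) * (rep C).period) = 1 := by
  refine and_congr (forall_circuit_iff hrep (P := fun D => D.IsComplete R) isComplete_iterate C)
    (and_congr (forall_circuit_iff hrep (P := fun D => D.path.length = l)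
      (fun D n => by rw [length_iterate]) C) ?_)
  have h : ∀ r, C.HasPeriod r ↔ (rep C).period = r := fun r =>
    forall_circuit_iff hrep (P := fun D => D.period = r) (fun D n => by rw [period_iterate]) C
  simp only [h]
  simp

theorem contributes_iff (hR : ∀ p ∈ R, p.length = 2) (hrep : ∀ C, (rep C).circuit = C) {m : ℕ}
    {C : Circuit V} : Contributes k R m (rep C) ↔ (C.IsCocomplete R ∧ m ≤ 1) ∨
      C ∈ signedCompleteCircuits k R m ∨ C ∈ signedCompleteCircuits k R (m + 1) := by
  rw [mem_signedCompleteCircuits_iff hrep, mem_signedCompleteCircuits_iff hrep,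
    circuit_isCocomplete_iff hR hrep]
  by_cases h1 : (rep C).IsComplete R
  · rw [contributes_iff_of_isComplete h1]
    have h2 := not_isCocomplete_of_isComplete hR h1
    constructor
    · rintro ⟨h | h, h'⟩
      · exact Or.inr (Or.inl ⟨h1, h, h ▸ h'⟩)
      · exact Or.inr (Or.inr ⟨h1, h, h ▸ h'⟩)
    · rintro (h | h | h)
      · exact absurd h.1 h2
      · exact ⟨Or.inl h.2.1, h.2.1.symm ▸ h.2.2⟩
      · exact ⟨Or.inr h.2.1, h.2.1.symm ▸ h.2.2⟩
  · by_cases h2 : (rep C).IsCocomplete R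
    · rw [contributes_iff_of_isCocomplete hR h2]
      simp [h1, h2]
    · simp only [h1, h2, false_and, or_false, iff_false]
      rintro ⟨h | h, -⟩
      · exact h1 ((isComplete_iff _).2 h)
      · exact h2 ((isCocomplete_iff hR _).2 h)

theorem not_isCocomplete_of_mem (hR : ∀ p ∈ R, p.length = 2) (hrep : ∀ C, (rep C).circuit = C)
    {l : ℕ} {C : Circuit V} (h : C ∈ signedCompleteCircuits k R l) : ¬ C.IsCocomplete R := by
  rw [circuit_isCocomplete_iff hR hrep]
  exact not_isCocomplete_of_isComplete hR ((mem_signedCompleteCircuits_iff hrep).1 h).1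

theorem length_eq_of_mem (hrep : ∀ C, (rep C).circuit = C) {l : ℕ} {C : Circuit V}
    (h : C ∈ signedCompleteCircuits k R l) : (rep C).path.length = l :=
  ((mem_signedCompleteCircuits_iff hrep).1 h).2.1

theorem ofCoord_orbitSum (m : ℕ) (δ : k) (D : Cyc V) : ofCoord k R m (orbitSum δ D) =
    ∑ i ∈ Finset.range D.period, δ ^ i • cut k R m (Cyc.rot^[i] D) := by
  simp only [orbitSum, map_sum, map_smul, ofCoord_single]

theorem cyclePair_eq (hR : ∀ p ∈ R, p.length = 2) {D : Cyc V} (hD : D.IsCocomplete R) :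
    cyclePair k R D = classChain k R 0 D := by
  rw [isCocomplete_iff hR] at hD
  rw [classChain, if_pos ((isCut_iff_of_forall_not_junc hD _).2 le_rfl)]
  exact pair_eq_cut rfl rfl (List.append_nil _)

theorem cocompleteSum_eq (hR : ∀ p ∈ R, p.length = 2) {D : Cyc V} (hD : D.IsCocomplete R) :
    cocompleteSum k R D = classChain k R 1 D := by
  rw [isCocomplete_iff hR] at hD
  have hc : ¬ IsCut R (1 + 1) D := by
    rw [isCut_iff_of_forall_not_junc hD]
    omega
  rw [classChain, if_neg hc, ofCoord_orbitSum, cocompleteSum]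
  refine Finset.sum_congr rfl fun i _ => ?_
  rw [neg_one_sq, one_pow, one_smul]
  exact pair_eq_cut rfl rfl (List.dropLast_append_getLast _)

theorem completeSum_eq {m : ℕ} {D : Cyc V} (hD : D.IsComplete R) (hl : D.path.length = m) :
    completeSum k R m D = classChain k R m D := by
  rw [isComplete_iff] at hD
  have hc : ¬ IsCut R (m + 1) D := by
    rw [isCut_iff_of_forall_junc hD]
    omega
  rw [classChain, if_neg hc, ofCoord_orbitSum, completeSum]
  refine Finset.sum_congr rfl fun i _ => ?_
  rw [pow_mul, pair_eq_cut (D := Cyc.rot^[i] D) ((length_iterate D i).trans hl)]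
  · exact (Cyc.rot^[i] D).closed
  · rfl

theorem splitPair_eq {m : ℕ} {D : Cyc V} (hD : D.IsComplete R) (hl : D.path.length = m + 1) :
    splitPair k R m D = classChain k R m D := by
  rw [isComplete_iff] at hD
  rw [classChain, if_pos ((isCut_iff_of_forall_junc hD _).2 (Or.inl hl))]
  refine pair_eq_cut ?_ rfl (by simp [QPath.lastArrow, QPath.ofArrow, QPath.dropLastArrow])
  rw [QPath.length] at hl ⊢
  simp [QPath.dropLastArrow, hl]

/-! ### Loops with square zero -/

/-- A loop, as a cycle of length one. -/
def loopCyc (a : Quiver.Total V) (h : a.left = a.right) : Cyc V :=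
  ⟨QPath.ofArrow a, by simp [QPath.ofArrow], h⟩

theorem mem_squareZeroLoops_iff (hR : ∀ p ∈ R, p.length = 2) (a : Quiver.Total V) :
    a ∈ squareZeroLoops k R ↔ ∃ h : a.left = a.right, (loopCyc a h).IsComplete R := by
  refine exists_congr fun h => ?_
  rw [ofPath_mem_relIdeal_iff hR, mem_pathsB_iff hR, Cyc.IsComplete, mem_pathsΓ_iff]
  simp [QPath.comp, QPath.ofArrow, loopCyc]

theorem left_eq_right_of_mem {a : Quiver.Total V} (h : a ∈ squareZeroLoops k R) :
    a.left = a.right := h.fst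

/-- The circuit of a loop with square zero. -/
def loopCircuit (a : squareZeroLoops k R) : Circuit V :=
  (loopCyc a.1 (left_eq_right_of_mem a.2)).circuit

theorem eq_of_circuit_eq_of_length_one {D E : Cyc V} (h : D.circuit = E.circuit)
    (hD : D.path.length = 1) : D = E := by
  obtain ⟨n, rfl⟩ := Cyc.exists_rot_iterate_of_circuit_eq h
  refine Cyc.ext_arrows ?_
  obtain ⟨a, ha⟩ := List.length_eq_one_iff.1 hD
  rw [Cyc.rot_iterate_arrows, ha, List.rotate_singleton]

theorem rep_loopCircuit (hrep : ∀ C, (rep C).circuit = C) (a : squareZeroLoops k R) :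
    rep (loopCircuit a) = loopCyc a.1 (left_eq_right_of_mem a.2) :=
  (eq_of_circuit_eq_of_length_one (hrep _).symm rfl).symm

theorem loopCircuit_injective : Function.Injective (loopCircuit : squareZeroLoops k R → _) := by
  intro a b h
  have h1 := eq_of_circuit_eq_of_length_one h rfl
  have h2 : [a.1] = [b.1] := congrArg (fun D : Cyc V => D.path.arrows) h1
  exact Subtype.ext (List.singleton_injective h2)

theorem mem_range_loopCircuit_iff (hR : ∀ p ∈ R, p.length = 2) (hrep : ∀ C, (rep C).circuit = C)
    {C : Circuit V} : C ∈ Set.range (loopCircuit : squareZeroLoops k R → _) ↔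
      C ∈ signedCompleteCircuits k R 1 := by
  constructor
  · rintro ⟨a, rfl⟩
    rw [mem_signedCompleteCircuits_iff hrep, rep_loopCircuit hrep]
    obtain ⟨_, h⟩ := (mem_squareZeroLoops_iff hR a.1).1 a.2
    exact ⟨h, rfl, by rw [pow_mul, neg_one_sq, one_pow]⟩
  · rw [mem_signedCompleteCircuits_iff hrep]
    rintro ⟨h1, h2, -⟩
    obtain ⟨a, ha⟩ := List.length_eq_one_iff.1 h2
    have hc := (rep C).closed
    have hw := (rep C).path.isWalk
    rw [ha] at hw
    have h3 : a.left = a.right := hw.2.trans (hc.trans hw.1.symm)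
    have h4 : loopCyc a h3 = rep C := Cyc.ext_arrows ha.symm
    refine ⟨⟨a, (mem_squareZeroLoops_iff hR a).2 ⟨h3, h4 ▸ h1⟩⟩, ?_⟩
    rw [loopCircuit, h4, hrep]

theorem loopPairZero_eq (hR : ∀ p ∈ R, p.length = 2) (hrep : ∀ C, (rep C).circuit = C)
    (a : squareZeroLoops k R) :
    loopPairZero k R a.1 = classChain k R 0 (rep (loopCircuit a)) := by
  rw [rep_loopCircuit hrep]
  obtain ⟨_, h⟩ := (mem_squareZeroLoops_iff hR a.1).1 a.2
  rw [isComplete_iff] at h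
  rw [classChain, if_pos ((isCut_iff_of_forall_junc h (0 + 1)).2 (Or.inl rfl))]
  exact pair_eq_cut rfl rfl rfl

theorem loopPairOne_eq (hR : ∀ p ∈ R, p.length = 2) (hrep : ∀ C, (rep C).circuit = C)
    (a : squareZeroLoops k R) :
    loopPairOne k R a.1 = classChain k R 1 (rep (loopCircuit a)) := by
  rw [rep_loopCircuit hrep]
  obtain ⟨h', h⟩ := (mem_squareZeroLoops_iff hR a.1).1 a.2
  have hper : (loopCyc a.1 h').period = 1 :=
    Function.minimalPeriod_eq_one_iff_isFixedPt.2 (Cyc.rot_iterate_length (loopCyc a.1 h'))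
  rw [isComplete_iff] at h
  have hc : ¬ IsCut R (1 + 1) (loopCyc a.1 h') := by
    rw [isCut_iff_of_forall_junc h]
    simp [loopCyc, QPath.ofArrow, QPath.length]
  rw [classChain, if_neg hc, ofCoord_orbitSum, hper, Finset.sum_range_one, pow_zero, one_smul]
  exact pair_eq_cut rfl h' rfl

/-! ### The bases in the various degrees -/

theorem homologyFreelySpannedBy_zero (hR : ∀ p ∈ R, p.length = 2)
    (hrep : ∀ C, (rep C).circuit = C) :
    HomologyFreelySpannedBy (X := fun n => Chains k R n) (chainsD k R) 0
      (ι := V ⊕ {C : Circuit V // C.IsCocomplete R} ⊕ squareZeroLoops k R)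
      (Sum.elim (fun e => vertexPair k R e)
        (Sum.elim (fun C => cyclePair k R (rep C.1)) (fun a => loopPairZero k R a.1))) := by
  refine homologyFreelySpannedBy_chainsD hR hrep
    (Sum.elim Sum.inl (Sum.elim (fun C => Sum.inr C.1) fun a => Sum.inr (loopCircuit a)))
    ?_ ?_ ?_ ?_
  · refine Sum.inl_injective.sumElim ((Sum.inr_injective.comp Subtype.val_injective).sumElim
      (Sum.inr_injective.comp loopCircuit_injective) ?_) ?_
    · intro C a h
      have h1 := (mem_range_loopCircuit_iff (k := k) hR hrep).1 ⟨a, rfl⟩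
      exact not_isCocomplete_of_mem hR hrep h1 (Sum.inr_injective h ▸ C.2)
    · rintro e (C | a) <;> simp
  · simp
  · intro C
    rw [contributes_iff hR hrep, ← mem_range_loopCircuit_iff hR hrep]
    have h0 : C ∉ signedCompleteCircuits k R 0 := fun h =>
      (rep C).length_pos.ne' (length_eq_of_mem hrep h)
    simp [h0]
  · rintro (e | C | a)
    · rfl
    · exact cyclePair_eq hR ((circuit_isCocomplete_iff hR hrep _).1 C.2)
    · exact loopPairZero_eq hR hrep a

theorem homologyFreelySpannedBy_one (hR : ∀ p ∈ R, p.length = 2)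
    (hrep : ∀ C, (rep C).circuit = C) :
    HomologyFreelySpannedBy (X := fun n => Chains k R n) (chainsD k R) 1
      (ι := {C : Circuit V // C.IsCocomplete R} ⊕ squareZeroLoops k R ⊕
        signedCompleteCircuits k R 2)
      (Sum.elim (fun C => cocompleteSum k R (rep C.1))
        (Sum.elim (fun a => loopPairOne k R a.1) (fun C => splitPair k R 1 (rep C.1)))) := by
  refine homologyFreelySpannedBy_chainsD hR hrep (Sum.elim (fun C => Sum.inr C.1)
    (Sum.elim (fun a => Sum.inr (loopCircuit a)) fun C => Sum.inr C.1)) ?_ ?_ ?_ ?_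
  · refine (Sum.inr_injective.comp Subtype.val_injective).sumElim
      ((Sum.inr_injective.comp loopCircuit_injective).sumElim
        (Sum.inr_injective.comp Subtype.val_injective) ?_) ?_
    · intro a C h
      have h1 := (mem_range_loopCircuit_iff (k := k) hR hrep).1 ⟨a, rfl⟩
      have h2 := length_eq_of_mem hrep h1
      have h3 := length_eq_of_mem hrep C.2
      rw [Sum.inr_injective h] at h2
      omega
    · rintro C (a | C') h
      · have h1 := (mem_range_loopCircuit_iff (k := k) hR hrep).1 ⟨a, rfl⟩
        exact not_isCocomplete_of_mem hR hrep h1 (Sum.inr_injective h ▸ C.2)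
      · exact not_isCocomplete_of_mem hR hrep C'.2 (Sum.inr_injective h ▸ C.2)
  · simp
  · intro C
    rw [contributes_iff hR hrep, ← mem_range_loopCircuit_iff hR hrep]
    simp
  · rintro (C | a | C)
    · exact cocompleteSum_eq hR ((circuit_isCocomplete_iff hR hrep _).1 C.2)
    · exact loopPairOne_eq hR hrep a
    · exact splitPair_eq ((mem_signedCompleteCircuits_iff hrep).1 C.2).1
        (length_eq_of_mem hrep C.2)

theorem homologyFreelySpannedBy_of_two_le (hR : ∀ p ∈ R, p.length = 2)
    (hrep : ∀ C, (rep C).circuit = C) {m : ℕ} (hm : 2 ≤ m) :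
    HomologyFreelySpannedBy (X := fun n => Chains k R n) (chainsD k R) m
      (ι := signedCompleteCircuits k R m ⊕ signedCompleteCircuits k R (m + 1))
      (Sum.elim (fun C => completeSum k R m (rep C.1))
        (fun C => splitPair k R m (rep C.1))) := by
  refine homologyFreelySpannedBy_chainsD hR hrep
    (Sum.elim (fun C => Sum.inr C.1) fun C => Sum.inr C.1) ?_ ?_ ?_ ?_
  · refine (Sum.inr_injective.comp Subtype.val_injective).sumElim
      (Sum.inr_injective.comp Subtype.val_injective) ?_
    intro C C' h
    have h2 := length_eq_of_mem hrep C.2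
    have h3 := length_eq_of_mem hrep C'.2
    rw [Sum.inr_injective h] at h2
    omega
  · intro e
    simp
    omega
  · intro C
    rw [contributes_iff hR hrep]
    have h : ¬ m ≤ 1 := by omega
    simp [h]
  · rintro (C | C)
    · exact completeSum_eq ((mem_signedCompleteCircuits_iff hrep).1 C.2).1
        (length_eq_of_mem hrep C.2)
    · exact splitPair_eq ((mem_signedCompleteCircuits_iff hrep).1 C.2).1
        (length_eq_of_mem hrep C.2)

end Contributions

end QuadraticMonomial

end

theorem mainTheorem2 {k : Type*} [Field k] {V : Type*} [Quiver V]
    (R : Set (QuadraticMonomial.QPath V)) (hR : ∀ p ∈ R, p.length = 2)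
    (rep : QuadraticMonomial.Circuit V → QuadraticMonomial.Cyc V)
    (hrep : ∀ C, (rep C).circuit = C) :
    -- the canonical maps form a morphism of complexes from `k(B ⊙ Γ)` to the Hochschild complex
    (∀ (m : ℕ) (x : QuadraticMonomial.Chains k R (m + 1)),
      QuadraticMonomial.hochschildD k (QuadraticMonomial.MonomialAlgebra k R) m
          (QuadraticMonomial.toHochschild k R (m + 1) x) =
        QuadraticMonomial.toHochschild k R m (QuadraticMonomial.chainsD k R m x)) ∧
    -- degree zero
    QuadraticMonomial.HHFreelySpannedBy k R 0
      (ι := V ⊕ {C : QuadraticMonomial.Circuit V // C.IsCocomplete R} ⊕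
        QuadraticMonomial.squareZeroLoops k R)
      (Sum.elim (fun e => QuadraticMonomial.vertexPair k R e)
        (Sum.elim (fun C => QuadraticMonomial.cyclePair k R (rep C.1))
          (fun a => QuadraticMonomial.loopPairZero k R a.1))) ∧
    -- degree one
    QuadraticMonomial.HHFreelySpannedBy k R 1
      (ι := {C : QuadraticMonomial.Circuit V // C.IsCocomplete R} ⊕
        QuadraticMonomial.squareZeroLoops k R ⊕
        QuadraticMonomial.signedCompleteCircuits k R 2)
      (Sum.elim (fun C => QuadraticMonomial.cocompleteSum k R (rep C.1))
        (Sum.elim (fun a => QuadraticMonomial.loopPairOne k R a.1)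
          (fun C => QuadraticMonomial.splitPair k R 1 (rep C.1)))) ∧
    -- higher degrees
    (∀ m : ℕ, 2 ≤ m →
      QuadraticMonomial.HHFreelySpannedBy k R m
        (ι := QuadraticMonomial.signedCompleteCircuits k R m ⊕
          QuadraticMonomial.signedCompleteCircuits k R (m + 1))
        (Sum.elim (fun C => QuadraticMonomial.completeSum k R m (rep C.1))
          (fun C => QuadraticMonomial.splitPair k R m (rep C.1)))) := by
  refine ⟨QuadraticMonomial.hochschildD_toHochschild hR, ?_, ?_, fun m hm => ?_⟩
  · exact (QuadraticMonomial.homologyFreelySpannedBy_zero hR hrep).hhFreelySpannedBy hR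
  · exact (QuadraticMonomial.homologyFreelySpannedBy_one hR hrep).hhFreelySpannedBy hR
  · exact (QuadraticMonomial.homologyFreelySpannedBy_of_two_le hR hrep hm).hhFreelySpannedBy hR
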